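/- Let $A$ be a unital $C^*$-algebra, $Z$ a commutative $C^*$-algebra, and $\tau\colon A\to Z$ a trace, i.e. a continuous $\mathbb{C}$-linear map with $\tau(ab)=\tau(ba)$ for all $a,b\in A$. Let $M$ be a finite-dimensional (Hausdorff) smooth manifold and let $W\to M$ be a smooth finitely generated projective Hilbert $A$-module bundle: the fibres $W_x$ are right Hilbert $A$-modules, each isomorphic to the range of a projection $p=p^2=p^*\in M_n(A)$ acting on $A^n$ (with $n$ and $p$ depending on $x$), and $W$ is given by an atlas of local trivializations $W|_U\cong U\times V$ which are fibrewise isomorphisms of Hilbert $A$-modules (invertible adjointable $A$-linear maps) and whose transition functions are smooth maps into the Banach spaces $\operatorname{Hom}_A(V_1,V_2)$ of adjointable $A$-linear maps with the operator norm. A connection on $W$ is an additive map $\nabla\colon \Gamma(W)\to\Omega^1(M;W)$ with $\nabla(sf)=s\,df+\nabla(s)f$ for all $s\in\Gamma(W)$ and $f\in C^\infty(M;A)$. It is extended to $W$-valued forms by the Leibniz rule $\nabla(\alpha\otimes s)=d\alpha\otimes s+(-1)^{\deg\alpha}\alpha\wedge\nabla s$, and its curvature is the form $\Omega\in\Omega^2(M;\operatorname{End}_A(W))$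 with $\nabla(\nabla s)=\Omega s$ for all $s\in\Gamma(W)$. Put $\exp(\Omega)=\sum_{k\ge 0}\Omega^{k}/k!$, where $\Omega^k$ is the $k$-fold wedge power. Let $ev\colon\operatorname{End}_A(W_x)\cong W_x\otimes_A\operatorname{Hom}_A(W_x,A)\to A/[A,A]$ be the map induced by $v\otimes\phi\mapsto\phi(v)+[A,A]$, where $v\otimes\phi$ corresponds to the endomorphism $u\mapsto v\phi(u)$ and $[A,A]$ is the linear span of the commutators, and set $$\operatorname{ch}_\tau(\Omega):=\tau(ev(\exp(\Omega)))\in\Omega^{2*}(M;Z).$$ Then: 1. every connection $\nabla$ on $W$ has exactly one curvature form $\Omega\in\Omega^2(M;\operatorname{End}_A(W))$; 2. for the curvature $\Omega$ of any connection on $W$, the form $\operatorname{ch}_\tau(\Omega)$ is smooth and closed, i.e. its component in $\Omega^{2k}(M;Z)$ is smooth and closed for every $k\ge0$; 3. the class of $\operatorname{ch}_\tau(\Omega)$ in de Rham cohomology $H^{2*}(M;Z)$ does not depend on the connection: if $\Omega,\Omega'$ are the curvatures of two connections on $W$, then their components in $\Omega^{2k}(M;Z)$ define the same class in $H^{2k}(M;Z)$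 for every $k\ge 0$. -/

import Mathlib

set_option linter.unusedSectionVars false

open scoped Manifold ContDiff RightActions TensorProduct

noncomputable section

/-! ## Hilbert modules -/

/-- A (right) Hilbert `A`-module: a right `A`-module `V` with an `A`-valued inner product,
`A`-linear in the second variable, such that `v ↦ ‖⟪v, v⟫‖ ^ (1/2)` is a complete norm.
Right `A`-module structures are `Module Aᵐᵒᵖ V`, with `v <• a` for the action of `a` on `v`.
(Mathlib's `CStarModule` is the analogous notion for left `A`-modules.) -/
class HilbertModule (A : Type*) (V : Type*) [CStarAlgebra A] [PartialOrder A]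
    [NormedAddCommGroup V] [NormedSpace ℂ V] [Module Aᵐᵒᵖ V] extends Inner A V where
  algebraMap_smul : ∀ (v : V) (z : ℂ), v <• (algebraMap ℂ A z) = z • v
  inner_right_smul : ∀ (v w : V) (a : A), inner v (w <• a) = inner v w * a
  inner_left_add : ∀ u v w : V, inner (u + v) w = inner u w + inner v w
  star_inner : ∀ v w : V, star (inner w v) = inner v w
  inner_self_nonneg : ∀ v : V, 0 ≤ inner v v
  inner_self_eq_zero : ∀ v : V, inner v v = 0 ↔ v = 0
  norm_eq : ∀ v : V, ‖v‖ = √‖inner v v‖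
  complete : CompleteSpace V

section HilbertModules

variable {A : Type*} [CStarAlgebra A] [PartialOrder A] [StarOrderedRing A]

/-- `A` as a Hilbert module over itself, with `⟪a, b⟫ = a* b`. -/
instance : HilbertModule A A where
  inner a b := star a * b
  algebraMap_smul v z := by
    rw [op_smul_eq_mul, ← Algebra.commutes, Algebra.smul_def]
  inner_right_smul v w a := by simp [mul_assoc]
  inner_left_add u v w := by simp [add_mul]
  star_inner v w := by simp
  inner_self_nonneg v := star_mul_self_nonneg v
  inner_self_eq_zero v := CStarRing.star_mul_self_eq_zero_iff v
  norm_eq v := by rw [CStarRing.norm_star_mul_self, Real.sqrt_mul_self (norm_nonneg v)]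
  complete := inferInstance

variable {V W X : Type*}
  [NormedAddCommGroup V] [NormedSpace ℂ V] [Module Aᵐᵒᵖ V] [HilbertModule A V]
  [NormedAddCommGroup W] [NormedSpace ℂ W] [Module Aᵐᵒᵖ W] [HilbertModule A W]
  [NormedAddCommGroup X] [NormedSpace ℂ X] [Module Aᵐᵒᵖ X] [HilbertModule A X]

namespace HilbertModule

lemma norm_op_smul_le (v : V) (a : A) : ‖v <• a‖ ≤ ‖v‖ * ‖a‖ := by
  have h1 : inner A (v <• a) (v <• a) = star a * inner A v v * a := by
    rw [inner_right_smul, ← star_inner (v <• a) v, inner_right_smul, star_mul, star_inner]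
  have h2 : ‖inner A (v <• a) (v <• a)‖ ≤ ‖inner A v v‖ * ‖a‖ ^ 2 := by
    rw [h1]
    calc ‖star a * inner A v v * a‖ ≤ ‖star a‖ * ‖inner A v v‖ * ‖a‖ :=
          (norm_mul_le _ _).trans (by gcongr; exact norm_mul_le _ _)
      _ = ‖inner A v v‖ * ‖a‖ ^ 2 := by rw [norm_star]; ring
  rw [norm_eq (A := A) (v <• a), norm_eq (A := A) v]
  calc √‖inner A (v <• a) (v <• a)‖ ≤ √(‖inner A v v‖ * ‖a‖ ^ 2) := Real.sqrt_le_sqrt h2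
    _ = √‖inner A v v‖ * ‖a‖ := by
      rw [Real.sqrt_mul (norm_nonneg _), Real.sqrt_sq (norm_nonneg _)]

lemma smul_smul_right (v : V) (a b : A) : (v <• a) <• b = v <• (a * b) := by
  rw [smul_smul, MulOpposite.op_mul]

lemma complex_smul_smul (v : V) (z : ℂ) (a : A) : v <• (z • a) = z • (v <• a) := by
  rw [← algebraMap_smul (A := A) (v <• a) z, smul_smul_right, Algebra.smul_def, Algebra.commutes]

lemma smul_complex_smul (v : V) (z : ℂ) (a : A) : (z • v) <• a = z • (v <• a) := by
  rw [← algebraMap_smul (A := A) v z, smul_smul_right, ← complex_smul_smul, Algebra.smul_def]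

lemma inner_right_add (u v w : V) : inner A u (v + w) = inner A u v + inner A u w := by
  rw [← star_inner, inner_left_add, star_add, star_inner, star_inner]

lemma inner_left_smul (v w : V) (a : A) : inner A (v <• a) w = star a * inner A v w := by
  rw [← star_inner, inner_right_smul, star_mul, star_inner]

lemma inner_right_complex_smul (v w : V) (z : ℂ) : inner A v (z • w) = z • inner A v w := by
  rw [← algebraMap_smul (A := A) w z, inner_right_smul, ← Algebra.commutes, Algebra.smul_def]

lemma inner_left_complex_smul (v w : V) (z : ℂ) :
    inner A (z • v) w = (starRingEnd ℂ z) • inner A v w := by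
  rw [← star_inner, inner_right_complex_smul, star_smul, star_inner]; rfl

lemma inner_left_zero (w : V) : inner A (0 : V) w = 0 := by
  have := inner_left_complex_smul (A := A) (0 : V) w 0
  simpa using this

lemma inner_right_zero (w : V) : inner A w (0 : V) = 0 := by
  have := inner_right_complex_smul (A := A) w (0 : V) 0
  simpa using this

end HilbertModule

open HilbertModule

variable (A) in
/-- A continuous linear map is a *Hilbert `A`-module morphism* if it is `A`-linear and has an
adjoint. -/
structure IsHilbertHom (T : V →L[ℂ] W) : Prop where
  map_smul : ∀ (v : V) (a : A), T (v <• a) = T v <• a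
  exists_adjoint : ∃ S : W → V, ∀ v w, inner A (T v) w = inner A v (S w)

lemma IsHilbertHom.comp {T : W →L[ℂ] X} {S : V →L[ℂ] W} (hT : IsHilbertHom A T)
    (hS : IsHilbertHom A S) : IsHilbertHom A (T ∘L S) := by
  obtain ⟨T', hT'⟩ := hT.exists_adjoint
  obtain ⟨S', hS'⟩ := hS.exists_adjoint
  exact ⟨fun v a => by simp [hS.map_smul, hT.map_smul],
    ⟨S' ∘ T', fun v w => by simp [hT', hS']⟩⟩

lemma IsHilbertHom.add {T S : V →L[ℂ] W} (hT : IsHilbertHom A T) (hS : IsHilbertHom A S) :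
    IsHilbertHom A (T + S) := by
  obtain ⟨T', hT'⟩ := hT.exists_adjoint
  obtain ⟨S', hS'⟩ := hS.exists_adjoint
  exact ⟨fun v a => by simp [hS.map_smul, hT.map_smul],
    ⟨fun w => T' w + S' w, fun v w => by
      simp [inner_left_add, inner_right_add, hT', hS']⟩⟩

lemma IsHilbertHom.zero : IsHilbertHom A (0 : V →L[ℂ] W) :=
  ⟨fun v a => by simp, ⟨fun _ => 0, fun v w => by simp [inner_left_zero, inner_right_zero]⟩⟩

lemma IsHilbertHom.smul {T : V →L[ℂ] W} (hT : IsHilbertHom A T) (z : ℂ) :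
    IsHilbertHom A (z • T) := by
  obtain ⟨T', hT'⟩ := hT.exists_adjoint
  exact ⟨fun v a => by simp [hT.map_smul, smul_complex_smul],
    ⟨fun w => (starRingEnd ℂ z) • T' w, fun v w => by
      simp [inner_left_complex_smul, inner_right_complex_smul, hT']⟩⟩

variable (A) in
lemma IsHilbertHom.id : IsHilbertHom A (ContinuousLinearMap.id ℂ V) :=
  ⟨fun _ _ => rfl, ⟨fun w => w, fun _ _ => rfl⟩⟩

variable (A V W) in
/-- The Banach space `Hom_A(V, W)` of Hilbert `A`-module morphisms, with the operator norm. -/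
def HomA : Submodule ℂ (V →L[ℂ] W) where
  carrier := {T | IsHilbertHom A T}
  add_mem' := IsHilbertHom.add
  zero_mem' := IsHilbertHom.zero
  smul_mem' z _ h := h.smul z

variable (A V) in
/-- The algebra `End_A(V)` of Hilbert `A`-module endomorphisms, with the operator norm. -/
def EndA : Subalgebra ℂ (V →L[ℂ] V) where
  carrier := {T | IsHilbertHom A T}
  mul_mem' := IsHilbertHom.comp
  add_mem' := IsHilbertHom.add
  algebraMap_mem' z := by
    rw [Algebra.algebraMap_eq_smul_one]
    exact (IsHilbertHom.id A).smul z

instance : NormedRing (EndA A V) := Subalgebra.normedRing (EndA A V)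

instance : NormedAlgebra ℂ (EndA A V) := Subalgebra.toNormedAlgebra (EndA A V)

instance : NormedAddCommGroup (EndA A V) := NonUnitalNormedRing.toNormedAddCommGroup

instance : NormedSpace ℂ (EndA A V) := NormedAlgebra.toNormedSpace (EndA A V)

instance : NormedAlgebra ℝ (EndA A V) := NormedAlgebra.complexToReal

instance : NormedSpace ℝ (EndA A V) := NormedAlgebra.toNormedSpace (EndA A V)

variable (A V) in
/-- The inclusion of `End_A(V)` in the space of all continuous linear endomorphisms. -/
def EndA.incl : EndA A V →L[ℂ] (V →L[ℂ] V) := ⟨(EndA A V).val.toLinearMap, continuous_subtype_val⟩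

variable (A V) in
/-- `V` is a *finitely generated projective* Hilbert `A`-module: it is isomorphic as a Hilbert
`A`-module (by `j`) to the range of a projection `p = p² = p*` in `M_n(A)`, acting on `A^n`,
where `A^n` carries the inner product `⟪a, b⟫ = ∑ aᵢ* bᵢ`. -/
def IsFGP : Prop :=
  ∃ (n : ℕ) (p : Matrix (Fin n) (Fin n) A) (j : V →ₗ[Aᵐᵒᵖ] (Fin n → A)),
    p * p = p ∧ p.conjTranspose = p ∧
    (∀ v w : V, inner A v w = ∑ i, star (j v i) * j w i) ∧
    Set.range j = Set.range (fun x : Fin n → A => p.mulVec x)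

/-! ## Endomorphisms as tensors, and the evaluation map -/

/-- The morphism `a φ : x ↦ a * φ x`, which makes `Hom_A(V, A)` a left `A`-module. -/
def HomA.leftMul (a : A) (φ : HomA A V A) : HomA A V A :=
  ⟨(ContinuousLinearMap.mul ℂ A a) ∘L φ.1, by
    obtain ⟨S, hS⟩ := φ.2.exists_adjoint
    refine ⟨fun v b => ?_, ⟨fun b => S (star a * b), fun v b => ?_⟩⟩
    · simp [φ.2.map_smul, mul_assoc]
    · rw [← hS]
      simp only [inner, ContinuousLinearMap.comp_apply, ContinuousLinearMap.mul_apply', star_mul,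
        mul_assoc]⟩

variable (A V) in
/-- The relations `v a ⊗ φ = v ⊗ a φ`. -/
def balancedRel : Submodule ℂ (V ⊗[ℂ] HomA A V A) :=
  Submodule.span ℂ {t | ∃ (v : V) (a : A) (φ : HomA A V A),
    t = (v <• a) ⊗ₜ[ℂ] φ - v ⊗ₜ[ℂ] (HomA.leftMul a φ)}

variable (A V) in
/-- The (algebraic) tensor product `V ⊗_A Hom_A(V, A)` over the noncommutative algebra `A`. -/
abbrev BalancedTensor := (V ⊗[ℂ] HomA A V A) ⧸ balancedRel A V

/-- The rank one endomorphism `x ↦ v φ(x)`. -/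
def rankOne (v : V) (φ : HomA A V A) : EndA A V :=
  ⟨LinearMap.mkContinuous
    { toFun := fun x => v <• (φ.1 x)
      map_add' := fun x y => by rw [map_add, MulOpposite.op_add, add_smul]
      map_smul' := fun z x => by rw [map_smul, complex_smul_smul]; rfl }
    (‖v‖ * ‖φ.1‖) (fun x => (norm_op_smul_le v _).trans (by
      rw [mul_assoc]; gcongr; exact φ.1.le_opNorm x)), by
    obtain ⟨S, hS⟩ := φ.2.exists_adjoint
    refine ⟨fun x a => ?_, ⟨fun w => S (inner A v w), fun x w => ?_⟩⟩
    · change v <• (φ.1 (x <• a)) = (v <• (φ.1 x)) <• a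
      rw [φ.2.map_smul, smul_smul_right]; rfl
    · change inner A (v <• (φ.1 x)) w = _
      rw [inner_left_smul, ← hS]; rfl⟩

lemma rankOne_apply (v : V) (φ : HomA A V A) (x : V) :
    (rankOne v φ : V →L[ℂ] V) x = v <• (φ.1 x) := rfl

variable (A V) in
/-- The canonical map `ι : V ⊗_A Hom_A(V, A) → End_A(V)`, `v ⊗ φ ↦ (x ↦ v φ(x))`. -/
def iotaA : BalancedTensor A V →ₗ[ℂ] EndA A V :=
  (balancedRel A V).liftQ
    (TensorProduct.lift (LinearMap.mk₂ ℂ (fun (v : V) (φ : HomA A V A) => rankOne v φ)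
      (fun v w φ => by ext x; simp [rankOne_apply])
      (fun z v φ => by ext x; simp [rankOne_apply, smul_complex_smul])
      (fun v φ ψ => by ext x; simp [rankOne_apply, add_smul])
      (fun z v φ => by
        ext x
        change v <• ((z • φ.1) x) = z • (v <• (φ.1 x))
        rw [_root_.smul_apply, complex_smul_smul])))
    (by
      refine Submodule.span_le.2 ?_
      rintro _ ⟨v, a, φ, rfl⟩
      simp only [SetLike.mem_coe, LinearMap.mem_ker, map_sub, TensorProduct.lift.tmul,
        LinearMap.mk₂_apply, sub_eq_zero]
      ext x
      rw [rankOne_apply, rankOne_apply, smul_smul_right]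
      rfl)

variable (A) in
/-- The subspace `[A, A]` of `A` spanned by the commutators. -/
def commSpan : Submodule ℂ A := Submodule.span ℂ {c | ∃ a b : A, c = a * b - b * a}

variable (A V) in
/-- The map `V ⊗_A Hom_A(V, A) → A/[A, A]`, `v ⊗ φ ↦ φ(v) + [A, A]`. -/
def evTensor : BalancedTensor A V →ₗ[ℂ] A ⧸ commSpan A :=
  (balancedRel A V).liftQ
    ((commSpan A).mkQ ∘ₗ TensorProduct.lift
      (LinearMap.mk₂ ℂ (fun (v : V) (φ : HomA A V A) => φ.1 v)
        (fun v w φ => map_add _ _ _) (fun z v φ => map_smul _ _ _)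
        (fun v φ ψ => rfl) (fun z v φ => rfl)))
    (by
      refine Submodule.span_le.2 ?_
      rintro _ ⟨v, a, φ, rfl⟩
      simp only [SetLike.mem_coe, LinearMap.mem_ker, map_sub, LinearMap.comp_apply,
        TensorProduct.lift.tmul, LinearMap.mk₂_apply]
      rw [← map_sub, Submodule.mkQ_apply, Submodule.Quotient.mk_eq_zero]
      refine Submodule.subset_span ⟨φ.1 v, a, ?_⟩
      rw [φ.2.map_smul]
      rfl)

/-- A finitely generated projective module has a finite frame. -/
lemma IsFGP.exists_frame (h : IsFGP A V) : ∃ (n : ℕ) (e : Fin n → V) (φ : Fin n → HomA A V A),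
    ∀ v, ∑ i, e i <• ((φ i).1 v) = v := by
  obtain ⟨n, p, j, hpp, hps, hj, hr⟩ := h
  have hinj : Function.Injective j := by
    intro v w hvw
    have h0 : j (v - w) = 0 := by rw [map_sub, hvw, sub_self]
    have : inner A (v - w) (v - w) = 0 := by rw [hj, h0]; simp
    exact sub_eq_zero.1 ((inner_self_eq_zero _).1 this)
  have hp : ∀ v, p.mulVec (j v) = j v := by
    intro v
    obtain ⟨x, hx⟩ : j v ∈ Set.range (fun x : Fin n → A => p.mulVec x) := hr ▸ ⟨v, rfl⟩
    simp only at hx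
    rw [← hx, Matrix.mulVec_mulVec, hpp]
  have he : ∀ i, ∃ e : V, j e = p.mulVec (Pi.single i 1) := by
    intro i
    have : p.mulVec (Pi.single i 1) ∈ Set.range j := hr ▸ ⟨_, rfl⟩
    exact this
  choose e he using he
  have hje : ∀ i k, j (e i) k = p k i := by intro i k; rw [he]; simp
  have hz : ∀ (z : ℂ) (v : V), j (z • v) = z • j v := by
    intro z v
    rw [← algebraMap_smul (A := A) v z, map_smul]
    ext k
    simp [← Algebra.commutes, Algebra.smul_def]
  have hadj : ∀ i v, inner A (e i) v = j v i := by
    intro i v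
    rw [hj]
    conv_rhs => rw [← hp v]
    simp only [hje, Matrix.mulVec, dotProduct]
    refine Finset.sum_congr rfl fun k _ => ?_
    rw [← Matrix.conjTranspose_apply, hps]
  have hb : ∀ i v, ‖j v i‖ ≤ 1 * ‖v‖ := by
    intro i v
    rw [one_mul, norm_eq (A := A) v]
    refine Real.le_sqrt_of_sq_le ?_
    rw [sq, ← CStarRing.norm_star_mul_self, hj]
    refine CStarAlgebra.norm_le_norm_of_nonneg_of_le (star_mul_self_nonneg _) ?_
    exact Finset.single_le_sum (f := fun i => star (j v i) * j v i)
      (fun k _ => star_mul_self_nonneg _) (Finset.mem_univ i)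
  refine ⟨n, e, fun i => ⟨LinearMap.mkContinuous
    { toFun := fun v => j v i
      map_add' := fun v w => by simp
      map_smul' := fun z v => by simp [hz] } 1 (hb i), ?_⟩, fun v => ?_⟩
  · refine ⟨fun v a => by simp, ⟨fun a => e i <• a, fun v a => ?_⟩⟩
    rw [inner_right_smul, ← star_inner v (e i), hadj]
    rfl
  · refine hinj ?_
    rw [map_sum]
    ext k
    simp only [map_smul, Finset.sum_apply, Pi.smul_apply, hje]
    conv_rhs => rw [← hp v]
    rfl

lemma rankOne_sum_eq {n : ℕ} {e : Fin n → V} {φ : Fin n → HomA A V A}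
    (h : ∀ v, ∑ i, e i <• ((φ i).1 v) = v) (v : V) (ψ : HomA A V A) :
    (Submodule.Quotient.mk (v ⊗ₜ[ℂ] ψ) : BalancedTensor A V) =
      ∑ i, Submodule.Quotient.mk (((rankOne v ψ : EndA A V) : V →L[ℂ] V) (e i) ⊗ₜ[ℂ] φ i) := by
  have h1 : ψ = ∑ i, HomA.leftMul (ψ.1 (e i)) (φ i) := by
    ext x
    conv_lhs => rw [← h x]
    rw [map_sum, Submodule.coe_sum, _root_.sum_apply]
    refine Finset.sum_congr rfl fun i _ => ?_
    rw [ψ.2.map_smul]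
    rfl
  conv_lhs => rw [h1, TensorProduct.tmul_sum]
  rw [← Submodule.mkQ_apply, map_sum]
  refine Finset.sum_congr rfl fun i _ => ?_
  rw [Submodule.mkQ_apply, rankOne_apply, eq_comm, Submodule.Quotient.eq]
  exact Submodule.subset_span ⟨v, _, _, rfl⟩

lemma iotaA_frame {n : ℕ} {e : Fin n → V} {φ : Fin n → HomA A V A}
    (h : ∀ v, ∑ i, e i <• ((φ i).1 v) = v) (t : BalancedTensor A V) :
    ∑ i, (Submodule.Quotient.mk ((iotaA A V t : V →L[ℂ] V) (e i) ⊗ₜ[ℂ] φ i) :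
      BalancedTensor A V) = t := by
  obtain ⟨t, rfl⟩ := Submodule.Quotient.mk_surjective _ t
  induction t using TensorProduct.induction_on with
  | zero => simp
  | tmul v ψ => exact (rankOne_sum_eq h v ψ).symm
  | add s t hs ht =>
    rw [Submodule.Quotient.mk_add]
    conv_rhs => rw [← hs, ← ht]
    rw [← Finset.sum_add_distrib]
    refine Finset.sum_congr rfl fun i _ => ?_
    have h1 : (iotaA A V (Submodule.Quotient.mk s + Submodule.Quotient.mk t) : V →L[ℂ] V) (e i) =
        (iotaA A V (Submodule.Quotient.mk s) : V →L[ℂ] V) (e i) +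
          (iotaA A V (Submodule.Quotient.mk t) : V →L[ℂ] V) (e i) := by
      rw [map_add]; rfl
    rw [h1, TensorProduct.add_tmul, Submodule.Quotient.mk_add]

/-- For a finitely generated projective module, `ι` is an isomorphism. -/
lemma IsFGP.iotaA_bijective (h : IsFGP A V) : Function.Bijective (iotaA A V) := by
  obtain ⟨n, e, φ, hf⟩ := h.exists_frame
  constructor
  · intro s t hst
    rw [← iotaA_frame hf s, ← iotaA_frame hf t, hst]
  · intro T
    refine ⟨∑ i, Submodule.Quotient.mk ((T : V →L[ℂ] V) (e i) ⊗ₜ[ℂ] φ i), ?_⟩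
    rw [map_sum]
    ext x
    conv_rhs => rw [← hf x, map_sum]
    rw [AddSubmonoidClass.coe_finsetSum, _root_.sum_apply]
    refine Finset.sum_congr rfl fun i _ => ?_
    rw [T.2.map_smul]
    rfl

/-- The evaluation map `ev : End_A(V) ≅ V ⊗_A Hom_A(V, A) → A/[A, A]`. -/
def evA (h : IsFGP A V) : EndA A V →ₗ[ℂ] A ⧸ commSpan A :=
  evTensor A V ∘ₗ (LinearEquiv.ofBijective (iotaA A V) h.iotaA_bijective).symm.toLinearMap

lemma evA_eq_sum (h : IsFGP A V) {n : ℕ} {e : Fin n → V} {φ : Fin n → HomA A V A}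
    (hf : ∀ v, ∑ i, e i <• ((φ i).1 v) = v) (T : EndA A V) :
    evA h T = ∑ i, (commSpan A).mkQ ((φ i).1 ((T : V →L[ℂ] V) (e i))) := by
  obtain ⟨t, rfl⟩ := h.iotaA_bijective.2 T
  have : (LinearEquiv.ofBijective (iotaA A V) h.iotaA_bijective).symm (iotaA A V t) = t :=
    (LinearEquiv.ofBijective (iotaA A V) h.iotaA_bijective).symm_apply_apply t
  rw [evA, LinearMap.comp_apply, LinearEquiv.coe_coe, this]
  conv_lhs => rw [← iotaA_frame hf t, map_sum]
  rfl

variable {Z : Type*} [NonUnitalCommCStarAlgebra Z]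

/-- A trace factors through `A/[A, A]`. -/
def traceBar (τ : A →L[ℂ] Z) (hτ : ∀ a b : A, τ (a * b) = τ (b * a)) : A ⧸ commSpan A →ₗ[ℂ] Z :=
  (commSpan A).liftQ τ.toLinearMap (by
    refine Submodule.span_le.2 ?_
    rintro _ ⟨a, b, rfl⟩
    simp [hτ a b])

/-- The `Z`-valued trace `τ ∘ ev` on `End_A(V)`. -/
def traceEv (τ : A →L[ℂ] Z) (hτ : ∀ a b : A, τ (a * b) = τ (b * a)) (h : IsFGP A V) :
    EndA A V →L[ℂ] Z :=
  ⟨traceBar τ hτ ∘ₗ evA h, by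
    obtain ⟨n, e, φ, hf⟩ := h.exists_frame
    have : ∀ T : EndA A V, (traceBar τ hτ ∘ₗ evA h) T =
        ∑ i, τ ((φ i).1 ((T : V →L[ℂ] V) (e i))) := by
      intro T
      rw [LinearMap.comp_apply, evA_eq_sum h hf, map_sum]
      rfl
    change Continuous (fun T : EndA A V => (traceBar τ hτ ∘ₗ evA h) T)
    simp only [this]
    refine continuous_finsetSum _ fun i _ => τ.continuous.comp ((φ i).1.continuous.comp ?_)
    exact (ContinuousLinearMap.apply ℂ V (e i)).continuous.comp continuous_subtype_val⟩

end HilbertModules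

/-! ## Algebra of alternating forms -/

section Wedge

variable {T F G H : Type*} [AddCommGroup T] [Module ℝ T] [TopologicalSpace T]
  [NormedAddCommGroup F] [NormedSpace ℝ F] [NormedAddCommGroup G] [NormedSpace ℝ G]
  [NormedAddCommGroup H] [NormedSpace ℝ H]

lemma update_castAdd {p q : ℕ} (v : Fin (p + q) → T) (j : Fin p) (x : T) :
    (fun i => Function.update v (Fin.castAdd q j) x (Fin.castAdd q i)) =
      Function.update (fun i => v (Fin.castAdd q i)) j x ∧
    (fun i => Function.update v (Fin.castAdd q j) x (Fin.natAdd p i)) =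
      fun i => v (Fin.natAdd p i) := by
  refine ⟨Function.update_comp_eq_of_injective v (Fin.castAdd_injective p q) j x, ?_⟩
  funext i
  refine Function.update_of_ne (fun h => ?_) _ _
  have := congrArg Fin.val h
  simp at this
  lia

lemma update_natAdd {p q : ℕ} (v : Fin (p + q) → T) (j : Fin q) (x : T) :
    (fun i => Function.update v (Fin.natAdd p j) x (Fin.natAdd p i)) =
      Function.update (fun i => v (Fin.natAdd p i)) j x ∧
    (fun i => Function.update v (Fin.natAdd p j) x (Fin.castAdd q i)) =
      fun i => v (Fin.castAdd q i) := by
  refine ⟨Function.update_comp_eq_of_injective v (Fin.natAdd_injective q p) j x, ?_⟩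
  funext i
  refine Function.update_of_ne (fun h => ?_) _ _
  have := congrArg Fin.val h
  simp at this
  lia

/-- The multilinear map
`(v₁, …, v_{p+q}) ↦ B (α (v₁, …, v_p)) (β (v_{p+1}, …, v_{p+q}))`. -/
def formProd {p q : ℕ} (B : F →L[ℝ] G →L[ℝ] H) (α : T [⋀^Fin p]→L[ℝ] F)
    (β : T [⋀^Fin q]→L[ℝ] G) : ContinuousMultilinearMap ℝ (fun _ : Fin (p + q) => T) H where
  toFun v := B (α fun i => v (Fin.castAdd q i)) (β fun i => v (Fin.natAdd p i))
  map_update_add' := by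
    intro inst v i x y
    have : inst = instDecidableEqFin _ := Subsingleton.elim _ _
    subst this
    induction i using Fin.addCases with
    | left j => simp only [(update_castAdd v j _).1, (update_castAdd v j _).2, α.map_update_add,
        map_add, _root_.add_apply]
    | right j => simp only [(update_natAdd v j _).1, (update_natAdd v j _).2, β.map_update_add,
        map_add]
  map_update_smul' := by
    intro inst v i c x
    have : inst = instDecidableEqFin _ := Subsingleton.elim _ _
    subst this
    induction i using Fin.addCases with
    | left j => simp only [(update_castAdd v j _).1, (update_castAdd v j _).2, α.map_update_smul,
        map_smul, _root_.smul_apply]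
    | right j => simp only [(update_natAdd v j _).1, (update_natAdd v j _).2, β.map_update_smul,
        map_smul]
  cont := by
    have h1 : Continuous fun v : Fin (p + q) → T => α fun i => v (Fin.castAdd q i) :=
      α.cont.comp (continuous_pi fun i => continuous_apply _)
    have h2 : Continuous fun v : Fin (p + q) → T => β fun i => v (Fin.natAdd p i) :=
      β.cont.comp (continuous_pi fun i => continuous_apply _)
    exact (B.continuous.comp h1).clm_apply h2

/-- The wedge product of alternating forms with respect to a bilinear pairing `B`,
`(α ∧ β)(v₁, …, v_{p+q}) = 1/(p! q!) ∑_σ sgn(σ) B (α (v_{σ 1}, …)) (β (v_{σ (p+1)}, …))`. -/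
def wedge {p q : ℕ} (B : F →L[ℝ] G →L[ℝ] H) (α : T [⋀^Fin p]→L[ℝ] F)
    (β : T [⋀^Fin q]→L[ℝ] G) : T [⋀^Fin (p + q)]→L[ℝ] H :=
  ((p.factorial * q.factorial : ℝ)⁻¹) •
    ContinuousMultilinearMap.alternatization (formProd B α β)

/-- The `k`-fold wedge power of a `2`-form with values in an algebra. -/
def wedgePow {R : Type*} [NormedRing R] [NormedAlgebra ℝ R] (Ω : T [⋀^Fin 2]→L[ℝ] R) :
    (k : ℕ) → T [⋀^Fin (2 * k)]→L[ℝ] R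
  | 0 => ContinuousAlternatingMap.constOfIsEmpty ℝ T (Fin 0) (1 : R)
  | k + 1 => wedge (ContinuousLinearMap.mul ℝ R) (wedgePow Ω k) Ω

/-- The component of degree `2 k` of `exp Ω = ∑ₖ Ω^k / k!`. -/
def expForm {R : Type*} [NormedRing R] [NormedAlgebra ℝ R] (Ω : T [⋀^Fin 2]→L[ℝ] R)
    (k : ℕ) : T [⋀^Fin (2 * k)]→L[ℝ] R :=
  ((k.factorial : ℝ)⁻¹) • wedgePow Ω k

end Wedge

/-! ## Differential forms on manifolds -/

section Forms

variable {E : Type*} [NormedAddCommGroup E] [NormedSpace ℝ E]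
  {M : Type*} [TopologicalSpace M] [ChartedSpace E M]

variable (E) in
/-- Differential `k`-forms on `M` (not necessarily smooth) with values in the family `W` of
normed spaces. -/
abbrev DForm {M : Type*} [TopologicalSpace M] [ChartedSpace E M] (W : M → Type*)
    [∀ x, NormedAddCommGroup (W x)] [∀ x, NormedSpace ℝ (W x)] (k : ℕ) :=
  ∀ x : M, TangentSpace 𝓘(ℝ, E) x [⋀^Fin k]→L[ℝ] W x

/-- The expression of a form in a chart `e`: its pullback by `e⁻¹`. -/
def DForm.inChart {W : M → Type*} [∀ x, NormedAddCommGroup (W x)] [∀ x, NormedSpace ℝ (W x)]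
    {k : ℕ} (α : DForm E W k) (e : OpenPartialHomeomorph M E) (y : E) :
    E [⋀^Fin k]→L[ℝ] W (e.symm y) :=
  (α (e.symm y)).compContinuousLinearMap
    (mfderiv 𝓘(ℝ, E) 𝓘(ℝ, E) e.symm y : E →L[ℝ] TangentSpace 𝓘(ℝ, E) (e.symm y))

/-- Smoothness over `U` of a form with values in `W`, read through the trivialization
`T x : W x → V` over `U`: in all charts the coefficients are smooth. -/
def DForm.SmoothThrough {W : M → Type*} [∀ x, NormedAddCommGroup (W x)]
    [∀ x, NormedSpace ℝ (W x)] {k : ℕ} (α : DForm E W k) {V : Type*} [NormedAddCommGroup V]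
    [NormedSpace ℝ V] (U : Set M) (T : ∀ x, W x →L[ℝ] V) : Prop :=
  ∀ e ∈ atlas E M, ContDiffOn ℝ ∞
    (fun y => (T (e.symm y)).compContinuousAlternatingMap (α.inChart e y))
    (e.target ∩ e.symm ⁻¹' U)

variable {F : Type*} [NormedAddCommGroup F] [NormedSpace ℝ F]

/-- The differential `df` of a function with values in a fixed normed space. -/
def differential (f : M → F) (x : M) : TangentSpace 𝓘(ℝ, E) x →L[ℝ] F :=
  mfderiv 𝓘(ℝ, E) 𝓘(ℝ, F) f x

/-- Smooth forms with values in a fixed normed space. -/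
def DForm.IsSmooth {k : ℕ} (α : DForm E (fun _ : M => F) k) : Prop :=
  α.SmoothThrough Set.univ (fun _ => ContinuousLinearMap.id ℝ F)

/-- The exterior derivative of a form with values in a fixed normed space, computed at `x` in the
preferred chart at `x`. -/
def DForm.d {k : ℕ} (α : DForm E (fun _ : M => F) k) : DForm E (fun _ : M => F) (k + 1) :=
  fun x => (extDeriv (fun y => α.inChart (chartAt E x) y)
      (chartAt E x x)).compContinuousLinearMap
    (mfderiv 𝓘(ℝ, E) 𝓘(ℝ, E) (chartAt E x) x : TangentSpace 𝓘(ℝ, E) x →L[ℝ] E)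

lemma DForm.IsSmooth.contDiffOn {k : ℕ} {α : DForm E (fun _ : M => F) k} (h : α.IsSmooth)
    {e : OpenPartialHomeomorph M E} (he : e ∈ atlas E M) :
    ContDiffOn ℝ ∞ (fun y => α.inChart e y) e.target := by
  have := h e he
  simp only [Set.preimage_univ, Set.inter_univ] at this
  exact this

lemma DForm.IsSmooth.of_contDiffOn {k : ℕ} {α : DForm E (fun _ : M => F) k}
    (h : ∀ e ∈ atlas E M, ContDiffOn ℝ ∞ (fun y => α.inChart e y) e.target) : α.IsSmooth := by
  intro e he
  simp only [Set.preimage_univ, Set.inter_univ]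
  exact h e he

lemma DForm.IsSmooth.differentiableAt {k : ℕ} {α : DForm E (fun _ : M => F) k} (h : α.IsSmooth)
    (x : M) : DifferentiableAt ℝ (fun y => α.inChart (chartAt E x) y) (chartAt E x x) :=
  ((h.contDiffOn (chart_mem_atlas E x)).contDiffAt ((chartAt E x).open_target.mem_nhds
    (mem_chart_target E x))).differentiableAt (by simp)

lemma DForm.IsSmooth.add {k : ℕ} {α β : DForm E (fun _ : M => F) k} (hα : α.IsSmooth)
    (hβ : β.IsSmooth) : (α + β).IsSmooth :=
  .of_contDiffOn fun _ he => (hα.contDiffOn he).add (hβ.contDiffOn he)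

lemma DForm.IsSmooth.smul {k : ℕ} {α : DForm E (fun _ : M => F) k} (hα : α.IsSmooth) (c : ℝ) :
    (c • α).IsSmooth :=
  .of_contDiffOn fun _ he => (hα.contDiffOn he).const_smul c

lemma DForm.isSmooth_zero {k : ℕ} : (0 : DForm E (fun _ : M => F) k).IsSmooth :=
  .of_contDiffOn fun _ _ => contDiffOn_const (c := 0)

lemma DForm.d_add {k : ℕ} {α β : DForm E (fun _ : M => F) k} (hα : α.IsSmooth)
    (hβ : β.IsSmooth) : (α + β).d = α.d + β.d := by
  funext x
  have := extDeriv_fun_add (hα.differentiableAt x) (hβ.differentiableAt x)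
  ext v
  exact DFunLike.congr_fun this _

lemma DForm.d_smul {k : ℕ} (α : DForm E (fun _ : M => F) k) (c : ℝ) : (c • α).d = c • α.d := by
  funext x
  have := extDeriv_fun_smul c (fun y => α.inChart (chartAt E x) y) (x := chartAt E x x)
  ext v
  exact DFunLike.congr_fun this _

lemma DForm.d_zero {k : ℕ} : (0 : DForm E (fun _ : M => F) k).d = 0 := by
  have := DForm.d_smul (0 : DForm E (fun _ : M => F) k) 0
  rwa [zero_smul, zero_smul] at this

variable (E M F) in
/-- The space of closed smooth `k`-forms. -/
def closedForms (k : ℕ) : Submodule ℝ (DForm E (fun _ : M => F) k) where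
  carrier := {α | α.IsSmooth ∧ α.d = 0}
  add_mem' hα hβ := ⟨hα.1.add hβ.1, by rw [DForm.d_add hα.1 hβ.1, hα.2, hβ.2, add_zero]⟩
  zero_mem' := ⟨DForm.isSmooth_zero, DForm.d_zero⟩
  smul_mem' c _ hα := ⟨hα.1.smul c, by rw [DForm.d_smul, hα.2, smul_zero]⟩

variable (E M F) in
/-- The subspace of exact forms `dη`, with `η` smooth, of the space of closed forms. -/
def exactForms : (k : ℕ) → Submodule ℝ (closedForms E M F k)
  | 0 => ⊥
  | k + 1 =>
    { carrier := {α | ∃ η : DForm E (fun _ : M => F) k, η.IsSmooth ∧ η.d = α.1}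
      add_mem' := by
        rintro _ _ ⟨η, h, h'⟩ ⟨θ, t, t'⟩
        exact ⟨η + θ, h.add t, by rw [DForm.d_add h t, h', t']; rfl⟩
      zero_mem' := ⟨0, DForm.isSmooth_zero, DForm.d_zero⟩
      smul_mem' := by
        rintro c _ ⟨η, h, h'⟩
        exact ⟨c • η, h.smul c, by rw [DForm.d_smul, h']; rfl⟩ }

variable (E M F) in
/-- De Rham cohomology with coefficients in `F`. -/
abbrev DeRham (k : ℕ) := closedForms E M F k ⧸ exactForms E M F k

/-- The cohomology class of a closed form. -/
def deRhamClass {k : ℕ} (α : DForm E (fun _ : M => F) k) (h : α ∈ closedForms E M F k) :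
    DeRham E M F k :=
  Submodule.Quotient.mk ⟨α, h⟩

end Forms

/-! ## Hilbert module bundles, connections and curvature -/

section Bundles

variable {A : Type*} [CStarAlgebra A] [PartialOrder A] [StarOrderedRing A]
  {E : Type*} [NormedAddCommGroup E] [NormedSpace ℝ E]
  {M : Type*} [TopologicalSpace M] [ChartedSpace E M]
  {W : M → Type*} [∀ x, NormedAddCommGroup (W x)] [∀ x, NormedSpace ℂ (W x)]
  [∀ x, Module Aᵐᵒᵖ (W x)] [∀ x, HilbertModule A (W x)]
  {ι : Type*} {V : ι → Type*} [∀ i, NormedAddCommGroup (V i)] [∀ i, NormedSpace ℂ (V i)]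
  [∀ i, Module Aᵐᵒᵖ (V i)] [∀ i, HilbertModule A (V i)]

variable (A E W V) in
/-- A smooth Hilbert `A`-module bundle over `M` with fibers `W x`, given by an atlas of local
trivializations `W|_{U i} ≅ U i × V i`, which are fiberwise isomorphisms of Hilbert `A`-modules,
with smooth transition functions `U i ∩ U j → Hom_A(V i, V j)`. The maps `triv i x : W x → V i` and
`symm i x : V i → W x` are meaningful only for `x` in `U i`. -/
structure SmoothHilbertBundle where
  U : ι → Set M
  isOpen_U : ∀ i, IsOpen (U i)
  iUnion_U : ⋃ i, U i = Set.univ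
  triv : ∀ (i : ι) (x : M), W x →L[ℂ] V i
  symm : ∀ (i : ι) (x : M), V i →L[ℂ] W x
  triv_hom : ∀ i, ∀ x ∈ U i, IsHilbertHom A (triv i x)
  symm_hom : ∀ i, ∀ x ∈ U i, IsHilbertHom A (symm i x)
  symm_triv : ∀ i, ∀ x ∈ U i, ∀ w : W x, symm i x (triv i x w) = w
  triv_symm : ∀ i, ∀ x ∈ U i, ∀ v : V i, triv i x (symm i x v) = v
  smooth_transition : ∀ i j, ContMDiffOn 𝓘(ℝ, E) 𝓘(ℝ, V i →L[ℂ] V j) ∞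
    (fun x => triv j x ∘L symm i x) (U i ∩ U j)

namespace SmoothHilbertBundle

variable (B : SmoothHilbertBundle A E W V)

/-- Smooth sections of the bundle. -/
def IsSmoothSection (s : ∀ x, W x) : Prop :=
  ∀ i, ContMDiffOn 𝓘(ℝ, E) 𝓘(ℝ, V i) ∞ (fun x => B.triv i x (s x)) (B.U i)

/-- Smooth forms with values in the bundle. -/
def IsSmoothForm {k : ℕ} (α : DForm E W k) : Prop :=
  ∀ i, α.SmoothThrough (B.U i) (fun x => (B.triv i x).restrictScalars ℝ)

/-- The trivialization `Φ ↦ φ Φ φ⁻¹` of the bundle `End_A(W)` over `U i`. -/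
def endTriv (i : ι) (x : M) : EndA A (W x) →L[ℝ] (V i →L[ℂ] V i) :=
  (((ContinuousLinearMap.compL ℂ (V i) (W x) (V i) (B.triv i x)) ∘L
    ((ContinuousLinearMap.compL ℂ (V i) (W x) (W x)).flip (B.symm i x))) ∘L
      EndA.incl A (W x)).restrictScalars ℝ

/-- Smooth forms with values in `End_A(W)`. -/
def IsSmoothEndForm {k : ℕ} (α : DForm E (fun x => EndA A (W x)) k) : Prop :=
  ∀ i, α.SmoothThrough (B.U i) (B.endTriv i)

/-- A connection on the bundle: an operator `∇ : Γ(W) → Ω¹(M; W)` which is additive and satisfies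
`∇(s f) = s df + ∇(s) f` for all smooth `f : M → A` (hence is `A`-linear). The values of `toFun` on
sections that are not smooth are irrelevant. -/
structure Connection where
  toFun : (∀ x, W x) → DForm E W 1
  smooth : ∀ s, B.IsSmoothSection s → B.IsSmoothForm (toFun s)
  map_add : ∀ s t, B.IsSmoothSection s → B.IsSmoothSection t →
    toFun (fun x => s x + t x) = fun x => toFun s x + toFun t x
  leibniz : ∀ s (f : M → A), B.IsSmoothSection s → ContMDiff 𝓘(ℝ, E) 𝓘(ℝ, A) ∞ f →
    ∀ (x : M) (ξ : Fin 1 → TangentSpace 𝓘(ℝ, E) x),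
      toFun (fun x => s x <• f x) x ξ =
        s x <• differential f x (ξ 0) + toFun s x ξ <• f x

variable {B}

/-- `Θ` is the image of the `W`-valued `p`-form `θ` under the extension of `∇` to forms by the
Leibniz rule `∇(α ⊗ t) = dα ⊗ t + (-1)^p α ∧ ∇ t`: whenever `θ = ∑ⱼ αⱼ ⊗ tⱼ` on an open set `O`,
with smooth real forms `αⱼ` and smooth sections `tⱼ`, then
`Θ = ∑ⱼ (dαⱼ ⊗ tⱼ + (-1)^p αⱼ ∧ ∇ tⱼ)` on `O`. -/
def Connection.Extends (D : B.Connection) {p : ℕ} (θ : DForm E W p) (Θ : DForm E W (p + 1)) :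
    Prop :=
  ∀ (O : Set M) (n : ℕ) (α : Fin n → DForm E (fun _ : M => ℝ) p) (t : Fin n → ∀ x, W x),
    IsOpen O → (∀ j, (α j).IsSmooth) → (∀ j, B.IsSmoothSection (t j)) →
    (∀ x ∈ O, ∀ ξ, θ x ξ = ∑ j, α j x ξ • t j x) →
    ∀ x ∈ O, ∀ ξ, Θ x ξ = ∑ j, ((α j).d x ξ • t j x +
      (-1 : ℝ) ^ p • wedge (ContinuousLinearMap.lsmul ℝ ℝ) (α j x) (D.toFun (t j) x) ξ)

/-- The `W`-valued form `Ω s` obtained by applying an `End_A(W)`-valued form to a section. -/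
def endApply {p : ℕ} (Ω : DForm E (fun x => EndA A (W x)) p) (s : ∀ x, W x) : DForm E W p :=
  fun x => (((ContinuousLinearMap.apply ℂ (W x) (s x)) ∘L EndA.incl A (W x)).restrictScalars
    ℝ).compContinuousAlternatingMap (Ω x)

/-- The smooth `End_A(W)`-valued `2`-form `Ω` is the curvature `∇ ∘ ∇` of the connection: for every
smooth section `s`, the extension of `∇` to `1`-forms maps `∇ s` to `Ω s`. -/
def Connection.IsCurvature (D : B.Connection) (Ω : DForm E (fun x => EndA A (W x)) 2) : Prop :=
  B.IsSmoothEndForm Ω ∧ ∀ s, B.IsSmoothSection s →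
    D.Extends (D.toFun s) (endApply Ω s)

end SmoothHilbertBundle

/-- The component of degree `2 k` of the form `ch_τ(Ω) = τ(ev(exp Ω))`. -/
def chernForm {Z : Type*} [NonUnitalCommCStarAlgebra Z] (τ : A →L[ℂ] Z)
    (hτ : ∀ a b : A, τ (a * b) = τ (b * a)) (hW : ∀ x, IsFGP A (W x))
    (Ω : DForm E (fun x => EndA A (W x)) 2) (k : ℕ) : DForm E (fun _ : M => Z) (2 * k) :=
  fun x => ((traceEv τ hτ (hW x)).restrictScalars ℝ).compContinuousAlternatingMap
    (expForm (Ω x) k)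

end Bundles

end

/-! This is Chern–Weil theory, reduced to identities for forms with values in one normed algebra R
with a trace T.

Reduction. Over a trivializing set with model fibre V a connection is d + ω, where ω is an
End_A(V)-valued 1-form, and its curvature should be F = dω + ω∧ω. A finite frame of V (vectors e_a
and functionals φ_a with v = Σ e_a φ_a(v)) turns τ∘ev into the functional S ↦ Σ τ(φ_a(S e_a)), which
does not vary with the point and is a trace on R = End_A(V): `traceEv_eq_frameTrace`,
`frameTrace_mul_comm`.

Curvature. In a trivialization, whenever ∇s = Σ α_j ⊗ t_j, the sum Σ (dα_j t_j − α_j ∧ ∇t_j) equals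
F s, whatever the decomposition (`curvature_apply_of_decomposition`). So the fibrewise endomorphisms
given by F form a curvature. It is the only one, because each vector is the value of a section and
each ∇s decomposes locally (`exists_decomposition`).

Closedness. Put ∇f = df + ωf − ε(f)ω, with ε the grading involution. A trace kills graded
commutators, so T(df) = T(∇f); as ∇ is a graded derivation and ∇F = 0 (Bianchi), T(F^k) is closed,
and d T(F^k θ) = T(F^k ∇θ). These identities are algebraic. They are proved in `GForm`, a ring whose
product and differential are defined by recursion on contraction with the first vector, so that each
identity is an induction on the degree; `hat_wedge` and `map_eval_d` translate them to `wedge` and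
`extDeriv`.

Independence. Join the connections by ∇_t = (1 − t)∇ + t∇' and put θ = ∇' − ∇. The curvature F_t is
quadratic in t with derivative ∇_t θ, hence d/dt T(F_t^{k+1}) = (k+1) d T(F_t^k θ), which is the
differential of a global form. Instead of integrating over t, the proof uses that T(F_t^{k+1}) is a
polynomial in t: if the derivative of a polynomial has all its values in a subspace, then so do its
non-constant coefficients (`sub_mem_of_deriv_mem`), hence also the difference of its values at 1 and
0. No topology on the space of forms is needed. -/

noncomputable section

/-! ## Graded forms with values in a noncommutative ring -/

/-- Families, indexed by the degree `n`, of functions of `n` vectors in `E` with values in `R`. -/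
def GForm (E R : Type*) := (n : ℕ) → (Fin n → E) → R

namespace GForm

variable {E R S C : Type*}

@[ext] lemma ext {f g : GForm E R} (h : ∀ n w, f n w = g n w) : f = g :=
  funext fun n => funext fun w => h n w

/-- Contraction with a vector, in the first slot. -/
def contr (v : E) (f : GForm E R) : GForm E R := fun n w => f (n + 1) (Fin.cons v w)

/-- Rewriting a component of positive degree as a contraction, and then contracting each operation
by its own rule, lowers the degree by one. All inductions on the degree below follow this pattern.
-/
lemma apply_succ (f : GForm E R) (n : ℕ) (w : Fin (n + 1) → E) :
    f (n + 1) w = contr (w 0) f n (Fin.tail w) := by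
  rw [contr, Fin.cons_self_tail]

section AddCommGroup

variable [AddCommGroup R] [AddCommGroup C]

instance : AddCommGroup (GForm E R) :=
  inferInstanceAs (AddCommGroup ((n : ℕ) → (Fin n → E) → R))

instance [Module ℝ R] : Module ℝ (GForm E R) :=
  inferInstanceAs (Module ℝ ((n : ℕ) → (Fin n → E) → R))

@[simp] lemma add_apply (f g : GForm E R) (n : ℕ) (w : Fin n → E) :
    (f + g) n w = f n w + g n w := rfl
@[simp] lemma sub_apply (f g : GForm E R) (n : ℕ) (w : Fin n → E) :
    (f - g) n w = f n w - g n w := rfl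
@[simp] lemma neg_apply (f : GForm E R) (n : ℕ) (w : Fin n → E) : (-f) n w = -f n w := rfl
@[simp] lemma zero_apply (n : ℕ) (w : Fin n → E) : (0 : GForm E R) n w = 0 := rfl
@[simp] lemma smul_apply [Module ℝ R] (c : ℝ) (f : GForm E R) (n : ℕ) (w : Fin n → E) :
    (c • f) n w = c • f n w := rfl

@[simp] lemma contr_add (v : E) (f g : GForm E R) : contr v (f + g) = contr v f + contr v g := rfl
@[simp] lemma contr_neg (v : E) (f : GForm E R) : contr v (-f) = -contr v f := rfl
@[simp] lemma contr_zero (v : E) : contr v (0 : GForm E R) = 0 := rfl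
@[simp] lemma contr_smul [Module ℝ R] (v : E) (c : ℝ) (f : GForm E R) :
    contr v (c • f) = c • contr v f := rfl

/-- The grading involution. -/
def eps (f : GForm E R) : GForm E R := fun n w => (-1 : ℤ) ^ n • f n w

@[simp] lemma eps_add (f g : GForm E R) : eps (f + g) = eps f + eps g := by
  ext n w; exact smul_add _ _ _
@[simp] lemma eps_sub (f g : GForm E R) : eps (f - g) = eps f - eps g := by
  ext n w; exact smul_sub _ _ _
@[simp] lemma eps_smul [Module ℝ R] (c : ℝ) (f : GForm E R) : eps (c • f) = c • eps f := by
  ext n w; exact smul_comm _ _ _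
@[simp] lemma eps_eps (f : GForm E R) : eps (eps f) = f := by
  ext n w
  simp [eps, smul_smul, ← mul_pow]

@[simp] lemma contr_eps (v : E) (f : GForm E R) : contr v (eps f) = -eps (contr v f) := by
  ext n w
  simp [contr, eps, pow_succ]

lemma eps_apply_zero (f : GForm E R) (w : Fin 0 → E) : eps f 0 w = f 0 w := by
  simp [eps]

/-- Application of an additive map to the coefficients. -/
def map (τ : R →+ C) (f : GForm E R) : GForm E C := fun n w => τ (f n w)

@[simp] lemma map_apply (τ : R →+ C) (f : GForm E R) (n : ℕ) (w : Fin n → E) :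
    map τ f n w = τ (f n w) := rfl
@[simp] lemma map_add (τ : R →+ C) (f g : GForm E R) : map τ (f + g) = map τ f + map τ g := by
  ext n w; simp
@[simp] lemma map_sub (τ : R →+ C) (f g : GForm E R) : map τ (f - g) = map τ f - map τ g := by
  ext n w; simp
@[simp] lemma map_neg (τ : R →+ C) (f : GForm E R) : map τ (-f) = -map τ f := by
  ext n w; simp
@[simp] lemma map_zero (τ : R →+ C) : map τ (0 : GForm E R) = 0 := by
  ext n w; simp
lemma contr_map (τ : R →+ C) (v : E) (f : GForm E R) : contr v (map τ f) = map τ (contr v f) := rfl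
lemma eps_map (τ : R →+ C) (f : GForm E R) : eps (map τ f) = map τ (eps f) := by
  ext n w; simp [eps]

/-- The exterior derivative defined by `D : E → R →+ R`, characterized by Cartan's formula. -/
def extd (D : E → R →+ R) : (n : ℕ) → GForm E R → (Fin n → E) → R
  | 0, _, _ => 0
  | n + 1, f, w => D (w 0) (f n (Fin.tail w)) - extd D n (contr (w 0) f) (Fin.tail w)

/-- The exterior derivative as an operator on forms. -/
def d (D : E → R →+ R) (f : GForm E R) : GForm E R := fun n w => extd D n f w

lemma d_zero_apply (D : E → R →+ R) (f : GForm E R) (w : Fin 0 → E) : d D f 0 w = 0 := rfl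

@[simp] lemma contr_d (D : E → R →+ R) (v : E) (f : GForm E R) :
    contr v (d D f) = map (D v) f - d D (contr v f) := by
  ext n w
  simp [contr, d, extd]

lemma d_add (D : E → R →+ R) (f g : GForm E R) : d D (f + g) = d D f + d D g := by
  ext n w
  induction n generalizing f g with
  | zero => simp [d_zero_apply]
  | succ n ih =>
    simp only [apply_succ _ n w, contr_d, contr_add, map_add, sub_apply, add_apply, ih]
    abel

lemma d_zero (D : E → R →+ R) : d D (0 : GForm E R) = 0 := by
  simpa using d_add D (0 : GForm E R) 0

lemma d_neg (D : E → R →+ R) (f : GForm E R) : d D (-f) = -d D f := by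
  rw [eq_neg_iff_add_eq_zero, ← d_add, neg_add_cancel, d_zero]

lemma eps_d (D : E → R →+ R) (f : GForm E R) : eps (d D f) = -d D (eps f) := by
  ext n w
  induction n generalizing f with
  | zero => simp [d_zero_apply, eps_apply_zero]
  | succ n ih =>
    have := ih (contr (w 0) f) (Fin.tail w)
    simp only [apply_succ _ n w, contr_d, contr_eps, contr_neg, eps_sub, sub_apply, neg_apply,
      d_neg, eps_map] at this ⊢
    rw [this]

/-- Partial derivatives commute with the exterior derivative. -/
lemma map_d (D : E → R →+ R) (D' : E → C →+ C) (τ : R →+ C) (h : ∀ v r, τ (D v r) = D' v (τ r))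
    (f : GForm E R) : map τ (d D f) = d D' (map τ f) := by
  ext n w
  induction n generalizing f with
  | zero => simp [d_zero_apply]
  | succ n ih =>
    have := ih (contr (w 0) f) (Fin.tail w)
    simp only [apply_succ _ n w, contr_d, contr_map, sub_apply, map_sub] at this ⊢
    rw [this]
    simp [h]

/-- Contracting d(df) with v gives D_v(df) − d(D_v f) + d(d(ι_v f)). The first two terms cancel
because D_v commutes with d, and the last one has lower degree. -/
lemma d_d (D : E → R →+ R) (h : ∀ v w r, D v (D w r) = D w (D v r)) (f : GForm E R) :
    d D (d D f) = 0 := by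
  ext n w
  induction n generalizing f with
  | zero => simp [d_zero_apply]
  | succ n ih =>
    simp only [apply_succ _ n w, contr_d, map_d D D (D (w 0)) (h _), sub_eq_add_neg (map _ f),
      d_add, d_neg, add_apply, neg_apply, ih, sub_apply]
    simp

end AddCommGroup

section Ring

variable [Ring R] [Ring S]

/-- The graded product of forms, characterized by the fact that contractions are graded
derivations. -/
def gmul : (n : ℕ) → GForm E R → GForm E R → (Fin n → E) → R
  | 0, f, g, w => f 0 w * g 0 w
  | n + 1, f, g, w =>
    gmul n (contr (w 0) f) g (Fin.tail w) + gmul n (eps f) (contr (w 0) g) (Fin.tail w)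

instance : Mul (GForm E R) := ⟨fun f g n w => gmul n f g w⟩

instance : One (GForm E R) := ⟨fun n _ => if n = 0 then 1 else 0⟩

lemma mul_apply_zero (f g : GForm E R) (w : Fin 0 → E) : (f * g) 0 w = f 0 w * g 0 w := rfl

lemma one_apply_zero (w : Fin 0 → E) : (1 : GForm E R) 0 w = 1 := rfl

@[simp] lemma contr_mul (v : E) (f g : GForm E R) :
    contr v (f * g) = contr v f * g + eps f * contr v g := by
  ext n w
  change gmul (n + 1) f g (Fin.cons v w) = gmul n (contr v f) g w + gmul n (eps f) (contr v g) w
  simp [gmul]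

@[simp] lemma contr_one (v : E) : contr v (1 : GForm E R) = 0 := by
  ext n w
  change (if n + 1 = 0 then (1 : R) else 0) = 0
  simp

@[simp] lemma eps_one : eps (1 : GForm E R) = 1 := by
  ext n w
  change (-1 : ℤ) ^ n • (if n = 0 then (1 : R) else 0) = if n = 0 then 1 else 0
  split_ifs with h <;> simp [h]

protected lemma add_mul' (f g h : GForm E R) : (f + g) * h = f * h + g * h := by
  ext n w
  induction n generalizing f g h with
  | zero => simp [mul_apply_zero, add_mul]
  | succ n ih =>
    simp only [apply_succ _ n w, contr_add, contr_mul, eps_add, add_apply, ih]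
    abel

protected lemma mul_add' (f g h : GForm E R) : f * (g + h) = f * g + f * h := by
  ext n w
  induction n generalizing f g h with
  | zero => simp [mul_apply_zero, mul_add]
  | succ n ih =>
    simp only [apply_succ _ n w, contr_add, contr_mul, add_apply, ih]
    abel

protected lemma zero_mul' (f : GForm E R) : 0 * f = 0 := by
  simpa using GForm.add_mul' 0 0 f

protected lemma mul_zero' (f : GForm E R) : f * 0 = 0 := by
  simpa using GForm.mul_add' f 0 0

protected lemma neg_mul' (f g : GForm E R) : -f * g = -(f * g) := by
  rw [eq_neg_iff_add_eq_zero, ← GForm.add_mul', neg_add_cancel, GForm.zero_mul']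

protected lemma mul_neg' (f g : GForm E R) : f * -g = -(f * g) := by
  rw [eq_neg_iff_add_eq_zero, ← GForm.mul_add', neg_add_cancel, GForm.mul_zero']

@[simp] lemma eps_mul (f g : GForm E R) : eps (f * g) = eps f * eps g := by
  ext n w
  induction n generalizing f g with
  | zero => simp [mul_apply_zero, eps_apply_zero]
  | succ n ih =>
    simp only [apply_succ _ n w, contr_eps, contr_mul, eps_add, add_apply, neg_apply, ih, eps_eps,
      GForm.neg_mul', GForm.mul_neg']
    abel

protected lemma mul_assoc' (f g h : GForm E R) : f * g * h = f * (g * h) := by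
  ext n w
  induction n generalizing f g h with
  | zero => simp [mul_apply_zero, mul_assoc]
  | succ n ih =>
    simp only [apply_succ _ n w, contr_mul, add_apply, eps_mul, GForm.add_mul', GForm.mul_add', ih]
    abel

protected lemma one_mul' (f : GForm E R) : 1 * f = f := by
  ext n w
  induction n generalizing f with
  | zero => simp [mul_apply_zero, one_apply_zero]
  | succ n ih => simp [apply_succ _ n w, GForm.zero_mul', ih]

protected lemma mul_one' (f : GForm E R) : f * 1 = f := by
  ext n w
  induction n generalizing f with
  | zero => simp [mul_apply_zero, one_apply_zero]
  | succ n ih => simp [apply_succ _ n w, GForm.mul_zero', ih]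

instance : Ring (GForm E R) :=
  { (inferInstance : AddCommGroup (GForm E R)) with
    left_distrib := GForm.mul_add'
    right_distrib := GForm.add_mul'
    zero_mul := GForm.zero_mul'
    mul_zero := GForm.mul_zero'
    mul_assoc := GForm.mul_assoc'
    one_mul := GForm.one_mul'
    mul_one := GForm.mul_one' }

lemma map_mul (φ : R →+* S) (f g : GForm E R) :
    map (φ : R →+ S) (f * g) = map (φ : R →+ S) f * map (φ : R →+ S) g := by
  ext n w
  induction n generalizing f g with
  | zero => simp [mul_apply_zero]
  | succ n ih =>
    have h1 := ih (contr (w 0) f) g (Fin.tail w)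
    have h2 := ih (eps f) (contr (w 0) g) (Fin.tail w)
    simp only [apply_succ _ n w, contr_map, contr_mul, map_add, add_apply] at h1 h2 ⊢
    rw [h1, h2, eps_map]

lemma smul_mul [Module ℝ R] [IsScalarTower ℝ R R] (c : ℝ) (f g : GForm E R) :
    (c • f) * g = c • (f * g) := by
  ext n w
  induction n generalizing f g with
  | zero => exact smul_mul_assoc _ _ _
  | succ n ih => simp [apply_succ _ n w, ih]

lemma map_der_mul (δ : R →+ R) (h : ∀ a b, δ (a * b) = δ a * b + a * δ b) (f g : GForm E R) :
    map δ (f * g) = map δ f * g + f * map δ g := by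
  ext n w
  induction n generalizing f g with
  | zero => simp [mul_apply_zero, h]
  | succ n ih =>
    have h1 := ih (contr (w 0) f) g (Fin.tail w)
    have h2 := ih (eps f) (contr (w 0) g) (Fin.tail w)
    simp only [apply_succ _ n w, contr_map, contr_mul, contr_add, map_add, add_apply, eps_map]
      at h1 h2 ⊢
    rw [h1, h2]
    abel

/-- The exterior derivative is a graded derivation. -/
lemma d_mul (D : E → R →+ R) (h : ∀ v a b, D v (a * b) = D v a * b + a * D v b)
    (f g : GForm E R) : d D (f * g) = d D f * g + eps f * d D g := by
  ext n w
  induction n generalizing f g with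
  | zero => simp [d_zero_apply, mul_apply_zero]
  | succ n ih =>
    have h1 := ih (contr (w 0) f) g (Fin.tail w)
    have h2 := ih (eps f) (contr (w 0) g) (Fin.tail w)
    simp only [apply_succ _ n w, contr_d, contr_mul, contr_add, sub_apply, add_apply, d_add, h1, h2,
      contr_eps, eps_d, eps_eps, map_der_mul _ (h _), sub_mul, mul_sub, neg_mul, neg_apply]
    abel

variable [AddCommGroup C] (τ : R →+ C) (hτ : ∀ a b, τ (a * b) = τ (b * a))
include hτ

/-- Graded cyclicity of the trace. Contraction exchanges even and odd forms, so both parities have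
to be carried through one induction. -/
lemma trace_mul_aux (n : ℕ) (w : Fin n → E) : ∀ f g : GForm E R,
    (eps f = f → map τ (f * g) n w = map τ (g * f) n w) ∧
    (eps f = -f → map τ (f * g) n w = map τ (eps g * f) n w) := by
  induction n with
  | zero =>
    intro f g
    simp [mul_apply_zero, hτ (f 0 w), eps_apply_zero]
  | succ n ih =>
    intro f g
    have ho : eps f = f → eps (contr (w 0) f) = -contr (w 0) f := fun h => by
      rw [← neg_eq_iff_eq_neg, ← contr_eps, h]
    have he : eps f = -f → eps (contr (w 0) f) = contr (w 0) f := fun h => by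
      rw [← neg_inj, ← contr_eps, h, contr_neg]
    constructor <;> intro h
    · have h1 := (ih (Fin.tail w) (contr (w 0) f) g).2 (ho h)
      have h2 := (ih (Fin.tail w) f (contr (w 0) g)).1 h
      simp only [apply_succ _ n w, contr_map, contr_mul, map_add, add_apply, h, h1, h2]
      abel
    · have h1 := (ih (Fin.tail w) (contr (w 0) f) g).1 (he h)
      have h2 := (ih (Fin.tail w) f (contr (w 0) g)).2 h
      simp only [apply_succ _ n w, contr_map, contr_mul, map_add, add_apply, h, h1, h2, neg_mul,
        map_neg, neg_apply, contr_eps, eps_eps]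
      abel

lemma trace_mul_of_even {f : GForm E R} (hf : eps f = f) (g : GForm E R) :
    map τ (f * g) = map τ (g * f) :=
  ext fun n w => (trace_mul_aux τ hτ n w f g).1 hf

lemma trace_mul_of_odd {f : GForm E R} (hf : eps f = -f) (g : GForm E R) :
    map τ (f * g) = map τ (eps g * f) :=
  ext fun n w => (trace_mul_aux τ hτ n w f g).2 hf

omit hτ

/-- The covariant derivative of an endomorphism valued form, with connection form `γ`. -/
def nabla (D : E → R →+ R) (γ f : GForm E R) : GForm E R := d D f + γ * f - eps f * γ

lemma nabla_mul (D : E → R →+ R) (h : ∀ v a b, D v (a * b) = D v a * b + a * D v b)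
    (γ f g : GForm E R) : nabla D γ (f * g) = nabla D γ f * g + eps f * nabla D γ g := by
  rw [nabla, nabla, nabla, d_mul D h, eps_mul]
  noncomm_ring

/-- The two sides differ by the trace of γf − ε(f)γ, a graded commutator with the odd form γ. -/
lemma trace_d (D : E → R →+ R) (hτ : ∀ a b, τ (a * b) = τ (b * a)) {γ : GForm E R}
    (hγ : eps γ = -γ) (f : GForm E R) : map τ (d D f) = map τ (nabla D γ f) := by
  rw [nabla, map_sub, map_add, trace_mul_of_odd τ hτ hγ, add_sub_cancel_right]

/-- The Bianchi identity. -/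
lemma nabla_curvature (D : E → R →+ R) (h : ∀ v a b, D v (a * b) = D v a * b + a * D v b)
    (hc : ∀ v w r, D v (D w r) = D w (D v r)) {γ : GForm E R} (hγ : eps γ = -γ) :
    nabla D γ (d D γ + γ * γ) = 0 := by
  rw [nabla, d_add, d_d D hc, d_mul D h, eps_add, eps_d, eps_mul, hγ, d_neg]
  noncomm_ring

lemma nabla_one (D : E → R →+ R) (h : ∀ v a b, D v (a * b) = D v a * b + a * D v b)
    (γ : GForm E R) : nabla D γ 1 = 0 := by
  have := nabla_mul D h γ 1 1
  simpa using this

lemma nabla_pow_eq_zero (D : E → R →+ R) (h : ∀ v a b, D v (a * b) = D v a * b + a * D v b)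
    {γ f : GForm E R} (hf : nabla D γ f = 0) (k : ℕ) : nabla D γ (f ^ k) = 0 := by
  induction k with
  | zero => rw [pow_zero, nabla_one D h]
  | succ k ih => rw [pow_succ, nabla_mul D h, ih, hf, zero_mul, mul_zero, add_zero]

lemma eps_curvature (D : E → R →+ R) {γ : GForm E R} (hγ : eps γ = -γ) :
    eps (d D γ + γ * γ) = d D γ + γ * γ := by
  rw [eps_add, eps_d, eps_mul, hγ, d_neg, neg_neg, neg_mul_neg]

lemma eps_pow {f : GForm E R} (hf : eps f = f) (k : ℕ) : eps (f ^ k) = f ^ k := by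
  induction k with
  | zero => simp
  | succ k ih => rw [pow_succ, eps_mul, ih, hf]

/-- Under the trace d may be replaced by the covariant derivative, which kills powers of the
curvature by the Bianchi identity. -/
lemma trace_d_curvature_pow (D : E → R →+ R)
    (h : ∀ v a b, D v (a * b) = D v a * b + a * D v b)
    (hc : ∀ v w r, D v (D w r) = D w (D v r))
    (hτ : ∀ a b, τ (a * b) = τ (b * a)) {γ : GForm E R} (hγ : eps γ = -γ) (k : ℕ) :
    map τ (d D ((d D γ + γ * γ) ^ k)) = 0 := by
  rw [trace_d τ D hτ hγ, nabla_pow_eq_zero D h (nabla_curvature D h hc hγ), map_zero]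

/-- By the Bianchi identity the covariant derivative reaches only θ, and no sign appears because the
power of the curvature is even. This produces primitives for the variation of the Chern forms. -/
lemma trace_d_curvature_pow_mul (D : E → R →+ R)
    (h : ∀ v a b, D v (a * b) = D v a * b + a * D v b)
    (hc : ∀ v w r, D v (D w r) = D w (D v r))
    (hτ : ∀ a b, τ (a * b) = τ (b * a)) {γ : GForm E R} (hγ : eps γ = -γ)
    (θ : GForm E R) (k : ℕ) :
    map τ (d D ((d D γ + γ * γ) ^ k * θ)) = map τ ((d D γ + γ * γ) ^ k * nabla D γ θ) := by
  rw [trace_d τ D hτ hγ, nabla_mul D h,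
    nabla_pow_eq_zero D h (nabla_curvature D h hc hγ), zero_mul, zero_add,
    eps_pow (eps_curvature D hγ)]

/-- The derivative of the power `f ^ k`, if the derivative of `f` is `f'`. -/
def derivPow (f f' : GForm E R) : ℕ → GForm E R
  | 0 => 0
  | k + 1 => derivPow f f' k * f + f ^ k * f'

/-- Cyclicity brings f' to the end of each of the k + 1 summands of the derivative. The extra factor
f ^ m is needed in the induction to absorb the trailing f of `derivPow`. -/
lemma trace_derivPow_mul (hτ : ∀ a b, τ (a * b) = τ (b * a)) {f : GForm E R} (hf : eps f = f)
    (f' : GForm E R) (k m : ℕ) :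
    map τ (derivPow f f' (k + 1) * f ^ m) = (k + 1) • map τ (f ^ (k + m) * f') := by
  have h : ∀ m j, map τ (f ^ j * f' * f ^ m) = map τ (f ^ (j + m) * f') := fun m j => by
    rw [← trace_mul_of_even τ hτ (eps_pow hf m), ← mul_assoc, ← pow_add, add_comm]
  induction k generalizing m with
  | zero => simp [derivPow, ← trace_mul_of_even τ hτ (eps_pow hf m)]
  | succ k ih =>
    rw [derivPow, add_mul, map_add, h, mul_assoc, ← pow_succ', ih,
      show k + (m + 1) = k + 1 + m by lia,
      ← succ_nsmul]

end Ring

end GForm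

/-! ## Alternating maps as graded forms -/

section Shuffles

/-- The permutations of `Fin (n + 1)`, sorted by the preimage of `0`. -/
lemma bijective_decomposeFin_mul_cycleRange (n : ℕ) : Function.Bijective
    (fun a : Fin (n + 1) × Equiv.Perm (Fin n) =>
      Equiv.Perm.decomposeFin.symm (0, a.2) * a.1.cycleRange) := by
  refine (Fintype.bijective_iff_injective_and_card _).2 ⟨?_, ?_⟩
  · rintro ⟨i, e⟩ ⟨i', e'⟩ h
    have h0 : i = i' := by
      have h1 := congrArg (fun σ : Equiv.Perm (Fin (n + 1)) => σ i) h
      simp only [Equiv.Perm.mul_apply, Fin.cycleRange_self,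
        Equiv.Perm.decomposeFin_symm_apply_zero] at h1
      have h2 : (Equiv.Perm.decomposeFin.symm ((0 : Fin (n + 1)), e')) 0 =
          (Equiv.Perm.decomposeFin.symm (0, e')) (i'.cycleRange i) := by
        rw [← h1, Equiv.Perm.decomposeFin_symm_apply_zero]
      have h3 := (Equiv.injective _ h2).symm
      rw [← Fin.cycleRange_self i'] at h3
      exact Equiv.injective _ h3
    subst h0
    have h1 := mul_right_cancel h
    have h2 := Equiv.Perm.decomposeFin.symm.injective h1
    simpa using h2
  · simp [Fintype.card_perm, Nat.factorial_succ]

/-- Sort the permutations by the position i at which v 0 ends up: each is a permutation fixing 0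
composed with a cycle of sign (-1)^i. This is the permutation-sum counterpart of contraction with
the first vector. -/
lemma sum_perm_insertNth {T X : Type*} [AddCommGroup X] {n : ℕ} (F : (Fin (n + 1) → T) → X)
    (v : Fin (n + 1) → T) :
    ∑ σ : Equiv.Perm (Fin (n + 1)), Equiv.Perm.sign σ • F (v ∘ σ) =
      ∑ i : Fin (n + 1), (-1 : ℤ) ^ (i : ℕ) • ∑ e : Equiv.Perm (Fin n),
        Equiv.Perm.sign e • F (Fin.insertNth i (v 0) (Fin.tail v ∘ e)) := by
  rw [← (bijective_decomposeFin_mul_cycleRange n).sum_comp, Fintype.sum_prod_type]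
  refine Finset.sum_congr rfl fun i _ => ?_
  rw [Finset.smul_sum]
  refine Finset.sum_congr rfl fun e _ => ?_
  have h1 : v ∘ (Equiv.Perm.decomposeFin.symm (0, e) * i.cycleRange : Equiv.Perm _) =
      Fin.insertNth i (v 0) (Fin.tail v ∘ e) := by
    rw [← Fin.cons_comp_cycleRange, Equiv.Perm.coe_mul, ← Function.comp_assoc]
    congr 1
    ext j
    refine Fin.cases ?_ (fun j => ?_) j
    · simp
    · simp [Fin.tail]
  rw [h1, Equiv.Perm.sign_mul, Fin.sign_cycleRange, Equiv.Perm.decomposeFin.symm_sign, if_pos rfl,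
    one_mul, mul_comm, ← smul_smul]
  simp [Units.smul_def]

/-- The first `p` of `n = p + q` indices. -/
def leftSlot {n p q : ℕ} (h : n = p + q) (i : Fin p) : Fin n := ⟨i, by lia⟩

/-- The last `q` of `n = p + q` indices. -/
def rightSlot {n p q : ℕ} (h : n = p + q) (i : Fin q) : Fin n := ⟨p + i, by lia⟩

lemma sum_slots {X : Type*} [AddCommMonoid X] {n p q : ℕ} (h : n = p + q) (f : Fin n → X) :
    ∑ i, f i = ∑ i, f (leftSlot h i) + ∑ i, f (rightSlot h i) := by
  subst h
  exact Fin.sum_univ_add f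

variable {T : Type*} {n p q : ℕ}

/-- The vector singled out by `sum_perm_insertNth` lands in one of the two blocks; that block sees
an insertion and the other is untouched. Together with `insertNth_rightSlot` this is the case
distinction in `sum_perm_eq`. -/
lemma insertNth_leftSlot (h : n + 1 = p + 1 + q) (h' : n = p + q) (j : Fin (p + 1)) (x : T)
    (u : Fin n → T) :
    (fun k => (Fin.insertNth (leftSlot h j) x u : Fin (n + 1) → T) (leftSlot h k)) =
      Fin.insertNth j x (fun k => u (leftSlot h' k)) ∧
    (fun k => (Fin.insertNth (leftSlot h j) x u : Fin (n + 1) → T) (rightSlot h k)) =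
      fun k => u (rightSlot h' k) := by
  constructor
  · funext k
    rcases Fin.eq_self_or_eq_succAbove j k with rfl | ⟨m, rfl⟩
    · simp
    · have : leftSlot h (j.succAbove m) = (leftSlot h j).succAbove (leftSlot h' m) := by
        ext
        simp only [leftSlot, Fin.succAbove, Fin.lt_def, Fin.val_castSucc]
        split_ifs <;> simp
      rw [this, Fin.insertNth_apply_succAbove, Fin.insertNth_apply_succAbove]
  · funext k
    have : rightSlot h k = (leftSlot h j).succAbove (rightSlot h' k) := by
      ext
      simp only [leftSlot, rightSlot, Fin.succAbove, Fin.lt_def, Fin.val_castSucc]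
      split_ifs <;> simp <;> lia
    rw [this, Fin.insertNth_apply_succAbove]

lemma insertNth_rightSlot (h : n + 1 = p + (q + 1)) (h' : n = p + q) (j : Fin (q + 1)) (x : T)
    (u : Fin n → T) :
    (fun k => (Fin.insertNth (rightSlot h j) x u : Fin (n + 1) → T) (rightSlot h k)) =
      Fin.insertNth j x (fun k => u (rightSlot h' k)) ∧
    (fun k => (Fin.insertNth (rightSlot h j) x u : Fin (n + 1) → T) (leftSlot h k)) =
      fun k => u (leftSlot h' k) := by
  constructor
  · funext k
    rcases Fin.eq_self_or_eq_succAbove j k with rfl | ⟨m, rfl⟩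
    · simp
    · have : rightSlot h (j.succAbove m) = (rightSlot h j).succAbove (rightSlot h' m) := by
        ext
        simp only [rightSlot, Fin.succAbove, Fin.lt_def, Fin.val_castSucc]
        split_ifs <;> simp <;> lia
      rw [this, Fin.insertNth_apply_succAbove, Fin.insertNth_apply_succAbove]
  · funext k
    have : leftSlot h k = (rightSlot h j).succAbove (leftSlot h' k) := by
      ext
      simp only [leftSlot, rightSlot, Fin.succAbove, Fin.lt_def, Fin.val_castSucc]
      split_ifs <;> simp <;> lia
    rw [this, Fin.insertNth_apply_succAbove]

end Shuffles

/-! ### The wedge product agrees with the recursive product. -/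

namespace GForm

section Hat

variable {E R : Type*} [NormedAddCommGroup E] [NormedSpace ℝ E]

section

variable [NormedAddCommGroup R] [NormedSpace ℝ R] {p : ℕ}

/-- An alternating map as a graded form. -/
def hat (α : E [⋀^Fin p]→L[ℝ] R) : GForm E R :=
  fun n w => if h : n = p then α (fun i => w (Fin.cast h.symm i)) else 0

@[simp] lemma hat_apply (α : E [⋀^Fin p]→L[ℝ] R) (w : Fin p → E) : hat α p w = α w := by
  simp [hat]

lemma hat_apply_of_ne (α : E [⋀^Fin p]→L[ℝ] R) {n : ℕ} (h : n ≠ p) (w : Fin n → E) :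
    hat α n w = 0 := by
  simp [hat, h]

lemma contr_hat (α : E [⋀^Fin (p + 1)]→L[ℝ] R) (v : E) :
    contr v (hat α) = hat (α.curryLeft v) := by
  ext n w
  by_cases h : n = p
  · subst h
    simp [contr, Matrix.vecCons]
  · rw [hat_apply_of_ne _ h, contr, hat_apply_of_ne _ (by lia)]

lemma contr_hat_zero (α : E [⋀^Fin 0]→L[ℝ] R) (v : E) : contr v (hat α) = 0 := by
  ext n w
  rw [contr, hat_apply_of_ne _ (by lia), zero_apply]

lemma eps_hat (α : E [⋀^Fin p]→L[ℝ] R) : eps (hat α) = (-1 : ℝ) ^ p • hat α := by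
  ext n w
  by_cases h : n = p
  · subst h
    rcases neg_one_pow_eq_or ℤ n with h1 | h1 <;> rcases Nat.even_or_odd n with h2 | h2 <;>
      simp [eps, h2.neg_one_pow]
  · simp [eps, hat_apply_of_ne _ h]

lemma hat_add (α β : E [⋀^Fin p]→L[ℝ] R) : hat (α + β) = hat α + hat β := by
  ext n w
  by_cases h : n = p
  · subst h; simp
  · simp [hat_apply_of_ne _ h]

lemma hat_smul (c : ℝ) (α : E [⋀^Fin p]→L[ℝ] R) : hat (c • α) = c • hat α := by
  ext n w
  by_cases h : n = p
  · subst h; simp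
  · simp [hat_apply_of_ne _ h]

end

variable [NormedRing R] [NormedAlgebra ℝ R]

lemma hat_one : hat (ContinuousAlternatingMap.constOfIsEmpty ℝ E (Fin 0) (1 : R)) = 1 := by
  ext n w
  by_cases h : n = 0
  · subst h; simp [one_apply_zero]
  · rw [hat_apply_of_ne _ h]
    exact (if_neg h).symm

lemma hat_mul_apply_of_ne (n : ℕ) : ∀ {p q : ℕ} (_ : n ≠ p + q) (α : E [⋀^Fin p]→L[ℝ] R)
    (β : E [⋀^Fin q]→L[ℝ] R) (w : Fin n → E), (hat α * hat β) n w = 0 := by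
  induction n with
  | zero =>
    intro p q h α β w
    rw [mul_apply_zero]
    rcases Nat.eq_zero_or_pos p with h1 | h1
    · rw [hat_apply_of_ne β (by lia), mul_zero]
    · rw [hat_apply_of_ne α (by lia), zero_mul]
  | succ n ih =>
    intro p q h α β w
    have h1 : (contr (w 0) (hat α) * hat β) n (Fin.tail w) = 0 := by
      cases p with
      | zero => simp [contr_hat_zero]
      | succ p => rw [contr_hat, ih (by lia)]
    have h2 : (eps (hat α) * contr (w 0) (hat β)) n (Fin.tail w) = 0 := by
      cases q with
      | zero => simp [contr_hat_zero]
      | succ q => rw [contr_hat, eps_hat, GForm.smul_mul, smul_apply, ih (by lia), smul_zero]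
    simp only [apply_succ _ n w, contr_mul, add_apply, h1, h2, add_zero]

/-- Both sides satisfy the same recursion in the first vector: it goes either to α or to β, which
corresponds to the two terms of the contraction of a product. The degrees p and q vary in the
induction on n, so the splitting of n is kept as an equation. -/
lemma sum_perm_eq (n : ℕ) : ∀ {p q : ℕ} (h : n = p + q) (α : E [⋀^Fin p]→L[ℝ] R)
    (β : E [⋀^Fin q]→L[ℝ] R) (w : Fin n → E),
    ∑ σ : Equiv.Perm (Fin n), Equiv.Perm.sign σ •
      (α (fun k => (w ∘ σ) (leftSlot h k)) * β (fun k => (w ∘ σ) (rightSlot h k))) =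
      (p.factorial * q.factorial : ℝ) • (hat α * hat β) n w := by
  induction n with
  | zero =>
    intro p q h α β w
    obtain rfl : p = 0 := by lia
    obtain rfl : q = 0 := by lia
    simp only [Finset.univ_unique, Finset.sum_singleton, mul_apply_zero, hat_apply]
    simp only [Nat.factorial_zero, Nat.cast_one, mul_one, one_smul]
    rw [Subsingleton.elim (default : Equiv.Perm (Fin 0)) 1, Equiv.Perm.sign_one, one_smul]
    congr 2 <;> exact Subsingleton.elim _ _
  | succ n ih =>
    intro p q h α β w
    rw [sum_perm_insertNth (fun u =>
        α (fun k => u (leftSlot h k)) * β (fun k => u (rightSlot h k))),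
      sum_slots h]
    have hl : ∑ i : Fin p, (-1 : ℤ) ^ (leftSlot h i : ℕ) • ∑ e : Equiv.Perm (Fin n),
        Equiv.Perm.sign e •
          (α (fun k => (Fin.insertNth (leftSlot h i) (w 0) (Fin.tail w ∘ e) : Fin (n + 1) → E)
              (leftSlot h k)) *
            β (fun k => (Fin.insertNth (leftSlot h i) (w 0) (Fin.tail w ∘ e) : Fin (n + 1) → E)
              (rightSlot h k))) =
        (p.factorial * q.factorial : ℝ) • (contr (w 0) (hat α) * hat β) n (Fin.tail w) := by
      cases p with
      | zero => simp [contr_hat_zero]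
      | succ p =>
        have h' : n = p + q := by lia
        have := ih h' (α.curryLeft (w 0)) β (Fin.tail w)
        rw [contr_hat, Nat.factorial_succ, Nat.cast_mul, mul_assoc, ← smul_smul, ← this]
        rw [Nat.cast_smul_eq_nsmul, ← Fin.sum_const]
        refine Finset.sum_congr rfl fun i _ => ?_
        rw [Finset.smul_sum]
        refine Finset.sum_congr rfl fun e _ => ?_
        rw [(insertNth_leftSlot h h' i _ _).1, (insertNth_leftSlot h h' i _ _).2,
          ContinuousAlternatingMap.map_insertNth, smul_comm, smul_mul_assoc, ]
        -- The sign of the position cancels against the sign of moving the vector to the front of α,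
        -- so all p + 1 positions contribute equally and turn p! into (p + 1)!.
        change _ • (-1 : ℤ) ^ (i : ℕ) • (-1 : ℤ) ^ (i : ℕ) • _ = _
        rw [smul_smul ((-1 : ℤ) ^ _), ← mul_pow, neg_one_mul, neg_neg, one_pow, one_smul]
        rfl
    have hr : ∑ i : Fin q, (-1 : ℤ) ^ (rightSlot h i : ℕ) • ∑ e : Equiv.Perm (Fin n),
        Equiv.Perm.sign e •
          (α (fun k => (Fin.insertNth (rightSlot h i) (w 0) (Fin.tail w ∘ e) : Fin (n + 1) → E)
              (leftSlot h k)) *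
            β (fun k => (Fin.insertNth (rightSlot h i) (w 0) (Fin.tail w ∘ e) : Fin (n + 1) → E)
              (rightSlot h k))) =
        (p.factorial * q.factorial : ℝ) • (eps (hat α) * contr (w 0) (hat β)) n (Fin.tail w) := by
      cases q with
      | zero => simp [contr_hat_zero]
      | succ q =>
        have h' : n = p + q := by lia
        have := ih h' α (β.curryLeft (w 0)) (Fin.tail w)
        rw [contr_hat, eps_hat, GForm.smul_mul, smul_apply, smul_comm, Nat.factorial_succ,
          Nat.cast_mul, mul_left_comm, ← smul_smul ((q + 1 : ℕ) : ℝ), ← this,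
          smul_comm, Nat.cast_smul_eq_nsmul, ← Fin.sum_const]
        refine Finset.sum_congr rfl fun i _ => ?_
        rw [Finset.smul_sum, Finset.smul_sum]
        refine Finset.sum_congr rfl fun e _ => ?_
        rw [(insertNth_rightSlot h h' i _ _).1, (insertNth_rightSlot h h' i _ _).2,
          ContinuousAlternatingMap.map_insertNth, smul_comm, mul_smul_comm]
        -- Here the position is p + i, while moving to the front of β costs only (-1)^i; the
        -- remaining (-1)^p is the sign of `eps` on α.
        change _ • (-1 : ℤ) ^ (p + i : ℕ) • (-1 : ℤ) ^ (i : ℕ) • _ = _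
        rw [smul_smul ((-1 : ℤ) ^ _), pow_add, mul_assoc, ← mul_pow, neg_one_mul, neg_neg, one_pow,
          mul_one, smul_comm]
        rcases Nat.even_or_odd p with h2 | h2 <;> simp only [h2.neg_one_pow, one_smul, neg_smul] <;>
        rfl
    rw [hl, hr, ← smul_add]
    simp only [apply_succ _ n w, contr_mul, add_apply]

/-- The wedge product of alternating maps is the product of graded forms. -/
lemma hat_wedge {p q : ℕ} (α : E [⋀^Fin p]→L[ℝ] R) (β : E [⋀^Fin q]→L[ℝ] R) :
    hat (wedge (ContinuousLinearMap.mul ℝ R) α β) = hat α * hat β := by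
  ext n w
  by_cases h : n = p + q
  · subst h
    have h1 := sum_perm_eq (p + q) rfl α β w
    rw [hat_apply]
    have h2 : (p.factorial * q.factorial : ℝ) ≠ 0 := by positivity
    rw [← inv_smul_smul₀ h2 ((hat α * hat β) (p + q) w), ← h1]
    simp only [wedge, ContinuousAlternatingMap.smul_apply,
      ContinuousMultilinearMap.alternatization_apply_apply]
    rfl
  · rw [hat_apply_of_ne _ h, hat_mul_apply_of_ne n h]

lemma hat_wedgePow (Φ : E [⋀^Fin 2]→L[ℝ] R) (k : ℕ) : hat (wedgePow Φ k) = hat Φ ^ k := by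
  induction k with
  | zero => rw [pow_zero]; exact hat_one
  | succ k ih =>
    rw [pow_succ, ← ih]
    exact hat_wedge (wedgePow Φ k) Φ

end Hat

end GForm

/-! ## Smooth forms on open sets of a vector space -/

section Smoothness

variable {E F G H X : Type*} [NormedAddCommGroup E] [NormedSpace ℝ E]
  [NormedAddCommGroup F] [NormedSpace ℝ F] [NormedAddCommGroup G] [NormedSpace ℝ G]
  [NormedAddCommGroup H] [NormedSpace ℝ H] [NormedAddCommGroup X] [NormedSpace ℝ X]

/-- A form on a finite dimensional space depends smoothly on parameters if its values do. -/
lemma contDiffOn_of_apply [FiniteDimensional ℝ E] {p : ℕ} {n : ℕ∞ω} {N : Set X}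
    {α : X → E [⋀^Fin p]→L[ℝ] F} (h : ∀ v, ContDiffOn ℝ n (fun y => α y v) N) :
    ContDiffOn ℝ n α N := by
  induction p with
  | zero =>
    have h1 : α = fun y =>
        ContinuousAlternatingMap.constOfIsEmptyLIE ℝ E F (Fin 0) (α y Fin.elim0) := by
      funext y
      ext w
      simp only [ContinuousAlternatingMap.constOfIsEmptyLIE_apply,
        ContinuousAlternatingMap.constOfIsEmpty_apply]
      congr 1
      exact Subsingleton.elim _ _
    rw [h1]
    exact (ContinuousAlternatingMap.constOfIsEmptyLIE ℝ E F
      (Fin 0)).toContinuousLinearEquiv.contDiff.comp_contDiffOn (h _)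
  | succ p ih =>
    have h1 : ContDiffOn ℝ n (fun y => (α y).curryLeft) N := by
      refine contDiffOn_clm_apply.2 fun v => ih fun w => ?_
      simpa using h (Matrix.vecCons v w)
    -- Antisymmetrizing the curried form gives (p + 1) times the form, so α is a fixed continuous
    -- linear function of its curried version, whose smoothness follows from lower degree.
    have h2 : α = fun y => ((p + 1 : ℕ) : ℝ)⁻¹ •
        ContinuousAlternatingMap.alternatizeUncurryFinCLM ℝ E F (α y).curryLeft := by
      funext y
      rw [ContinuousAlternatingMap.alternatizeUncurryFinCLM_apply,
        ContinuousAlternatingMap.alternatizeUncurryFin_curryLeft, ← Nat.cast_smul_eq_nsmul ℝ,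
        inv_smul_smul₀ (by positivity)]
    rw [h2]
    exact ((ContinuousLinearMap.contDiff _).comp_contDiffOn h1).const_smul _

lemma ContDiffOn.alternating_apply {p : ℕ} {n : ℕ∞ω} {N : Set X}
    {α : X → E [⋀^Fin p]→L[ℝ] F} (h : ContDiffOn ℝ n α N) (v : Fin p → E) :
    ContDiffOn ℝ n (fun y => α y v) N :=
  (ContinuousAlternatingMap.apply ℝ E F v).contDiff.comp_contDiffOn h

lemma ContDiffOn.wedge [FiniteDimensional ℝ E] {p q : ℕ} {n : ℕ∞ω} {N : Set X}
    (B : F →L[ℝ] G →L[ℝ] H)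
    {α : X → E [⋀^Fin p]→L[ℝ] F} {β : X → E [⋀^Fin q]→L[ℝ] G} (hα : ContDiffOn ℝ n α N)
    (hβ : ContDiffOn ℝ n β N) : ContDiffOn ℝ n (fun y => _root_.wedge B (α y) (β y)) N := by
  refine contDiffOn_of_apply fun v => ?_
  simp only [_root_.wedge, ContinuousAlternatingMap.smul_apply,
    ContinuousMultilinearMap.alternatization_apply_apply, Units.smul_def]
  refine ContDiffOn.const_smul _ (ContDiffOn.sum fun σ _ => ?_)
  have : ContDiffOn ℝ n (fun y => formProd B (α y) (β y) (v ∘ σ)) N :=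
    (B.contDiff.comp_contDiffOn (hα.alternating_apply _)).clm_apply (hβ.alternating_apply _)
  simpa only [Int.cast_smul_eq_zsmul] using this.const_smul ((Equiv.Perm.sign σ : ℤ) : ℝ)

lemma ContDiffOn.wedgePow [FiniteDimensional ℝ E] {R : Type*} [NormedRing R] [NormedAlgebra ℝ R]
    {n : ℕ∞ω} {N : Set X} {Φ : X → E [⋀^Fin 2]→L[ℝ] R} (h : ContDiffOn ℝ n Φ N) (k : ℕ) :
    ContDiffOn ℝ n (fun y => _root_.wedgePow (Φ y) k) N := by
  induction k with
  | zero => exact contDiffOn_const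
  | succ k ih => exact ih.wedge _ h

lemma ContDiffOn.extDeriv {p : ℕ} {N : Set E} (hN : IsOpen N)
    {α : E → E [⋀^Fin p]→L[ℝ] F} (h : ContDiffOn ℝ ∞ α N) :
    ContDiffOn ℝ ∞ (fun y => _root_.extDeriv α y) N :=
  (ContinuousAlternatingMap.alternatizeUncurryFinCLM ℝ E F).contDiff.comp_contDiffOn
    (h.fderiv_of_isOpen hN (by simp))

/-- Cartan's formula for a constant vector field. -/
lemma extDeriv_curryLeft {p : ℕ} {α : E → E [⋀^Fin (p + 1)]→L[ℝ] F} {y : E}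
    (h : DifferentiableAt ℝ α y) (v : E) :
    (extDeriv α y).curryLeft v = fderiv ℝ α y v - extDeriv (fun z => (α z).curryLeft v) y := by
  have h' : DifferentiableAt ℝ (fun z => (α z).curryLeft v) y :=
    ((ContinuousLinearMap.apply ℝ _ v).comp (ContinuousAlternatingMap.curryLeftLI (𝕜 := ℝ)
      (E := E) (F := F) (n := p)).toContinuousLinearMap).differentiableAt.comp y h
  ext w
  rw [ContinuousAlternatingMap.curryLeft_apply_apply, extDeriv_apply h, Fin.sum_univ_succ,
    ContinuousAlternatingMap.sub_apply, extDeriv_apply h']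
  have h1 : ∀ u, fderiv ℝ (fun z => α z u) y v = fderiv ℝ α y v u := fun u =>
    fderiv_continuousAlternatingMap_apply_const_apply h u v
  simp only [Fin.val_zero, pow_zero, one_smul, Matrix.cons_val_zero, Matrix.cons_val_succ,
    Fin.val_succ, pow_succ, mul_neg, mul_one, neg_smul, Finset.sum_neg_distrib, sub_eq_add_neg]
  have h2 : ∀ i : Fin (p + 1), i.succ.removeNth (Matrix.vecCons v w) =
      Matrix.vecCons v (i.removeNth w) := fun i => by
    funext j
    refine Fin.cases ?_ (fun j => ?_) j <;> simp [Fin.removeNth]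
  rw [h1]
  simp only [h2, ContinuousAlternatingMap.curryLeft_apply_apply]
  rfl

lemma extDeriv_apply_zero {α : E → E [⋀^Fin 0]→L[ℝ] F} {y : E}
    (h : DifferentiableAt ℝ α y) (w : Fin 1 → E) :
    extDeriv α y w = fderiv ℝ α y (w 0) (Fin.tail w) := by
  rw [extDeriv_apply h, Fin.sum_univ_one, Fin.val_zero, pow_zero, one_smul,
    fderiv_continuousAlternatingMap_apply_const_apply h]
  congr 1

lemma extDeriv_comp_clm {p : ℕ} (T : F →L[ℝ] G) {α : E → E [⋀^Fin p]→L[ℝ] F} {y : E}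
    (h : DifferentiableAt ℝ α y) :
    extDeriv (fun z => T.compContinuousAlternatingMap (α z)) y =
      T.compContinuousAlternatingMap (extDeriv α y) := by
  have h' : DifferentiableAt ℝ (fun z => T.compContinuousAlternatingMap (α z)) y :=
    (ContinuousLinearMap.compContinuousAlternatingMapCLM ℝ E F G (Fin p)
      T).differentiableAt.comp y h
  ext v
  rw [extDeriv_apply h', ContinuousLinearMap.compContinuousAlternatingMap_coe,
    Function.comp_apply, extDeriv_apply h, map_sum]
  refine Finset.sum_congr rfl fun i _ => ?_
  rw [map_zsmul]
  congr 1
  have h1 : DifferentiableAt ℝ (fun z => α z (i.removeNth v)) y :=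
    (ContinuousAlternatingMap.apply ℝ E F (i.removeNth v)).differentiableAt.comp y h
  exact DFunLike.congr_fun (T.hasFDerivAt.comp y h1.hasFDerivAt).fderiv (v i)

end Smoothness

/-! ## Graded forms with smooth coefficients -/

section SmoothRing

lemma two_le_infty : (2 : ℕ∞ω) ≤ ∞ := WithTop.coe_le_coe.2 (le_top : (2 : ℕ∞) ≤ ⊤)

variable {E R : Type*} [NormedAddCommGroup E] [NormedSpace ℝ E] [NormedRing R] [NormedAlgebra ℝ R]

variable (R) in
/-- The ring of functions which are smooth on `N`. -/
def smoothRing (N : Set E) : Subring (E → R) where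
  carrier := {f | ContDiffOn ℝ ∞ f N}
  mul_mem' hf hg := ContDiffOn.mul hf hg
  one_mem' := contDiffOn_const
  add_mem' hf hg := ContDiffOn.add hf hg
  zero_mem' := contDiffOn_const
  neg_mem' hf := ContDiffOn.neg hf

lemma smoothRing.differentiableAt {N : Set E} (hN : IsOpen N) (f : smoothRing R N) {y : E}
    (hy : y ∈ N) : DifferentiableAt ℝ f.1 y :=
  (f.2.contDiffAt (hN.mem_nhds hy)).differentiableAt (by simp)

variable (R) in
/-- The partial derivative in the direction of `v`, as an operator on the functions which are smooth
on `N`. -/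
def partialDeriv {N : Set E} (hN : IsOpen N) (v : E) : smoothRing R N →+ smoothRing R N where
  -- Cutting off to 0 outside N makes the Leibniz rule and the commutation of partial derivatives
  -- equalities of functions on all of E, as the algebra of `GForm` requires.
  toFun f := ⟨N.indicator fun y => fderiv ℝ f.1 y v, by
    have h : ContDiffOn ℝ ∞ (fun y => fderiv ℝ f.1 y v) N :=
      (f.2.fderiv_of_isOpen hN (by simp)).clm_apply contDiffOn_const
    exact h.congr fun y hy => Set.indicator_of_mem hy _⟩
  map_zero' := by
    ext y
    by_cases hy : y ∈ N <;> simp [hy]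
  map_add' f g := by
    ext y
    by_cases hy : y ∈ N
    · simp [hy, fderiv_add (smoothRing.differentiableAt hN f hy)
        (smoothRing.differentiableAt hN g hy)]
    · simp [hy]

variable {N : Set E} (hN : IsOpen N)

lemma partialDeriv_apply (v : E) (f : smoothRing R N) {y : E} (hy : y ∈ N) :
    (partialDeriv R hN v f).1 y = fderiv ℝ f.1 y v :=
  Set.indicator_of_mem hy (fun y => fderiv ℝ f.1 y v)

lemma partialDeriv_apply_of_notMem (v : E) (f : smoothRing R N) {y : E} (hy : y ∉ N) :
    (partialDeriv R hN v f).1 y = 0 :=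
  Set.indicator_of_notMem hy (fun y => fderiv ℝ f.1 y v)

lemma partialDeriv_mul (v : E) (f g : smoothRing R N) :
    partialDeriv R hN v (f * g) = partialDeriv R hN v f * g + f * partialDeriv R hN v g := by
  ext y
  change (partialDeriv R hN v (f * g)).1 y =
    (partialDeriv R hN v f).1 y * g.1 y + f.1 y * (partialDeriv R hN v g).1 y
  by_cases hy : y ∈ N
  · simp only [partialDeriv_apply hN _ _ hy, Subring.coe_mul]
    rw [fderiv_mul' (smoothRing.differentiableAt hN f hy)
        (smoothRing.differentiableAt hN g hy)]
    simp [add_comm]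
  · simp [partialDeriv_apply_of_notMem hN _ _ hy]

/-- Symmetry of the second derivative on N; off N both sides are cut off to 0. -/
lemma partialDeriv_comm (v w : E) (f : smoothRing R N) :
    partialDeriv R hN v (partialDeriv R hN w f) = partialDeriv R hN w (partialDeriv R hN v f) := by
  ext y
  by_cases hy : y ∈ N
  · have h1 : ∀ u, (partialDeriv R hN u f).1 =ᶠ[nhds y] fun z => fderiv ℝ f.1 z u := fun u => by
      filter_upwards [hN.mem_nhds hy] with z hz using partialDeriv_apply hN u f hz
    have h2 : ContDiffAt ℝ ∞ f.1 y := f.2.contDiffAt (hN.mem_nhds hy)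
    have h3 : DifferentiableAt ℝ (fderiv ℝ f.1) y :=
      (h2.fderiv_right (m := 1) two_le_infty).differentiableAt one_ne_zero
    have h4 : ∀ u u', fderiv ℝ (fun z => fderiv ℝ f.1 z u) y u' =
        fderiv ℝ (fderiv ℝ f.1) y u' u := fun u u' => by
      rw [fderiv_clm_apply h3 (differentiableAt_const u)]
      simp
    rw [partialDeriv_apply hN _ _ hy, partialDeriv_apply hN _ _ hy, (h1 w).fderiv_eq,
      (h1 v).fderiv_eq, h4, h4]
    exact h2.isSymmSndFDerivAt (by simpa using two_le_infty) v w
  · rw [partialDeriv_apply_of_notMem hN _ _ hy, partialDeriv_apply_of_notMem hN _ _ hy]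

variable (R) in
/-- The value at a point. -/
def smoothRing.eval (N : Set E) (y : E) : smoothRing R N →+* R :=
  (Pi.evalRingHom (fun _ : E => R) y).comp (smoothRing R N).subtype

namespace GForm

variable {p : ℕ}

lemma contDiffOn_hat {F : Type*} [NormedAddCommGroup F] [NormedSpace ℝ F]
    {α : E → E [⋀^Fin p]→L[ℝ] F} (h : ContDiffOn ℝ ∞ α N) (n : ℕ) (w : Fin n → E) :
    ContDiffOn ℝ ∞ (fun y => hat (α y) n w) N := by
  by_cases hn : n = p
  · subst hn
    simpa using h.alternating_apply w
  · simp only [hat_apply_of_ne _ hn]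
    exact contDiffOn_const

/-- A smooth differential form on `N` as a graded form over the ring of smooth functions. -/
def field (α : E → E [⋀^Fin p]→L[ℝ] R) (h : ContDiffOn ℝ ∞ α N) : GForm E (smoothRing R N) :=
  fun n w => ⟨fun y => hat (α y) n w, contDiffOn_hat h n w⟩

lemma map_eval_field {α : E → E [⋀^Fin p]→L[ℝ] R} (h : ContDiffOn ℝ ∞ α N) (y : E) :
    map (smoothRing.eval R N y : smoothRing R N →+ R) (field α h) = hat (α y) := rfl

lemma eps_field {α : E → E [⋀^Fin 1]→L[ℝ] R} (h : ContDiffOn ℝ ∞ α N) :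
    eps (field α h) = -field α h := by
  ext n w y
  have := congrArg (fun f => f n w) (eps_hat (α y))
  rw [pow_one, neg_smul, one_smul] at this
  exact this

/-- The exterior derivative of graded forms corresponds to `extDeriv`. -/
lemma map_eval_d_field {y : E} (hy : y ∈ N) (n : ℕ) : ∀ {p : ℕ} {α : E → E [⋀^Fin p]→L[ℝ] R}
    (h : ContDiffOn ℝ ∞ α N) (w : Fin n → E),
    (d (partialDeriv R hN) (field α h) n w).1 y = hat (extDeriv α y) n w := by
  induction n with
  | zero =>
    intro p α h w
    rw [d_zero_apply, hat_apply_of_ne _ (by lia)]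
    rfl
  | succ n ih =>
    intro p α h w
    have hd : DifferentiableAt ℝ α y :=
      (h.contDiffAt (hN.mem_nhds hy)).differentiableAt (by simp)
    have h1 : (map (partialDeriv R hN (w 0)) (field α h) n (Fin.tail w)).1 y =
        hat (fderiv ℝ α y (w 0)) n (Fin.tail w) := by
      rw [map_apply, partialDeriv_apply hN _ _ hy]
      by_cases hn : n = p
      · subst hn
        simp only [field, hat_apply]
        exact fderiv_continuousAlternatingMap_apply_const_apply hd _ _
      · simp [field, hat_apply_of_ne _ hn]
    simp only [apply_succ _ n w, contr_d, contr_hat, sub_apply]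
    change (map (partialDeriv R hN (w 0)) (field α h) n (Fin.tail w)).1 y - _ = _
    rw [h1]
    cases p with
    | zero =>
      have h2 : contr (w 0) (field α h) = 0 := by
        ext m u z
        exact congrArg (fun f => f m u) (contr_hat_zero (α z) (w 0))
      rw [h2, d_zero, zero_apply, ZeroMemClass.coe_zero, Pi.zero_apply, sub_zero]
      congr 1
      congr 1
      ext u
      rw [ContinuousAlternatingMap.curryLeft_apply_apply, extDeriv_apply_zero hd]
      congr 1
    | succ p =>
      have h3 : ContDiffOn ℝ ∞ (fun z => (α z).curryLeft (w 0)) N :=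
        (((ContinuousLinearMap.apply ℝ _ (w 0)).comp (ContinuousAlternatingMap.curryLeftLI (𝕜 := ℝ)
          (E := E) (F := R) (n := p)).toContinuousLinearMap)).contDiff.comp_contDiffOn h
      have h2 : contr (w 0) (field α h) = field _ h3 := by
        ext m u z
        exact congrArg (fun f => f m u) (contr_hat (α z) (w 0))
      rw [h2, ih h3, extDeriv_curryLeft hd, sub_eq_add_neg, sub_eq_add_neg, hat_add]
      rw [← neg_one_smul ℝ (extDeriv _ y), hat_smul]
      simp

lemma map_eval_d {y : E} (hy : y ∈ N) {α : E → E [⋀^Fin p]→L[ℝ] R}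
    (h : ContDiffOn ℝ ∞ α N) :
    map (smoothRing.eval R N y : smoothRing R N →+ R) (d (partialDeriv R hN) (field α h)) =
      hat (extDeriv α y) :=
  ext fun n w => map_eval_d_field hN hy n h w

end GForm

end SmoothRing

namespace GForm

variable {E R Z : Type*} [NormedAddCommGroup E] [NormedSpace ℝ E]
  [NormedRing R] [NormedAlgebra ℝ R] [NormedAddCommGroup Z] [NormedSpace ℝ Z] {N : Set E}

/-! ## Closedness of Chern forms and the transgression formula, on open sets -/

lemma ext_eval {f g : GForm E (smoothRing R N)}
    (h : ∀ y, map (smoothRing.eval R N y : smoothRing R N →+ R) f =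
      map (smoothRing.eval R N y : smoothRing R N →+ R) g) : f = g := by
  ext n w y
  exact congrArg (fun f => f n w) (h y)

lemma map_eval_mul (f g : GForm E (smoothRing R N)) (y : E) :
    map (smoothRing.eval R N y : smoothRing R N →+ R) (f * g) =
      map (smoothRing.eval R N y : smoothRing R N →+ R) f *
        map (smoothRing.eval R N y : smoothRing R N →+ R) g := map_mul _ f g

lemma field_wedge {p q : ℕ} {α : E → E [⋀^Fin p]→L[ℝ] R} {β : E → E [⋀^Fin q]→L[ℝ] R}
    (hα : ContDiffOn ℝ ∞ α N) (hβ : ContDiffOn ℝ ∞ β N)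
    (h : ContDiffOn ℝ ∞ (fun y => wedge (ContinuousLinearMap.mul ℝ R) (α y) (β y)) N) :
    field _ h = field α hα * field β hβ := by
  refine ext_eval fun y => ?_
  rw [map_eval_mul, map_eval_field, map_eval_field, map_eval_field, hat_wedge]

lemma field_wedgePow [FiniteDimensional ℝ E] {Φ : E → E [⋀^Fin 2]→L[ℝ] R}
    (hΦ : ContDiffOn ℝ ∞ Φ N) (k : ℕ) : field _ (hΦ.wedgePow k) = field Φ hΦ ^ k := by
  induction k with
  | zero =>
    rw [pow_zero]
    ext n w y
    refine (congrArg (fun f => f n w) (hat_one (E := E) (R := R))).trans ?_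
    change (if n = 0 then (1 : R) else 0) = (if n = 0 then (1 : smoothRing R N) else 0).1 y
    split_ifs <;> rfl
  | succ k ih =>
    rw [pow_succ, ← ih]
    exact field_wedge (hΦ.wedgePow k) hΦ _

variable [FiniteDimensional ℝ E] (hN : IsOpen N)
include hN

/-- The equation is one between functions on all of E. The cut-off differential vanishes off N, so γ
and Φ are required to vanish there too. -/
lemma field_curvature {γ : E → E [⋀^Fin 1]→L[ℝ] R} {Φ : E → E [⋀^Fin 2]→L[ℝ] R}
    (hγ : ContDiffOn ℝ ∞ γ N) (hΦ : ContDiffOn ℝ ∞ Φ N)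
    (h : ∀ y ∈ N, Φ y = extDeriv γ y + wedge (ContinuousLinearMap.mul ℝ R) (γ y) (γ y))
    (h0 : ∀ y ∉ N, γ y = 0 ∧ Φ y = 0) :
    field Φ hΦ = d (partialDeriv R hN) (field γ hγ) + field γ hγ * field γ hγ := by
  refine ext_eval fun y => ?_
  rw [map_add, map_eval_mul, map_eval_field, map_eval_field]
  by_cases hy : y ∈ N
  · rw [map_eval_d hN hy, h y hy, hat_add, ← hat_wedge]
  · have hz : ∀ p, hat (0 : E [⋀^Fin p]→L[ℝ] R) = 0 := fun p => by
      simpa using hat_smul 0 (0 : E [⋀^Fin p]→L[ℝ] R)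
    rw [(h0 y hy).1, (h0 y hy).2, hz, hz, mul_zero, add_zero]
    ext n w
    have hs : ∀ (n : ℕ) (f : GForm E (smoothRing R N)) (w : Fin n → E),
        (d (partialDeriv R hN) f n w).1 y = 0 := by
      intro n
      induction n with
      | zero => intro f w; rfl
      | succ n ih =>
        intro f w
        simp only [apply_succ _ n w, contr_d, sub_apply]
        change (partialDeriv R hN (w 0) _).1 y - _ = 0
        rw [ih, partialDeriv_apply_of_notMem hN _ _ hy, sub_zero]
    exact (hs n _ w).symm

variable (T : R →L[ℝ] Z) (hT : ∀ a b, T (a * b) = T (b * a))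
include hT

omit hN [FiniteDimensional ℝ E] in
lemma trace_eval_comm (y : E) (a b : smoothRing R N) :
    ((T : R →+ Z).comp (smoothRing.eval R N y : smoothRing R N →+ R)) (a * b) =
      ((T : R →+ Z).comp (smoothRing.eval R N y : smoothRing R N →+ R)) (b * a) :=
  hT (a.1 y) (b.1 y)

omit hT [FiniteDimensional ℝ E] in
lemma extDeriv_trace {p : ℕ} {α : E → E [⋀^Fin p]→L[ℝ] R} (h : ContDiffOn ℝ ∞ α N) {y : E}
    (hy : y ∈ N) (v : Fin (p + 1) → E) :
    extDeriv (fun z => T.compContinuousAlternatingMap (α z)) y v =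
      map ((T : R →+ Z).comp (smoothRing.eval R N y : smoothRing R N →+ R))
        (d (partialDeriv R hN) (field α h)) (p + 1) v := by
  rw [extDeriv_comp_clm T ((h.contDiffAt (hN.mem_nhds hy)).differentiableAt (by simp))]
  change T (extDeriv α y v) =
    T (map (smoothRing.eval R N y : smoothRing R N →+ R) (d (partialDeriv R hN) (field α h))
      (p + 1) v)
  rw [map_eval_d hN hy]
  simp only [hat_apply]

omit hT hN [FiniteDimensional ℝ E] in
open Classical in
lemma contDiffOn_ite {F : Type*} [NormedAddCommGroup F] [NormedSpace ℝ F] {α : E → F}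
    (h : ContDiffOn ℝ ∞ α N) : ContDiffOn ℝ ∞ (fun y => if y ∈ N then α y else 0) N :=
  h.congr fun _ hy => if_pos hy

omit hT [FiniteDimensional ℝ E] in
open Classical in
lemma extDeriv_ite {F : Type*} [NormedAddCommGroup F] [NormedSpace ℝ F] {p : ℕ}
    (α : E → E [⋀^Fin p]→L[ℝ] F) {y : E} (hy : y ∈ N) :
    extDeriv (fun y => if y ∈ N then α y else 0) y = extDeriv α y := by
  refine Filter.EventuallyEq.extDeriv_eq ?_
  filter_upwards [hN.mem_nhds hy] with z hz using if_pos hz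

/-- The trace of a power of the curvature is closed. -/
theorem extDeriv_trace_wedgePow {γ : E → E [⋀^Fin 1]→L[ℝ] R} {Φ : E → E [⋀^Fin 2]→L[ℝ] R}
    (hγ : ContDiffOn ℝ ∞ γ N) (hΦ : ContDiffOn ℝ ∞ Φ N)
    (h : ∀ y ∈ N, Φ y = extDeriv γ y + wedge (ContinuousLinearMap.mul ℝ R) (γ y) (γ y))
    (k : ℕ) {y : E} (hy : y ∈ N) :
    extDeriv (fun z => T.compContinuousAlternatingMap (wedgePow (Φ z) k)) y = 0 := by
  classical
  -- Extending γ and Φ by 0 off N changes nothing near y, since N is open, and makes the curvature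
  -- equation hold in the ring of graded forms.
  wlog h0 : ∀ y ∉ N, γ y = 0 ∧ Φ y = 0 generalizing γ Φ
  · have := this (contDiffOn_ite hγ) (contDiffOn_ite hΦ)
      (fun z hz => by rw [if_pos hz, if_pos hz, extDeriv_ite hN γ hz, h z hz])
      (fun z hz => ⟨if_neg hz, if_neg hz⟩)
    rw [← this]
    refine Filter.EventuallyEq.extDeriv_eq ?_
    filter_upwards [hN.mem_nhds hy] with z hz
    rw [if_pos hz]
  ext v
  rw [extDeriv_trace hN T (hΦ.wedgePow k) hy, field_wedgePow hΦ, field_curvature hN hγ hΦ h h0,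
    trace_d_curvature_pow _ _ (partialDeriv_mul hN) (partialDeriv_comm hN)
      (trace_eval_comm T hT y) (eps_field hγ)]
  rfl

/-- The differential of the transgression form. -/
theorem extDeriv_trace_wedgePow_wedge {γ : E → E [⋀^Fin 1]→L[ℝ] R}
    {Φ : E → E [⋀^Fin 2]→L[ℝ] R} {θ : E → E [⋀^Fin 1]→L[ℝ] R}
    (hγ : ContDiffOn ℝ ∞ γ N) (hΦ : ContDiffOn ℝ ∞ Φ N) (hθ : ContDiffOn ℝ ∞ θ N)
    (h : ∀ y ∈ N, Φ y = extDeriv γ y + wedge (ContinuousLinearMap.mul ℝ R) (γ y) (γ y))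
    (k : ℕ) {y : E} (hy : y ∈ N) :
    extDeriv (fun z => T.compContinuousAlternatingMap
        (wedge (ContinuousLinearMap.mul ℝ R) (wedgePow (Φ z) k) (θ z))) y =
      T.compContinuousAlternatingMap (wedge (ContinuousLinearMap.mul ℝ R) (wedgePow (Φ y) k)
        (extDeriv θ y + wedge (ContinuousLinearMap.mul ℝ R) (γ y) (θ y) +
          wedge (ContinuousLinearMap.mul ℝ R) (θ y) (γ y))) := by
  classical
  wlog h0 : ∀ y ∉ N, γ y = 0 ∧ Φ y = 0 generalizing γ Φ
  · have := this (contDiffOn_ite hγ) (contDiffOn_ite hΦ)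
      (fun z hz => by rw [if_pos hz, if_pos hz, extDeriv_ite hN γ hz, h z hz])
      (fun z hz => ⟨if_neg hz, if_neg hz⟩)
    rw [if_pos hy, if_pos hy] at this
    rw [← this]
    refine Filter.EventuallyEq.extDeriv_eq ?_
    filter_upwards [hN.mem_nhds hy] with z hz
    rw [if_pos hz]
  have hw := (hΦ.wedgePow k).wedge (ContinuousLinearMap.mul ℝ R) hθ
  ext v
  rw [extDeriv_trace hN T hw hy, field_wedge (hΦ.wedgePow k) hθ, field_wedgePow hΦ,
    field_curvature hN hγ hΦ h h0, trace_d_curvature_pow_mul _ _ (partialDeriv_mul hN)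
      (partialDeriv_comm hN) (trace_eval_comm T hT y) (eps_field hγ),
    ← field_curvature hN hγ hΦ h h0, ← field_wedgePow]
  change T (map (smoothRing.eval R N y : smoothRing R N →+ R) _ (2 * k + 1 + 1) v) = T _
  congr 1
  -- As θ has degree one, ε(θ) = −θ, and the covariant derivative of θ is dθ + γθ + θγ.
  rw [map_eval_mul, map_eval_field, nabla, map_sub, map_add, map_eval_mul, map_eval_mul, eps_field,
    map_neg, map_eval_field, map_eval_field, map_eval_d hN hy, neg_mul, sub_neg_eq_add,
    ← hat_wedge, ← hat_wedge, ← hat_add, ← hat_add, ← hat_wedge]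
  exact hat_apply _ v

end GForm

/-! ## Dependence of the trace of the powers on a parameter -/

section Parameter

variable {E R Z : Type*} [NormedAddCommGroup E] [NormedSpace ℝ E]
  [NormedRing R] [NormedAlgebra ℝ R] [NormedAddCommGroup Z] [NormedSpace ℝ Z]

namespace GForm

/-- Derivatives are taken with the vectors held fixed. Contraction and `eps` commute with them, so
the Leibniz rule of R passes through the recursion defining the product. -/
lemma hasDerivAt_mul {f g : ℝ → GForm E R} {f' g' : GForm E R} {t : ℝ}
    (hf : ∀ n w, HasDerivAt (fun s => f s n w) (f' n w) t)
    (hg : ∀ n w, HasDerivAt (fun s => g s n w) (g' n w) t) (n : ℕ) (w : Fin n → E) :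
    HasDerivAt (fun s => (f s * g s) n w) ((f' * g t + f t * g') n w) t := by
  induction n generalizing f g f' g' with
  | zero => exact (hf 0 w).mul (hg 0 w)
  | succ n ih =>
    have h1 := ih (f := fun s => contr (w 0) (f s)) (f' := contr (w 0) f')
      (fun m u => hf (m + 1) _) hg (Fin.tail w)
    have h2 := ih (f := fun s => eps (f s)) (f' := eps f') (g := fun s => contr (w 0) (g s))
      (g' := contr (w 0) g')
      (fun m u => by
        have := (hf m u).const_smul ((-1 : ℝ) ^ m)
        rcases Nat.even_or_odd m with h | h <;>
          simp only [eps, h.neg_one_pow, one_smul, neg_smul] at this ⊢ <;> exact this)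
      (fun m u => hg (m + 1) _) (Fin.tail w)
    simp only [apply_succ _ n w, contr_add, contr_mul, add_apply] at h1 h2 ⊢
    rw [add_add_add_comm]
    exact h1.add h2

lemma hasDerivAt_pow {f : ℝ → GForm E R} {f' : GForm E R} {t : ℝ}
    (hf : ∀ n w, HasDerivAt (fun s => f s n w) (f' n w) t) (k : ℕ) (n : ℕ) (w : Fin n → E) :
    HasDerivAt (fun s => (f s ^ k) n w) (derivPow (f t) f' k n w) t := by
  induction k generalizing n w with
  | zero =>
    simp only [pow_zero]
    exact hasDerivAt_const _ _
  | succ k ih =>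
    simp only [pow_succ]
    exact hasDerivAt_mul ih hf n w

end GForm

-- Differentiating the power puts Φ' in each of k + 1 places; since 2-forms are even, cyclicity of
-- the trace moves it to the end each time.
open GForm in
lemma hasDerivAt_trace_wedgePow (T : R →L[ℝ] Z) (hT : ∀ a b, T (a * b) = T (b * a))
    {Φ : ℝ → E [⋀^Fin 2]→L[ℝ] R} {Φ' : E [⋀^Fin 2]→L[ℝ] R} {t : ℝ}
    (h : ∀ v, HasDerivAt (fun s => Φ s v) (Φ' v) t) (k : ℕ) (v : Fin (2 * (k + 1)) → E) :
    HasDerivAt (fun s => T (wedgePow (Φ s) (k + 1) v))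
      (((k + 1 : ℕ) : ℝ) • T (wedge (ContinuousLinearMap.mul ℝ R) (wedgePow (Φ t) k) Φ' v)) t := by
  have h1 : ∀ n w, HasDerivAt (fun s => hat (Φ s) n w) (hat Φ' n w) t := by
    intro n w
    by_cases hn : n = 2
    · subst hn
      simpa using h w
    · simp only [hat_apply_of_ne _ hn]
      exact hasDerivAt_const _ _
  have h2 := T.hasFDerivAt.comp_hasDerivAt t (hasDerivAt_pow h1 (k + 1) (2 * (k + 1)) v)
  have h3 := trace_derivPow_mul (T : R →+ Z) hT (f := hat (Φ t))
    (by rw [eps_hat, neg_one_sq, one_smul]) (hat Φ') k 0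
  rw [pow_zero, mul_one, add_zero] at h3
  have h4 : T (derivPow (hat (Φ t)) (hat Φ') (k + 1) (2 * (k + 1)) v) =
      (k + 1) • T ((hat (Φ t) ^ k * hat Φ') (2 * (k + 1)) v) :=
    congrArg (fun f => f (2 * (k + 1)) v) h3
  rw [h4, ← hat_wedgePow, ← hat_wedge, ← Nat.cast_smul_eq_nsmul ℝ] at h2
  have h5 : hat (wedge (ContinuousLinearMap.mul ℝ R) (wedgePow (Φ t) k) Φ') (2 * (k + 1)) v =
      wedge (ContinuousLinearMap.mul ℝ R) (wedgePow (Φ t) k) Φ' v := hat_apply _ v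
  rw [h5] at h2
  refine h2.congr_of_eventuallyEq (Filter.Eventually.of_forall fun s => ?_)
  change _ = T ((hat (Φ s) ^ (k + 1)) (2 * (k + 1)) v)
  rw [← hat_wedgePow, hat_apply]

end Parameter

/-! ## Polynomial curves -/

section PolyCurves

variable {X Y Z : Type*} [AddCommGroup X] [Module ℝ X] [AddCommGroup Y] [Module ℝ Y]
  [AddCommGroup Z] [Module ℝ Z]

variable (X) in
/-- The polynomial curves of degree less than `N`. -/
def polyCurves (N : ℕ) : Submodule ℝ (ℝ → X) :=
  Submodule.span ℝ {f | ∃ m < N, ∃ c : X, f = fun t => t ^ m • c}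

lemma polyCurves_monomial {N m : ℕ} (h : m < N) (c : X) :
    (fun t : ℝ => t ^ m • c) ∈ polyCurves X N :=
  Submodule.subset_span ⟨m, h, c, rfl⟩

lemma polyCurves_const {N : ℕ} (h : 0 < N) (c : X) : (fun _ : ℝ => c) ∈ polyCurves X N := by
  simpa using polyCurves_monomial h c

lemma polyCurves_bilinear (b : X →ₗ[ℝ] Y →ₗ[ℝ] Z) {N K : ℕ} {f : ℝ → X} {g : ℝ → Y}
    (hf : f ∈ polyCurves X (N + 1)) (hg : g ∈ polyCurves Y (K + 1)) :
    (fun t => b (f t) (g t)) ∈ polyCurves Z (N + K + 1) := by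
  induction hf using Submodule.span_induction with
  | mem f h =>
    obtain ⟨m, hm, c, rfl⟩ := h
    induction hg using Submodule.span_induction with
    | mem g h =>
      obtain ⟨l, hl, c', rfl⟩ := h
      simp only [map_smul, LinearMap.smul_apply, smul_smul, ← pow_add]
      exact polyCurves_monomial (by lia) _
    | zero => convert Submodule.zero_mem _ using 1; funext t; simp
    | add g g' _ _ h h' => convert Submodule.add_mem _ h h' using 1; funext t; simp
    | smul a g _ h => convert Submodule.smul_mem _ a h using 1; funext t; simp
  | zero => convert Submodule.zero_mem _ using 1; funext t; simp
  | add g g' _ _ h h' => convert Submodule.add_mem _ h h' using 1; funext t; simp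
  | smul a g _ h => convert Submodule.smul_mem _ a h using 1; funext t; simp

lemma polyCurves_comp (b : X →ₗ[ℝ] Y) {N : ℕ} {f : ℝ → X} (hf : f ∈ polyCurves X N) :
    (fun t => b (f t)) ∈ polyCurves Y N := by
  induction hf using Submodule.span_induction with
  | mem f h =>
    obtain ⟨m, hm, c, rfl⟩ := h
    simp only [map_smul]
    exact polyCurves_monomial hm _
  | zero => convert Submodule.zero_mem _ using 1; funext t; simp
  | add g g' _ _ h h' => convert Submodule.add_mem _ h h' using 1; funext t; simp
  | smul a g _ h => convert Submodule.smul_mem _ a h using 1; funext t; simp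

lemma exists_coeff_of_mem_polyCurves {N : ℕ} {f : ℝ → X} (hf : f ∈ polyCurves X N) :
    ∃ c : ℕ → X, ∀ t, f t = ∑ m ∈ Finset.range N, t ^ m • c m := by
  induction hf using Submodule.span_induction with
  | mem f h =>
    obtain ⟨m, hm, c, rfl⟩ := h
    refine ⟨Pi.single m c, fun t => ?_⟩
    rw [Finset.sum_eq_single m]
    · simp
    · intro l _ hl
      simp [hl]
    · intro h
      exact absurd (Finset.mem_range.2 hm) h
  | zero => exact ⟨0, by simp⟩
  | add g g' _ _ h h' =>
    obtain ⟨c, hc⟩ := h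
    obtain ⟨c', hc'⟩ := h'
    exact ⟨c + c', fun t => by simp [hc, hc', Finset.sum_add_distrib]⟩
  | smul a g _ h =>
    obtain ⟨c, hc⟩ := h
    exact ⟨a • c, fun t => by simp [hc, Finset.smul_sum, smul_comm a]⟩

/-- A polynomial which vanishes identically has vanishing coefficients. -/
lemma coeff_eq_zero_of_sum_eq_zero {N : ℕ} {c : ℕ → X}
    (h : ∀ t : ℝ, ∑ m ∈ Finset.range N, t ^ m • c m = 0) {m : ℕ} (hm : m < N) : c m = 0 := by
  rw [← Module.forall_dual_apply_eq_zero_iff ℝ]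
  intro φ
  have h1 : ∑ m ∈ Finset.range N, Polynomial.monomial m (φ (c m)) = 0 := by
    refine Polynomial.funext fun t => ?_
    have := congrArg φ (h t)
    simp only [map_sum, map_smul, smul_eq_mul, map_zero] at this
    rw [Polynomial.eval_finsetSum, Polynomial.eval_zero, ← this]
    exact Finset.sum_congr rfl fun m _ => by rw [Polynomial.eval_monomial, mul_comm]
  have h2 := congrArg (fun p => Polynomial.coeff p m) h1
  simpa [Polynomial.finsetSum_coeff, Polynomial.coeff_monomial, hm] using h2

/-- If the derivative of a polynomial takes its values in a subspace, then so do the differences of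
its values. -/
lemma sub_mem_of_deriv_mem {S : Submodule ℝ X} {N : ℕ} {c : ℕ → X}
    (h : ∀ t : ℝ, ∑ m ∈ Finset.range N, (m * t ^ (m - 1)) • c m ∈ S) :
    ∑ m ∈ Finset.range N, (1 : ℝ) ^ m • c m - ∑ m ∈ Finset.range N, (0 : ℝ) ^ m • c m ∈ S := by
  have h1 : ∀ m < N, m ≠ 0 → c m ∈ S := by
    intro m hm hm0
    obtain ⟨N, rfl⟩ : ∃ K, N = K + 1 := ⟨N - 1, by lia⟩
    -- Modulo S the derivative is the zero polynomial, so its coefficients (m + 1) c (m + 1) vanish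
    -- there. The term m = 0 of the sum drops out, which is why the constant coefficient is not
    -- constrained.
    have h2 : ∀ t : ℝ,
        ∑ m ∈ Finset.range N, t ^ m • (((m + 1 : ℕ) : ℝ) • S.mkQ (c (m + 1))) = 0 := by
      intro t
      have := (Submodule.Quotient.mk_eq_zero S).2 (h t)
      rw [← Submodule.mkQ_apply, map_sum, Finset.sum_range_succ'] at this
      rw [← this]
      simp [smul_smul, mul_comm]
    obtain ⟨m, rfl⟩ : ∃ l, m = l + 1 := ⟨m - 1, by lia⟩
    have h3 := coeff_eq_zero_of_sum_eq_zero h2 (m := m) (by lia)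
    rw [smul_eq_zero] at h3
    rcases h3 with h3 | h3
    · exact absurd h3 (by positivity)
    · simpa using h3
  rw [← Finset.sum_sub_distrib]
  refine Submodule.sum_mem _ fun m hm => ?_
  rcases Nat.eq_zero_or_pos m with rfl | hm0
  · simp
  · rw [zero_pow hm0.ne', zero_smul, sub_zero, one_pow, one_smul]
    exact h1 m (Finset.mem_range.1 hm) hm0.ne'

end PolyCurves

/-! ### Bilinearity of the wedge product and polynomial wedge powers. -/

section WedgePolynomial

variable {T F G H : Type*} [AddCommGroup T] [Module ℝ T] [TopologicalSpace T]
  [NormedAddCommGroup F] [NormedSpace ℝ F] [NormedAddCommGroup G] [NormedSpace ℝ G]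
  [NormedAddCommGroup H] [NormedSpace ℝ H]

lemma wedge_apply {p q : ℕ} (B : F →L[ℝ] G →L[ℝ] H) (α : T [⋀^Fin p]→L[ℝ] F)
    (β : T [⋀^Fin q]→L[ℝ] G) (v : Fin (p + q) → T) :
    wedge B α β v = ((p.factorial * q.factorial : ℝ)⁻¹) • ∑ σ : Equiv.Perm (Fin (p + q)),
      Equiv.Perm.sign σ • B (α fun i => v (σ (Fin.castAdd q i)))
        (β fun i => v (σ (Fin.natAdd p i))) := by
  simp only [wedge, ContinuousAlternatingMap.smul_apply,
    ContinuousMultilinearMap.alternatization_apply_apply]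
  rfl

/-- The wedge product as a bilinear map. -/
def wedgeₗ {p q : ℕ} (B : F →L[ℝ] G →L[ℝ] H) :
    T [⋀^Fin p]→L[ℝ] F →ₗ[ℝ] T [⋀^Fin q]→L[ℝ] G →ₗ[ℝ] T [⋀^Fin (p + q)]→L[ℝ] H :=
  LinearMap.mk₂ ℝ (wedge B)
    (fun α α' β => by
      ext v
      simp [wedge_apply, Finset.sum_add_distrib])
    (fun c α β => by
      ext v
      simp [wedge_apply, Finset.smul_sum, smul_comm c])
    (fun α β β' => by
      ext v
      simp [wedge_apply, Finset.sum_add_distrib])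
    (fun c α β => by
      ext v
      simp [wedge_apply, Finset.smul_sum, smul_comm c])

lemma polyCurves_wedgePow {R : Type*} [NormedRing R] [NormedAlgebra ℝ R]
    {Φ : ℝ → T [⋀^Fin 2]→L[ℝ] R} {N : ℕ} (h : Φ ∈ polyCurves _ (N + 1)) (k : ℕ) :
    (fun t => wedgePow (Φ t) k) ∈ polyCurves (T [⋀^Fin (2 * k)]→L[ℝ] R) (k * N + 1) := by
  induction k with
  | zero => exact polyCurves_const (by lia) _
  | succ k ih =>
    have := polyCurves_bilinear (wedgeₗ (ContinuousLinearMap.mul ℝ R)) ih h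
    rwa [show (k + 1) * N = k * N + N by ring]

end WedgePolynomial

/-! ### Pull-back of wedge products, and the product of two 1-forms. -/

section WedgeNaturality

variable {T T' F G H : Type*} [AddCommGroup T] [Module ℝ T] [TopologicalSpace T]
  [AddCommGroup T'] [Module ℝ T'] [TopologicalSpace T']
  [NormedAddCommGroup F] [NormedSpace ℝ F] [NormedAddCommGroup G] [NormedSpace ℝ G]
  [NormedAddCommGroup H] [NormedSpace ℝ H]

lemma wedge_compContinuousLinearMap {p q : ℕ} (B : F →L[ℝ] G →L[ℝ] H) (α : T [⋀^Fin p]→L[ℝ] F)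
    (β : T [⋀^Fin q]→L[ℝ] G) (L : T' →L[ℝ] T) :
    (wedge B α β).compContinuousLinearMap L =
      wedge B (α.compContinuousLinearMap L) (β.compContinuousLinearMap L) := by
  ext v
  simp only [ContinuousAlternatingMap.compContinuousLinearMap_apply, wedge_apply]
  rfl

variable {R S : Type*} [NormedRing R] [NormedAlgebra ℝ R] [NormedRing S] [NormedAlgebra ℝ S]

lemma wedgePow_compContinuousLinearMap (Φ : T [⋀^Fin 2]→L[ℝ] R) (L : T' →L[ℝ] T) (k : ℕ) :
    (wedgePow Φ k).compContinuousLinearMap L = wedgePow (Φ.compContinuousLinearMap L) k := by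
  induction k with
  | zero => rfl
  | succ k ih =>
    rw [wedgePow, wedgePow, ← ih]
    exact wedge_compContinuousLinearMap _ _ _ _

lemma univ_perm_fin_two : (Finset.univ : Finset (Equiv.Perm (Fin 2))) = {1, Equiv.swap 0 1} := by
  decide

lemma wedge_apply_one_one (B : F →L[ℝ] G →L[ℝ] H) (α : T [⋀^Fin 1]→L[ℝ] F)
    (β : T [⋀^Fin 1]→L[ℝ] G) (v : Fin 2 → T) :
    wedge B α β v = B (α fun _ => v 0) (β fun _ => v 1) - B (α fun _ => v 1) (β fun _ => v 0) := by
  have h := wedge_apply B α β v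
  have h1 : ∀ σ : Equiv.Perm (Fin 2),
      (fun i : Fin 1 => v (σ (Fin.castAdd 1 i))) = fun _ => v (σ 0) :=
    fun σ => by funext i; fin_cases i; rfl
  have h2 : ∀ σ : Equiv.Perm (Fin 2),
      (fun i : Fin 1 => v (σ (Fin.natAdd 1 i))) = fun _ => v (σ 1) :=
    fun σ => by funext i; fin_cases i; rfl
  change _ = _ • ∑ σ : Equiv.Perm (Fin 2), _ at h
  rw [univ_perm_fin_two, Finset.sum_pair (by decide)] at h
  rw [h, h1, h2, h1, h2]
  simp [sub_eq_add_neg]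

end WedgeNaturality

/-! ## Forms on manifolds with values in a fixed space -/

section ManifoldForms

variable {E : Type*} [NormedAddCommGroup E] [NormedSpace ℝ E]
  {M : Type*} [TopologicalSpace M] [ChartedSpace E M]
  {F G H : Type*} [NormedAddCommGroup F] [NormedSpace ℝ F] [NormedAddCommGroup G] [NormedSpace ℝ G]
  [NormedAddCommGroup H] [NormedSpace ℝ H] {U : Set M} {p q : ℕ}

namespace DForm

/-- Smoothness over `U` of a form with values in a fixed normed space. -/
def SmoothOn (α : DForm E (fun _ : M => F) p) (U : Set M) : Prop :=
  α.SmoothThrough U (fun _ => ContinuousLinearMap.id ℝ F)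

lemma isSmooth_iff_smoothOn {α : DForm E (fun _ : M => F) p} :
    α.IsSmooth ↔ α.SmoothOn Set.univ := Iff.rfl

lemma smoothOn_iff {α : DForm E (fun _ : M => F) p} :
    α.SmoothOn U ↔ ∀ e ∈ atlas E M,
      ContDiffOn ℝ ∞ (fun y => α.inChart e y) (e.target ∩ e.symm ⁻¹' U) := Iff.rfl

lemma SmoothOn.mono {α : DForm E (fun _ : M => F) p} {U' : Set M} (h : α.SmoothOn U)
    (hU : U' ⊆ U) : α.SmoothOn U' :=
  fun e he => (h e he).mono (Set.inter_subset_inter_right _ (Set.preimage_mono hU))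

lemma isOpen_inChart (e : OpenPartialHomeomorph M E) (hU : IsOpen U) :
    IsOpen (e.target ∩ e.symm ⁻¹' U) := e.symm.isOpen_inter_preimage hU

lemma SmoothOn.congr {α β : DForm E (fun _ : M => F) p} (h : α.SmoothOn U)
    (h' : ∀ x ∈ U, α x = β x) : β.SmoothOn U := by
  refine smoothOn_iff.2 fun e he => (smoothOn_iff.1 h e he).congr fun y hy => ?_
  rw [inChart, inChart, h' _ hy.2]

lemma smoothOn_of_locally {α : DForm E (fun _ : M => F) p}
    (h : ∀ x ∈ U, ∃ O, IsOpen O ∧ x ∈ O ∧ α.SmoothOn O) : α.SmoothOn U := by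
  refine smoothOn_iff.2 fun e he y hy => ?_
  obtain ⟨O, hO, hx, hα⟩ := h _ hy.2
  exact ((smoothOn_iff.1 hα e he).contDiffAt
    ((isOpen_inChart e hO).mem_nhds ⟨hy.1, hx⟩)).contDiffWithinAt

lemma SmoothOn.add {α β : DForm E (fun _ : M => F) p} (hα : α.SmoothOn U) (hβ : β.SmoothOn U) :
    (α + β).SmoothOn U :=
  fun e he => (smoothOn_iff.1 hα e he).add (smoothOn_iff.1 hβ e he)

lemma SmoothOn.const_smul {α : DForm E (fun _ : M => F) p} (hα : α.SmoothOn U) (c : ℝ) :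
    (c • α).SmoothOn U :=
  fun e he => (smoothOn_iff.1 hα e he).const_smul c

lemma SmoothOn.comp_clm (T : F →L[ℝ] G) {α : DForm E (fun _ : M => F) p} (hα : α.SmoothOn U) :
    DForm.SmoothOn (fun x => T.compContinuousAlternatingMap (α x) : DForm E (fun _ : M => G) p) U :=
  fun e he => ((ContinuousLinearMap.compContinuousAlternatingMapCLM ℝ E F G (Fin p)
    T).contDiff.comp_contDiffOn (smoothOn_iff.1 hα e he))

lemma SmoothOn.wedge [FiniteDimensional ℝ E] (B : F →L[ℝ] G →L[ℝ] H)
    {α : DForm E (fun _ : M => F) p} {β : DForm E (fun _ : M => G) q} (hα : α.SmoothOn U)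
    (hβ : β.SmoothOn U) :
    DForm.SmoothOn (fun x => _root_.wedge B (α x) (β x) : DForm E (fun _ : M => H) (p + q)) U := by
  refine smoothOn_iff.2 fun e he => ?_
  refine ((smoothOn_iff.1 hα e he).wedge B (smoothOn_iff.1 hβ e he)).congr fun y _ => ?_
  exact wedge_compContinuousLinearMap B _ _ _

lemma SmoothOn.wedgePow [FiniteDimensional ℝ E] {R : Type*} [NormedRing R] [NormedAlgebra ℝ R]
    {Φ : DForm E (fun _ : M => R) 2} (h : Φ.SmoothOn U) (k : ℕ) :
    DForm.SmoothOn (fun x => _root_.wedgePow (Φ x) k : DForm E (fun _ : M => R) (2 * k)) U := by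
  refine smoothOn_iff.2 fun e he => ?_
  exact ((smoothOn_iff.1 h e he).wedgePow k).congr fun y _ =>
    wedgePow_compContinuousLinearMap _ _ k

variable [IsManifold 𝓘(ℝ, E) ∞ M]

lemma mdifferentiable_of_mem_atlas' {e : OpenPartialHomeomorph M E} (he : e ∈ atlas E M) :
    e.MDifferentiable 𝓘(ℝ, E) 𝓘(ℝ, E) :=
  haveI : IsManifold 𝓘(ℝ, E) 1 M := IsManifold.of_le (n := ∞) (by simp)
  mdifferentiable_of_mem_atlas he

/-- The derivative of a chart, as an endomorphism of the model space. -/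
def chartDeriv (e : OpenPartialHomeomorph M E) (x : M) : E →L[ℝ] E :=
  mfderiv 𝓘(ℝ, E) 𝓘(ℝ, E) e x

/-- The derivative of the inverse of a chart, as an endomorphism of the model space. -/
def symmDeriv (e : OpenPartialHomeomorph M E) (y : E) : E →L[ℝ] E :=
  mfderiv 𝓘(ℝ, E) 𝓘(ℝ, E) e.symm y

/-- The value of a form at a point, as a form on the model space. -/
def val (α : DForm E (fun _ : M => F) p) (x : M) : E [⋀^Fin p]→L[ℝ] F := α x

lemma inChart_eq (α : DForm E (fun _ : M => F) p) (e : OpenPartialHomeomorph M E) (y : E) :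
    α.inChart e y = (α.val (e.symm y)).compContinuousLinearMap (symmDeriv e y) := rfl

lemma val_d (α : DForm E (fun _ : M => F) p) (x : M) :
    α.d.val x = (extDeriv (fun y => α.inChart (chartAt E x) y)
      (chartAt E x x)).compContinuousLinearMap (chartDeriv (chartAt E x) x) := rfl

lemma symmDeriv_comp_chartDeriv {e : OpenPartialHomeomorph M E} (he : e ∈ atlas E M) {x : M}
    (hx : x ∈ e.source) : (symmDeriv e (e x)).comp (chartDeriv e x) = ContinuousLinearMap.id ℝ E :=
  (mdifferentiable_of_mem_atlas' he).symm_comp_deriv hx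

lemma fderiv_transition {e e' : OpenPartialHomeomorph M E} (he : e ∈ atlas E M)
    (he' : e' ∈ atlas E M) {y : E} (hy : y ∈ e.target) (hy' : e.symm y ∈ e'.source) :
    fderiv ℝ (e' ∘ e.symm) y = (chartDeriv e' (e.symm y)).comp (symmDeriv e y) := by
  rw [← mfderiv_eq_fderiv]
  exact mfderiv_comp y ((mdifferentiable_of_mem_atlas' he').mdifferentiableAt hy')
    ((mdifferentiable_of_mem_atlas' he).mdifferentiableAt_symm hy)

/-- A form is recovered from its expression in a chart. -/
lemma inChart_comp_chartDeriv (α : DForm E (fun _ : M => F) p) {e : OpenPartialHomeomorph M E}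
    (he : e ∈ atlas E M) {x : M} (hx : x ∈ e.source) :
    (α.inChart e (e x)).compContinuousLinearMap (chartDeriv e x) = α.val x := by
  have h : ∀ v, symmDeriv e (e x) (chartDeriv e x v) = v := fun v =>
    DFunLike.congr_fun (symmDeriv_comp_chartDeriv he hx) v
  rw [inChart_eq, e.left_inv hx]
  ext v
  simp only [ContinuousAlternatingMap.compContinuousLinearMap_apply, Function.comp_def, h]

lemma contDiffAt_transition {e e' : OpenPartialHomeomorph M E} (he : e ∈ atlas E M)
    (he' : e' ∈ atlas E M) {y : E} (hy : y ∈ e.target) (hy' : e.symm y ∈ e'.source) :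
    ContDiffAt ℝ ∞ (e' ∘ e.symm) y := by
  have h1 : ContMDiffAt 𝓘(ℝ, E) 𝓘(ℝ, E) ∞ e' (e.symm y) :=
    contMDiffAt_of_mem_maximalAtlas (IsManifold.subset_maximalAtlas he') hy'
  have h2 : ContMDiffAt 𝓘(ℝ, E) 𝓘(ℝ, E) ∞ e.symm y :=
    (contMDiffOn_symm_of_mem_maximalAtlas (IsManifold.subset_maximalAtlas he)).contMDiffAt
      (e.open_target.mem_nhds hy)
  exact (h1.comp y h2).contDiffAt

/-- The exterior derivative can be computed in any chart. -/
lemma inChart_d (hU : IsOpen U) {α : DForm E (fun _ : M => F) p} (h : α.SmoothOn U)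
    {e : OpenPartialHomeomorph M E} (he : e ∈ atlas E M) {y : E} (hy : y ∈ e.target)
    (hyU : e.symm y ∈ U) : α.d.inChart e y = extDeriv (fun z => α.inChart e z) y := by
  obtain ⟨c, hc⟩ : ∃ c, c = chartAt E (e.symm y) := ⟨_, rfl⟩
  have hcs : e.symm y ∈ c.source := hc ▸ mem_chart_source E _
  have hca : c ∈ atlas E M := hc ▸ chart_mem_atlas E _
  -- Near y the expression in e is the pull-back of the expression in the preferred chart c along
  -- the transition map, and the exterior derivative commutes with pull-back.
  have h1 : (fun z => α.inChart e z) =ᶠ[nhds y] fun z =>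
      (α.inChart c ((c ∘ e.symm) z)).compContinuousLinearMap (fderiv ℝ (c ∘ e.symm) z) := by
    have : IsOpen (e.target ∩ e.symm ⁻¹' c.source) := e.symm.isOpen_inter_preimage c.open_source
    filter_upwards [this.mem_nhds ⟨hy, hcs⟩] with z hz
    rw [fderiv_transition he hca hz.1 hz.2, inChart_eq α e, ← inChart_comp_chartDeriv α hca hz.2]
    rfl
  have h4 : DifferentiableAt ℝ (fun z => α.inChart c z) ((c ∘ e.symm) y) := by
    refine ((smoothOn_iff.1 h c hca).contDiffAt ((isOpen_inChart c hU).mem_nhds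
      ⟨c.map_source hcs, ?_⟩)).differentiableAt (by simp)
    rw [Set.mem_preimage, c.left_inv hcs]
    exact hyU
  rw [h1.extDeriv_eq, extDeriv_pullback h4
    (contDiffAt_transition he hca hy hcs) (by simpa using two_le_infty),
    fderiv_transition he hca hy hcs, inChart_eq, val_d, ← hc]
  rfl

lemma SmoothOn.d (hU : IsOpen U) {α : DForm E (fun _ : M => F) p} (h : α.SmoothOn U) :
    α.d.SmoothOn U :=
  smoothOn_iff.2 fun e he => ((smoothOn_iff.1 h e he).extDeriv (isOpen_inChart e hU)).congr
    fun _ hy => inChart_d hU h he hy.1 hy.2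

lemma SmoothOn.differentiableAt (hU : IsOpen U) {α : DForm E (fun _ : M => F) p} (h : α.SmoothOn U)
    {e : OpenPartialHomeomorph M E} (he : e ∈ atlas E M) {y : E} (hy : y ∈ e.target)
    (hyU : e.symm y ∈ U) : DifferentiableAt ℝ (fun z => α.inChart e z) y :=
  ((smoothOn_iff.1 h e he).contDiffAt ((isOpen_inChart e hU).mem_nhds ⟨hy, hyU⟩)).differentiableAt
    (by simp)

/-- The exterior derivative is local. -/
lemma d_congr (hU : IsOpen U) {α β : DForm E (fun _ : M => F) p} (h : ∀ x ∈ U, α x = β x) {x : M}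
    (hx : x ∈ U) : α.d x = β.d x := by
  have h1 : (fun y => α.inChart (chartAt E x) y) =ᶠ[nhds (chartAt E x x)]
      fun y => β.inChart (chartAt E x) y := by
    have : chartAt E x x ∈ (chartAt E x).target ∩ (chartAt E x).symm ⁻¹' U :=
      ⟨mem_chart_target E x, by
        rwa [Set.mem_preimage, (chartAt E x).left_inv (mem_chart_source E x)]⟩
    filter_upwards [(isOpen_inChart _ hU).mem_nhds this] with y hy
    rw [inChart, inChart, h _ hy.2]
  change α.d.val x = β.d.val x
  rw [val_d, val_d, h1.extDeriv_eq]

/-- Two forms agree at a point if they agree in a chart. -/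
lemma eq_of_inChart_eq {α β : DForm E (fun _ : M => F) p} {x : M}
    (h : α.inChart (chartAt E x) (chartAt E x x) = β.inChart (chartAt E x) (chartAt E x x)) :
    α x = β x := by
  change α.val x = β.val x
  rw [← inChart_comp_chartDeriv α (chart_mem_atlas E x) (mem_chart_source E x),
    ← inChart_comp_chartDeriv β (chart_mem_atlas E x) (mem_chart_source E x), h]

lemma d_add_apply (hU : IsOpen U) {α β : DForm E (fun _ : M => F) p} (hα : α.SmoothOn U)
    (hβ : β.SmoothOn U) {x : M} (hx : x ∈ U) : (α + β).d x = α.d x + β.d x := by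
  have hx' : (chartAt E x).symm (chartAt E x x) ∈ U := by
    rwa [(chartAt E x).left_inv (mem_chart_source E x)]
  change (α + β).d.val x = α.d.val x + β.d.val x
  have := extDeriv_fun_add (hα.differentiableAt hU (chart_mem_atlas E x) (mem_chart_target E x) hx')
    (hβ.differentiableAt hU (chart_mem_atlas E x) (mem_chart_target E x) hx')
  rw [val_d, val_d, val_d]
  ext v
  exact DFunLike.congr_fun this _

variable [FiniteDimensional ℝ E] {R : Type*} [NormedRing R] [NormedAlgebra ℝ R]

/-- The curvature of the connection form `γ` on a trivial bundle. -/
def curvature (γ : DForm E (fun _ : M => R) 1) : DForm E (fun _ : M => R) 2 :=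
  fun x => γ.d x + _root_.wedge (ContinuousLinearMap.mul ℝ R) (γ x) (γ x)

lemma SmoothOn.curvature (hU : IsOpen U) {γ : DForm E (fun _ : M => R) 1} (h : γ.SmoothOn U) :
    γ.curvature.SmoothOn U :=
  (h.d hU).add (h.wedge (ContinuousLinearMap.mul ℝ R) h)

lemma inChart_curvature (hU : IsOpen U) {γ : DForm E (fun _ : M => R) 1} (h : γ.SmoothOn U)
    {e : OpenPartialHomeomorph M E} (he : e ∈ atlas E M) {y : E}
    (hy : y ∈ e.target ∩ e.symm ⁻¹' U) :
    γ.curvature.inChart e y = extDeriv (fun z => γ.inChart e z) y +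
      _root_.wedge (ContinuousLinearMap.mul ℝ R) (γ.inChart e y) (γ.inChart e y) := by
  rw [← inChart_d hU h he hy.1 hy.2, inChart_eq γ, ← wedge_compContinuousLinearMap]
  rfl

variable (T : R →L[ℝ] F) (hT : ∀ a b, T (a * b) = T (b * a))
include hT

/-- The trace of a power of the curvature is closed. -/
theorem d_trace_wedgePow_curvature (hU : IsOpen U) {γ : DForm E (fun _ : M => R) 1}
    (h : γ.SmoothOn U) (k : ℕ) {x : M} (hx : x ∈ U) :
    DForm.d (fun x => T.compContinuousAlternatingMap (_root_.wedgePow (γ.curvature x) k) :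
      DForm E (fun _ : M => F) (2 * k)) x = 0 := by
  have hx' : chartAt E x x ∈ (chartAt E x).target ∩ (chartAt E x).symm ⁻¹' U :=
    ⟨mem_chart_target E x, by rwa [Set.mem_preimage, (chartAt E x).left_inv (mem_chart_source E x)]⟩
  have hc := chart_mem_atlas E x
  have h1 := GForm.extDeriv_trace_wedgePow (isOpen_inChart _ hU) T hT (smoothOn_iff.1 h _ hc)
    (smoothOn_iff.1 (h.curvature hU) _ hc) (fun y hy => inChart_curvature hU h hc hy) k hx'
  refine eq_of_inChart_eq (β := (0 : DForm E (fun _ : M => F) (2 * k + 1))) ?_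
  rw [inChart_d hU ((h.curvature hU).wedgePow k |>.comp_clm T) hc hx'.1 hx'.2]
  refine Eq.trans ?_ h1
  congr 1
  funext y
  rw [inChart_eq γ.curvature, ← wedgePow_compContinuousLinearMap]
  rfl

/-- The differential of the transgression form. -/
theorem d_trace_wedgePow_curvature_wedge (hU : IsOpen U) {γ θ : DForm E (fun _ : M => R) 1}
    (h : γ.SmoothOn U) (hθ : θ.SmoothOn U) (k : ℕ) {x : M} (hx : x ∈ U) :
    DForm.d (fun x => T.compContinuousAlternatingMap (_root_.wedge (ContinuousLinearMap.mul ℝ R)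
        (_root_.wedgePow (γ.curvature x) k) (θ x)) : DForm E (fun _ : M => F) (2 * k + 1)) x =
      T.compContinuousAlternatingMap (_root_.wedge (ContinuousLinearMap.mul ℝ R)
        (_root_.wedgePow (γ.curvature x) k)
        (θ.d x + _root_.wedge (ContinuousLinearMap.mul ℝ R) (γ x) (θ x) +
          _root_.wedge (ContinuousLinearMap.mul ℝ R) (θ x) (γ x))) := by
  have hx' : chartAt E x x ∈ (chartAt E x).target ∩ (chartAt E x).symm ⁻¹' U :=
    ⟨mem_chart_target E x, by rwa [Set.mem_preimage, (chartAt E x).left_inv (mem_chart_source E x)]⟩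
  have hc := chart_mem_atlas E x
  have h1 := GForm.extDeriv_trace_wedgePow_wedge (isOpen_inChart _ hU) T hT (smoothOn_iff.1 h _ hc)
    (smoothOn_iff.1 (h.curvature hU) _ hc) (smoothOn_iff.1 hθ _ hc)
    (fun y hy => inChart_curvature hU h hc hy) k hx'
  refine eq_of_inChart_eq (β := (fun x => T.compContinuousAlternatingMap
    (_root_.wedge (ContinuousLinearMap.mul ℝ R) (_root_.wedgePow (γ.curvature x) k)
        (θ.d x + _root_.wedge (ContinuousLinearMap.mul ℝ R) (γ x) (θ x) +
          _root_.wedge (ContinuousLinearMap.mul ℝ R) (θ x) (γ x))) :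
            DForm E (fun _ : M => F) (2 * k + 2))) ?_
  rw [inChart_d hU (((h.curvature hU).wedgePow k).wedge _ hθ |>.comp_clm T) hc hx'.1 hx'.2]
  refine Eq.trans ?_ (h1.trans ?_)
  · congr 1
    funext y
    rw [inChart_eq γ.curvature, ← wedgePow_compContinuousLinearMap, inChart_eq θ,
      ← wedge_compContinuousLinearMap]
    rfl
  · rw [inChart_eq γ.curvature, ← wedgePow_compContinuousLinearMap, inChart_eq θ, inChart_eq γ,
      ← wedge_compContinuousLinearMap, ← wedge_compContinuousLinearMap,
      ← inChart_d hU hθ hc hx'.1 hx'.2, inChart_eq]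
    have h2 : ∀ α β δ : E [⋀^Fin 2]→L[ℝ] R, ∀ L : E →L[ℝ] E, α.compContinuousLinearMap L +
        β.compContinuousLinearMap L + δ.compContinuousLinearMap L =
          (α + β + δ).compContinuousLinearMap L := fun _ _ _ _ => rfl
    have h3 := h2 (θ.d.val ((chartAt E x).symm (chartAt E x x))) (_root_.wedge
      (ContinuousLinearMap.mul ℝ R) (γ.val ((chartAt E x).symm (chartAt E x x)))
        (θ.val ((chartAt E x).symm (chartAt E x x)))) (_root_.wedge
      (ContinuousLinearMap.mul ℝ R) (θ.val ((chartAt E x).symm (chartAt E x x)))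
        (γ.val ((chartAt E x).symm (chartAt E x x))))
        (symmDeriv (chartAt E x) (chartAt E x x))
    erw [h3]
    rw [← wedge_compContinuousLinearMap]
    rfl

end DForm

end ManifoldForms

/-! ## Frames and traces -/

section HilbertModules

variable {A : Type*} [CStarAlgebra A] [PartialOrder A] [StarOrderedRing A]
  {V W : Type*}
  [NormedAddCommGroup V] [NormedSpace ℂ V] [Module Aᵐᵒᵖ V] [HilbertModule A V]
  [NormedAddCommGroup W] [NormedSpace ℂ W] [Module Aᵐᵒᵖ W] [HilbertModule A W]

open HilbertModule

lemma isBoundedBilinearMap_op_smul :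
    IsBoundedBilinearMap ℝ (fun p : V × A => p.1 <• p.2) where
  add_left v w a := smul_add _ _ _
  smul_left c v a := by
    have := smul_complex_smul (A := A) v (c : ℂ) a
    simpa only [Complex.coe_smul] using this
  add_right v a b := by rw [MulOpposite.op_add, add_smul]
  smul_right c v a := by
    have := complex_smul_smul (A := A) v (c : ℂ) a
    simpa only [Complex.coe_smul] using this
  bound := ⟨1, one_pos, fun v a => by simpa using norm_op_smul_le v a⟩

/-- Continuous real linear maps between normed spaces. -/
abbrev NormedCLM (F G : Type*) [NormedAddCommGroup F] [NormedSpace ℝ F] [NormedAddCommGroup G]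
    [NormedSpace ℝ G] := F →L[ℝ] G

/-- A bounded linear function. -/
def NormedCLM.mkBounded {F G : Type*} [NormedAddCommGroup F] [NormedSpace ℝ F]
    [NormedAddCommGroup G] [NormedSpace ℝ G] (f : F → G) (hadd : ∀ a b, f (a + b) = f a + f b)
    (hsmul : ∀ (c : ℝ) a, f (c • a) = c • f a) (C : ℝ) (hC : ∀ a, ‖f a‖ ≤ C * ‖a‖) :
    NormedCLM F G :=
  LinearMap.mkContinuous { toFun := f, map_add' := hadd, map_smul' := hsmul } C hC

variable (A V) in
/-- The algebra `End_A(V)` as a real normed algebra. -/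
def EndR : Type _ := EndA A V

instance : NormedRing (EndR A V) := inferInstanceAs (NormedRing (EndA A V))

instance : NormedAlgebra ℝ (EndR A V) := inferInstanceAs (NormedAlgebra ℝ (EndA A V))

namespace EndR

/-- The endomorphism underlying an element of `EndR A V`. -/
def toCLM (T : EndR A V) : V →L[ℂ] V := T.1

lemma isHilbertHom (T : EndR A V) : IsHilbertHom A T.toCLM := T.2

@[ext] lemma ext {S T : EndR A V} (h : ∀ v, S.toCLM v = T.toCLM v) : S = T :=
  Subtype.ext (ContinuousLinearMap.ext h)

lemma norm_eq (T : EndR A V) : ‖T‖ = ‖T.toCLM‖ := rfl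

@[simp] lemma add_toCLM (S T : EndR A V) (v : V) : (S + T).toCLM v = S.toCLM v + T.toCLM v := rfl

@[simp] lemma mul_toCLM (S T : EndR A V) (v : V) : (S * T).toCLM v = S.toCLM (T.toCLM v) := rfl

@[simp] lemma smul_toCLM (c : ℝ) (T : EndR A V) (v : V) : (c • T).toCLM v = c • T.toCLM v := rfl

/-- The action of `End_A(V)` on `V`. -/
def action : EndR A V →L[ℝ] V →L[ℝ] V :=
  NormedCLM.mkBounded (fun T => T.toCLM.restrictScalars ℝ) (fun _ _ => rfl)
    (fun _ _ => rfl) 1 (fun T => by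
      rw [one_mul, norm_eq]
      exact ContinuousLinearMap.opNorm_le_bound _ (norm_nonneg _) fun v => T.toCLM.le_opNorm v)

lemma action_apply (T : EndR A V) (v : V) : action T v = T.toCLM v := rfl

@[simp] lemma sum_toCLM {n : ℕ} (T : Fin n → EndR A V) (v : V) :
    (∑ a, T a).toCLM v = ∑ a, (T a).toCLM v := by
  rw [← action_apply, map_sum, _root_.sum_apply]
  rfl

/-- The rank one endomorphism `x ↦ v φ(x)`, as a continuous linear function of `v`. -/
def rankOneL (φ : HomA A V A) : V →L[ℝ] EndR A V :=
  NormedCLM.mkBounded (fun v => rankOne v φ) (fun v w => ext fun x => smul_add _ _ _)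
    (fun c v => ext fun x => smul_complex_smul (A := A) v (c : ℂ) (φ.1 x)) ‖φ.1‖ (fun v => by
      rw [mul_comm]
      refine ContinuousLinearMap.opNorm_le_bound _ (by positivity) fun x => ?_
      rw [mul_assoc]
      refine (norm_op_smul_le v _).trans ?_
      gcongr
      exact φ.1.le_opNorm x)

/-- Conjugation of an endomorphism of `W` with `f : V → W` and `g : W → V`. -/
def conj {f : V →L[ℂ] W} {g : W →L[ℂ] V} (hf : IsHilbertHom A f) (hg : IsHilbertHom A g)
    (T : EndA A W) : EndR A V :=
  ⟨g ∘L (T : W →L[ℂ] W) ∘L f, hg.comp (IsHilbertHom.comp T.2 hf)⟩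

lemma conj_toCLM {f : V →L[ℂ] W} {g : W →L[ℂ] V} (hf : IsHilbertHom A f) (hg : IsHilbertHom A g)
    (T : EndA A W) (v : V) : (conj hf hg T).toCLM v = g ((T : W →L[ℂ] W) (f v)) := rfl

/-- Conjugation of an endomorphism of `V` with `f : V → W` and `g : W → V`. -/
def conjSymm {f : V →L[ℂ] W} {g : W →L[ℂ] V} (hf : IsHilbertHom A f) (hg : IsHilbertHom A g) :
    NormedCLM (EndR A V) (EndA A W) :=
  NormedCLM.mkBounded
    (fun T => ⟨f ∘L T.toCLM ∘L g, hf.comp (T.isHilbertHom.comp hg)⟩)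
    (fun T S => Subtype.ext (ContinuousLinearMap.ext fun w => map_add f _ _))
    (fun c T => Subtype.ext (ContinuousLinearMap.ext fun w => f.map_smul_of_tower c _))
    (‖f‖ * ‖g‖) (fun T => by
      have h1 := (f.opNorm_comp_le (T.toCLM ∘L g)).trans
        (mul_le_mul_of_nonneg_left (T.toCLM.opNorm_comp_le g) (norm_nonneg _))
      exact h1.trans (le_of_eq (by rw [norm_eq]; ring)))

lemma conjSymm_apply {f : V →L[ℂ] W} {g : W →L[ℂ] V} (hf : IsHilbertHom A f)
    (hg : IsHilbertHom A g) (T : EndR A V) (w : W) :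
    (conjSymm hf hg T : W →L[ℂ] W) w = f (T.toCLM (g w)) := rfl

lemma conj_mul {f : V →L[ℂ] W} {g : W →L[ℂ] V} (hf : IsHilbertHom A f)
    (hg : IsHilbertHom A g) (h : ∀ w, f (g w) = w) (T S : EndA A W) :
    conj hf hg (T * S) = conj hf hg T * conj hf hg S := by
  ext v
  change g ((T : W →L[ℂ] W) ((S : W →L[ℂ] W) (f v))) =
    g ((T : W →L[ℂ] W) (f (g ((S : W →L[ℂ] W) (f v)))))
  rw [h]

lemma conj_one {f : V →L[ℂ] W} {g : W →L[ℂ] V} (hf : IsHilbertHom A f)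
    (hg : IsHilbertHom A g) (h : ∀ v, g (f v) = v) : conj hf hg (1 : EndA A W) = 1 := by
  ext v
  exact h v

lemma conj_add {f : V →L[ℂ] W} {g : W →L[ℂ] V} (hf : IsHilbertHom A f)
    (hg : IsHilbertHom A g) (T S : EndA A W) :
    conj hf hg (T + S) = conj hf hg T + conj hf hg S := by
  ext v
  exact map_add g _ _

lemma conj_smul {f : V →L[ℂ] W} {g : W →L[ℂ] V} (hf : IsHilbertHom A f)
    (hg : IsHilbertHom A g) (c : ℝ) (T : EndA A W) :
    conj hf hg (c • T) = c • conj hf hg T := by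
  ext v
  exact g.map_smul_of_tower c _

lemma conj_conjSymm {f : V →L[ℂ] W} {g : W →L[ℂ] V} (hf : IsHilbertHom A f)
    (hg : IsHilbertHom A g) (h : ∀ v, g (f v) = v) (T : EndR A V) :
    conj hf hg (conjSymm hf hg T) = T := by
  ext v
  rw [conj_toCLM, conjSymm_apply, h, h]

lemma conj_injective {f : V →L[ℂ] W} {g : W →L[ℂ] V} (hf : IsHilbertHom A f)
    (hg : IsHilbertHom A g) (h : ∀ w, f (g w) = w) {S T : EndA A W}
    (hST : conj hf hg S = conj hf hg T) : S = T := by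
  refine Subtype.ext (ContinuousLinearMap.ext fun w => ?_)
  have := congrArg (fun R : EndR A V => f (R.toCLM (g w))) hST
  simpa only [conj_toCLM, h] using this

end EndR

/-- The morphism `φ ∘ g`. -/
def HomA.compHom (φ : HomA A V A) {g : W →L[ℂ] V} (hg : IsHilbertHom A g) : HomA A W A :=
  ⟨φ.1 ∘L g, IsHilbertHom.comp φ.2 hg⟩

variable {n : ℕ} {e : Fin n → V} {φ : Fin n → HomA A V A}

/-- Frames are preserved by isomorphisms. -/
lemma frame_comp (h : ∀ v, ∑ a, e a <• ((φ a).1 v) = v) {f : V →L[ℂ] W} {g : W →L[ℂ] V}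
    (hf : IsHilbertHom A f) (hg : IsHilbertHom A g) (hfg : ∀ w, f (g w) = w) (w : W) :
    ∑ a, f (e a) <• ((HomA.compHom (φ a) hg).1 w) = w := by
  conv_rhs => rw [← hfg w, ← h (g w), map_sum]
  exact Finset.sum_congr rfl fun a _ => (hf.map_smul _ _).symm

variable {Z : Type*} [NonUnitalCommCStarAlgebra Z] (τ : A →L[ℂ] Z)

/-- The trace on `End_A(V)` defined by a frame of `V`. -/
def frameTrace (e : Fin n → V) (φ : Fin n → HomA A V A) : EndR A V →L[ℝ] Z :=
  NormedCLM.mkBounded (fun T => ∑ a, τ ((φ a).1 (T.toCLM (e a))))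
    (fun T S => by
      rw [← Finset.sum_add_distrib]
      refine Finset.sum_congr rfl fun a _ => ?_
      rw [← map_add, ← map_add]
      rfl)
    (fun c T => by
      rw [Finset.smul_sum]
      refine Finset.sum_congr rfl fun a _ => ?_
      rw [← τ.map_smul_of_tower, ← (φ a).1.map_smul_of_tower]
      rfl)
    (∑ a, ‖τ‖ * (‖(φ a).1‖ * ‖e a‖)) (fun T => by
      rw [Finset.sum_mul]
      refine norm_sum_le_of_le _ fun a _ => ?_
      have h1 : ‖T.toCLM (e a)‖ ≤ ‖T‖ * ‖e a‖ := T.toCLM.le_opNorm _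
      calc _ ≤ ‖τ‖ * (‖(φ a).1‖ * (‖T‖ * ‖e a‖)) :=
            τ.le_opNorm_of_le ((φ a).1.le_opNorm_of_le h1)
        _ = _ := by ring)

lemma frameTrace_apply (T : EndR A V) :
    frameTrace τ e φ T = ∑ a, τ ((φ a).1 (T.toCLM (e a))) := rfl

/-- Expanding T e_a in the frame gives Σ τ(S_ab T_ba) with matrix entries S_ab = φ_a(S e_b).
Exchanging the two factors under τ and renaming the indices gives the other order. -/
lemma frameTrace_mul_comm (hτ : ∀ a b : A, τ (a * b) = τ (b * a))
    (h : ∀ v, ∑ a, e a <• ((φ a).1 v) = v) (S T : EndR A V) :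
    frameTrace τ e φ (S * T) = frameTrace τ e φ (T * S) := by
  have key : ∀ S T : EndR A V, frameTrace τ e φ (S * T) = ∑ a, ∑ b,
      τ ((φ a).1 (S.toCLM (e b)) * (φ b).1 (T.toCLM (e a))) := by
    intro S T
    rw [frameTrace_apply]
    refine Finset.sum_congr rfl fun a _ => ?_
    rw [EndR.mul_toCLM]
    conv_lhs => rw [← h (T.toCLM (e a)), map_sum, map_sum, map_sum]
    refine Finset.sum_congr rfl fun b _ => ?_
    rw [S.isHilbertHom.map_smul, (φ a).2.map_smul]
    rfl
  rw [key, key, Finset.sum_comm]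
  exact Finset.sum_congr rfl fun a _ => Finset.sum_congr rfl fun b _ => hτ _ _

/-- The evaluation map can be computed in any frame, in particular in one transported from V. Hence
in a trivialization the fibrewise trace becomes one fixed functional, which commutes with d. -/
lemma traceEv_eq_frameTrace (hτ : ∀ a b : A, τ (a * b) = τ (b * a)) (hW : IsFGP A W)
    (h : ∀ v, ∑ a, e a <• ((φ a).1 v) = v) {f : V →L[ℂ] W} {g : W →L[ℂ] V}
    (hf : IsHilbertHom A f) (hg : IsHilbertHom A g) (hfg : ∀ w, f (g w) = w) (T : EndA A W) :
    traceEv τ hτ hW T = frameTrace τ e φ (EndR.conj hf hg T) := by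
  rw [frameTrace_apply]
  change traceBar τ hτ (evA hW T) = _
  rw [evA_eq_sum hW (frame_comp h hf hg hfg), map_sum]
  rfl

end HilbertModules

/-! ## Sections of bundles -/

section Sections

variable {A : Type*} [CStarAlgebra A] [PartialOrder A] [StarOrderedRing A]
  {E : Type*} [NormedAddCommGroup E] [NormedSpace ℝ E]
  {M : Type*} [TopologicalSpace M] [ChartedSpace E M]
  {W : M → Type*} [∀ x, NormedAddCommGroup (W x)] [∀ x, NormedSpace ℂ (W x)]
  [∀ x, Module Aᵐᵒᵖ (W x)] [∀ x, HilbertModule A (W x)]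
  {ι : Type*} {V : ι → Type*} [∀ i, NormedAddCommGroup (V i)] [∀ i, NormedSpace ℂ (V i)]
  [∀ i, Module Aᵐᵒᵖ (V i)] [∀ i, HilbertModule A (V i)]

open HilbertModule

lemma exists_bump [FiniteDimensional ℝ E] [T2Space M] [IsManifold 𝓘(ℝ, E) ∞ M] {O : Set M}
    (hO : IsOpen O) {x : M} (hx : x ∈ O) :
    ∃ χ : M → ℝ, ContMDiff 𝓘(ℝ, E) 𝓘(ℝ, ℝ) ∞ χ ∧ tsupport χ ⊆ O ∧ ∀ᶠ y in nhds x, χ y = 1 := by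
  obtain ⟨f, -, hf⟩ := (SmoothBumpFunction.nhds_basis_tsupport (I := 𝓘(ℝ, E)) x).mem_iff.1
    (hO.mem_nhds hx)
  exact ⟨f, f.contMDiff, hf, f.eventuallyEq_one⟩

namespace SmoothHilbertBundle

variable {B : SmoothHilbertBundle A E W V}

lemma exists_mem_U (B : SmoothHilbertBundle A E W V) (x : M) : ∃ i, x ∈ B.U i := by
  have : x ∈ ⋃ i, B.U i := B.iUnion_U ▸ Set.mem_univ x
  simpa using this

lemma isSmoothSection_zero : B.IsSmoothSection (fun _ => 0) := fun i => by
  simpa using contMDiffOn_const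

lemma IsSmoothSection.add {s t : ∀ x, W x} (hs : B.IsSmoothSection s) (ht : B.IsSmoothSection t) :
    B.IsSmoothSection (fun x => s x + t x) := fun i => by
  simpa only [_root_.map_add] using! (hs i).add (ht i)

lemma IsSmoothSection.sub {s t : ∀ x, W x} (hs : B.IsSmoothSection s) (ht : B.IsSmoothSection t) :
    B.IsSmoothSection (fun x => s x - t x) := fun i => by
  simpa only [_root_.map_sub] using! (hs i).sub (ht i)

lemma IsSmoothSection.op_smul {s : ∀ x, W x} (hs : B.IsSmoothSection s) {f : M → A}
    (hf : ContMDiff 𝓘(ℝ, E) 𝓘(ℝ, A) ∞ f) : B.IsSmoothSection (fun x => s x <• f x) := fun i => by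
  have h1 : ContMDiffOn 𝓘(ℝ, E) 𝓘(ℝ, V i × A) ∞ (fun x => (B.triv i x (s x), f x)) (B.U i) :=
    (hs i).prodMk_space hf.contMDiffOn
  have h2 := (isBoundedBilinearMap_op_smul (A := A) (V := V i)).contDiff (n := ∞)
  refine (h2.contMDiff.comp_contMDiffOn h1).congr fun x hx => ?_
  exact (B.triv_hom i x hx).map_smul _ _

lemma IsSmoothSection.sum {n : ℕ} {s : Fin n → ∀ x, W x} (hs : ∀ a, B.IsSmoothSection (s a)) :
    B.IsSmoothSection (fun x => ∑ a, s a x) := by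
  have : ∀ t : Finset (Fin n), B.IsSmoothSection (fun x => ∑ a ∈ t, s a x) := fun t => by
    classical
    induction t using Finset.induction_on with
    | empty => simpa using isSmoothSection_zero
    | insert a t ha ih =>
      simp only [Finset.sum_insert ha]
      exact (hs a).add ih
  exact this _

/-- On O, another trivialization sees the section through a smooth transition function. Off O, the
section vanishes in a neighbourhood because the support of χ is closed and contained in O. -/
lemma isSmoothSection_bump {i : ι} {χ : M → ℝ} (hχ : ContMDiff 𝓘(ℝ, E) 𝓘(ℝ, ℝ) ∞ χ) {O : Set M}
    (hO : IsOpen O) (hOU : O ⊆ B.U i) (hs : tsupport χ ⊆ O) {f : M → V i}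
    (hf : ContMDiffOn 𝓘(ℝ, E) 𝓘(ℝ, V i) ∞ f O) :
    B.IsSmoothSection (fun x => χ x • B.symm i x (f x)) := by
  intro j x hx
  by_cases hxO : x ∈ O
  · have h1 : ContMDiffAt 𝓘(ℝ, E) 𝓘(ℝ, V j) ∞
        (fun x => χ x • (B.triv j x ∘L B.symm i x) (f x)) x := by
      have h2 := ((B.smooth_transition i j).contMDiffAt
        (((B.isOpen_U i).inter (B.isOpen_U j)).mem_nhds ⟨hOU hxO, hx⟩))
      have h3 : ContMDiffAt 𝓘(ℝ, E) 𝓘(ℝ, V i →L[ℝ] V j) ∞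
          (fun x => (B.triv j x ∘L B.symm i x).restrictScalars ℝ) x :=
        (ContinuousLinearMap.restrictScalarsL ℂ (V i) (V j) ℝ
          ℝ).contDiff.contMDiff.contMDiffAt.comp x
          h2
      exact hχ.contMDiffAt.smul (h3.clm_apply (hf.contMDiffAt (hO.mem_nhds hxO)))
    refine (h1.congr_of_eventuallyEq (Filter.Eventually.of_forall fun y => ?_)).contMDiffWithinAt
    exact (B.triv j y).map_smul_of_tower _ _
  · have h1 : (fun x => B.triv j x (χ x • B.symm i x (f x))) =ᶠ[nhds x] fun _ => 0 := by
      filter_upwards [(isClosed_tsupport χ).isOpen_compl.mem_nhds (fun h => hxO (hs h))] with y hy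
      rw [image_eq_zero_of_notMem_tsupport hy, zero_smul, map_zero]
    exact (contMDiffAt_const.congr_of_eventuallyEq h1).contMDiffWithinAt

variable [FiniteDimensional ℝ E] [T2Space M] [IsManifold 𝓘(ℝ, E) ∞ M]

lemma exists_section {i : ι} {O : Set M} (hO : IsOpen O) (hOU : O ⊆ B.U i) {x : M} (hx : x ∈ O)
    {f : M → V i} (hf : ContMDiffOn 𝓘(ℝ, E) 𝓘(ℝ, V i) ∞ f O) :
    ∃ s, B.IsSmoothSection s ∧ ∀ᶠ y in nhds x, s y = B.symm i y (f y) := by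
  obtain ⟨χ, h1, h2, h3⟩ := exists_bump (E := E) hO hx
  refine ⟨_, isSmoothSection_bump h1 hO hOU h2 hf, ?_⟩
  filter_upwards [h3] with y hy
  rw [hy, one_smul]

open Classical in
variable (B) in
/-- A smooth section which is constant in the trivialization `i` near `x`. -/
def localSection (i : ι) (x : M) (v : V i) : ∀ x, W x :=
  if h : ∃ s, B.IsSmoothSection s ∧ ∀ᶠ y in nhds x, s y = B.symm i y v then h.choose else fun _ => 0

lemma isSmoothSection_localSection (i : ι) (x : M) (v : V i) :
    B.IsSmoothSection (B.localSection i x v) := by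
  rw [localSection]
  split_ifs with h
  · exact h.choose_spec.1
  · exact isSmoothSection_zero

lemma localSection_eventually {i : ι} {x : M} (hx : x ∈ B.U i) (v : V i) :
    ∀ᶠ y in nhds x, B.localSection i x v y = B.symm i y v := by
  have h : ∃ s, B.IsSmoothSection s ∧ ∀ᶠ y in nhds x, s y = B.symm i y v :=
    exists_section (B.isOpen_U i) subset_rfl hx (f := fun _ => v) contMDiffOn_const
  rw [localSection, dif_pos h]
  exact h.choose_spec.2

lemma exists_section_eq (x : M) (w : W x) : ∃ s, B.IsSmoothSection s ∧ s x = w := by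
  obtain ⟨i, hi⟩ := B.exists_mem_U x
  refine ⟨B.localSection i x (B.triv i x w), isSmoothSection_localSection _ _ _, ?_⟩
  rw [(localSection_eventually hi _).self_of_nhds, B.symm_triv i x hi]

variable (D : B.Connection)

lemma Connection.map_zero : D.toFun (fun _ => 0) = 0 := by
  have h := D.map_add _ _ isSmoothSection_zero isSmoothSection_zero
  simp only [add_zero] at h
  funext x
  have := congrFun h x
  simpa using this

lemma Connection.map_sum {n : ℕ} {s : Fin n → ∀ x, W x} (hs : ∀ a, B.IsSmoothSection (s a))
    (x : M) : D.toFun (fun x => ∑ a, s a x) x = ∑ a, D.toFun (s a) x := by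
  have : ∀ t : Finset (Fin n), B.IsSmoothSection (fun x => ∑ a ∈ t, s a x) ∧
      D.toFun (fun x => ∑ a ∈ t, s a x) x = ∑ a ∈ t, D.toFun (s a) x := fun t => by
    classical
    induction t using Finset.induction_on with
    | empty => exact ⟨by simpa using isSmoothSection_zero, by simp [D.map_zero]⟩
    | insert a t ha ih =>
      simp only [Finset.sum_insert ha]
      exact ⟨(hs a).add ih.1, by rw [D.map_add _ _ (hs a) ih.1, ← ih.2]⟩
  exact (this _).2

/-- Connections are local. -/
lemma Connection.congr {s t : ∀ x, W x} (hs : B.IsSmoothSection s) (ht : B.IsSmoothSection t)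
    {x : M} (h : ∀ᶠ y in nhds x, s y = t y) : D.toFun s x = D.toFun t x := by
  have hr := hs.sub ht
  obtain ⟨O, hO, hOo, hxO⟩ := eventually_nhds_iff.1 h
  obtain ⟨χ, h1, h2, h3⟩ := exists_bump (E := E) hOo hxO
  -- With χ equal to 1 near x and supported where s = t, the section (s − t)χ is 0. At x the Leibniz
  -- rule then gives ∇(s − t) = 0, since s − t vanishes there and χ is 1.
  have h4 : ContMDiff 𝓘(ℝ, E) 𝓘(ℝ, A) ∞ (fun y => χ y • (1 : A)) := h1.smul contMDiff_const
  have h5 : (fun y => (s y - t y) <• (χ y • (1 : A))) = fun _ => 0 := by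
    funext y
    by_cases hy : y ∈ O
    · rw [hO y hy, sub_self, smul_zero]
    · rw [image_eq_zero_of_notMem_tsupport (fun h => hy (h2 h)), zero_smul, MulOpposite.op_zero,
        zero_smul]
  have h6 : D.toFun (fun y => s y - t y) x = 0 := by
    ext ξ
    have := D.leibniz _ _ hr h4 x ξ
    rw [h5, D.map_zero, h.self_of_nhds, sub_self, smul_zero, zero_add, h3.self_of_nhds,
      one_smul, MulOpposite.op_one, one_smul] at this
    exact this.symm
  have h7 := D.map_add _ _ hr ht
  simp only [sub_add_cancel] at h7
  have h8 := congrFun h7 x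
  simp only [h6, zero_add] at h8
  exact h8

end SmoothHilbertBundle

end Sections

/-! ## The connection form and the curvature in a local trivialization -/

section Connections

variable {A : Type*} [CStarAlgebra A] [PartialOrder A] [StarOrderedRing A]
  {E : Type*} [NormedAddCommGroup E] [NormedSpace ℝ E]
  {M : Type*} [TopologicalSpace M] [ChartedSpace E M]
  {W : M → Type*} [∀ x, NormedAddCommGroup (W x)] [∀ x, NormedSpace ℂ (W x)]
  [∀ x, Module Aᵐᵒᵖ (W x)] [∀ x, HilbertModule A (W x)]
  {ι : Type*} {V : ι → Type*} [∀ i, NormedAddCommGroup (V i)] [∀ i, NormedSpace ℂ (V i)]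
  [∀ i, Module Aᵐᵒᵖ (V i)] [∀ i, HilbertModule A (V i)]
  [FiniteDimensional ℝ E] [T2Space M] [IsManifold 𝓘(ℝ, E) ∞ M]

open HilbertModule

namespace SmoothHilbertBundle

variable {B : SmoothHilbertBundle A E W V} (D : B.Connection) {i : ι} {n : ℕ} {e : Fin n → V i}
  {φ : Fin n → HomA A (V i) A}

/-- A form with values in the bundle, read in a trivialization. -/
def trivForm (B : SmoothHilbertBundle A E W V) (i : ι) {p : ℕ} (α : DForm E W p) :
    DForm E (fun _ : M => V i) p :=
  fun x => ((B.triv i x).restrictScalars ℝ).compContinuousAlternatingMap (α x)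

lemma IsSmoothForm.smoothOn {p : ℕ} {α : DForm E W p} (h : B.IsSmoothForm α) (i : ι) :
    (B.trivForm i α).SmoothOn (B.U i) := h i

/-- The connection form in the trivialization `i`, in terms of a frame of `V i`. -/
def Connection.form (e : Fin n → V i) (φ : Fin n → HomA A (V i) A) :
    DForm E (fun _ : M => EndR A (V i)) 1 :=
  fun x => ∑ a, (EndR.rankOneL (φ a)).compContinuousAlternatingMap
    (B.trivForm i (D.toFun (B.localSection i x (e a))) x)

/-- The form at each point uses local sections centred at that same point. By locality of the
connection those centred at x serve for all nearby points, and this is what makes the form smooth.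
-/
lemma Connection.form_eventually {x : M} (hx : x ∈ B.U i) :
    ∀ᶠ y in nhds x, D.form e φ y = ∑ a, (EndR.rankOneL (φ a)).compContinuousAlternatingMap
      (B.trivForm i (D.toFun (B.localSection i x (e a))) y) := by
  have h : ∀ᶠ y in nhds x, ∀ a, ∀ᶠ z in nhds y, B.localSection i x (e a) z = B.symm i z (e a) :=
    Filter.eventually_all.2 fun a => (localSection_eventually hx (e a)).eventually_nhds
  filter_upwards [h, (B.isOpen_U i).mem_nhds hx] with y hy hyU
  refine Finset.sum_congr rfl fun a _ => ?_
  rw [trivForm, trivForm, D.congr (isSmoothSection_localSection i y (e a))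
    (isSmoothSection_localSection i x (e a))]
  filter_upwards [hy a, localSection_eventually hyU (e a)] with z h1 h2
  rw [h1, h2]

lemma _root_.DForm.SmoothOn.sum {F : Type*} [NormedAddCommGroup F] [NormedSpace ℝ F]
    {U : Set M} {p n : ℕ}
    {α : Fin n → DForm E (fun _ : M => F) p} (h : ∀ a, (α a).SmoothOn U) :
    DForm.SmoothOn (fun x => ∑ a, α a x : DForm E (fun _ : M => F) p) U := by
  have : ∀ t : Finset (Fin n),
      DForm.SmoothOn (fun x => ∑ a ∈ t, α a x : DForm E (fun _ : M => F) p) U := fun t => by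
    classical
    induction t using Finset.induction_on with
    | empty =>
      simp only [Finset.sum_empty]
      exact (_root_.DForm.isSmooth_iff_smoothOn.1 _root_.DForm.isSmooth_zero).mono
        (Set.subset_univ _)
    | insert a t ha ih =>
      simp only [Finset.sum_insert ha]
      exact (h a).add ih
  exact this _

lemma Connection.smoothOn_form : (D.form e φ).SmoothOn (B.U i) := by
  refine DForm.smoothOn_of_locally fun x hx => ?_
  obtain ⟨O, hO, hOo, hxO⟩ := eventually_nhds_iff.1 (D.form_eventually (e := e) (φ := φ) hx)
  refine ⟨O ∩ B.U i, hOo.inter (B.isOpen_U i), ⟨hxO, hx⟩, ?_⟩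
  refine DForm.SmoothOn.congr ?_ fun y hy => (hO y hy.1).symm
  refine DForm.SmoothOn.sum fun a => ?_
  refine DForm.SmoothOn.comp_clm (EndR.rankOneL (φ a)) ?_
  exact ((D.smooth _ (isSmoothSection_localSection i x (e a))).smoothOn i).mono
    Set.inter_subset_right

/-- In a trivialization, a connection is `d + ω`. -/
lemma Connection.triv_toFun (h : ∀ v, ∑ a, e a <• ((φ a).1 v) = v) {s : ∀ x, W x}
    (hs : B.IsSmoothSection s) {x : M} (hx : x ∈ B.U i) (ξ : Fin 1 → TangentSpace 𝓘(ℝ, E) x) :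
    B.triv i x (D.toFun s x ξ) =
      differential (E := E) (fun y => B.triv i y (s y)) x (ξ 0) +
        (D.form e φ x ξ).toCLM (B.triv i x (s x)) := by
  obtain ⟨χ, h1, h2, h3⟩ := exists_bump (E := E) (B.isOpen_U i) hx
  -- Frame coefficients of s; the cut-off is needed because the Leibniz rule is available only for
  -- globally smooth functions.
  set f : Fin n → M → A := fun a y => χ y • (φ a).1 (B.triv i y (s y)) with hf
  have hφ : ∀ a, ContMDiffOn 𝓘(ℝ, E) 𝓘(ℝ, A) ∞ (fun y => (φ a).1 (B.triv i y (s y))) (B.U i) :=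
    fun a => ((φ a).1.restrictScalars ℝ).contDiff.contMDiff.comp_contMDiffOn (hs i)
  have hfs : ∀ a, ContMDiff 𝓘(ℝ, E) 𝓘(ℝ, A) ∞ (f a) := by
    intro a y
    by_cases hy : y ∈ B.U i
    · exact h1.contMDiffAt.smul ((hφ a).contMDiffAt ((B.isOpen_U i).mem_nhds hy))
    · have h4 : f a =ᶠ[nhds y] fun _ => 0 := by
        filter_upwards [(isClosed_tsupport χ).isOpen_compl.mem_nhds (fun h => hy (h2 h))] with z hz
        simp only [hf, image_eq_zero_of_notMem_tsupport hz, zero_smul]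
      exact contMDiffAt_const.congr_of_eventuallyEq h4
  have hσ : ∀ a, B.IsSmoothSection (B.localSection i x (e a)) :=
    fun a => isSmoothSection_localSection i x (e a)
  have hfx : ∀ a, f a x = (φ a).1 (B.triv i x (s x)) := fun a => by
    simp only [hf, h3.self_of_nhds, one_smul]
  -- Near x, s = Σ σ_a f_a with σ_a constant in the trivialization. In ∇s = Σ (σ_a df_a + ∇σ_a f_a)
  -- the first sum is the differential of s and the second is the connection form applied to s.
  have h5 : D.toFun s x = D.toFun (fun y => ∑ a, B.localSection i x (e a) y <• f a y) x := by
    refine D.congr hs (IsSmoothSection.sum fun a => (hσ a).op_smul (hfs a)) ?_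
    have h6 : ∀ᶠ y in nhds x, ∀ a, B.localSection i x (e a) y = B.symm i y (e a) :=
      Filter.eventually_all.2 fun a => localSection_eventually hx (e a)
    filter_upwards [h6, h3, (B.isOpen_U i).mem_nhds hx] with y h6 h7 h8
    simp only [hf, h6, h7, one_smul]
    conv_lhs => rw [← B.symm_triv i y h8 (s y), ← h (B.triv i y (s y)), _root_.map_sum]
    exact Finset.sum_congr rfl fun a _ => (B.symm_hom i y h8).map_smul _ _
  have hd : ∀ a, differential (E := E) (f a) x (ξ 0) =
      (φ a).1 (differential (E := E) (fun y => B.triv i y (s y)) x (ξ 0)) := by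
    intro a
    have h6 : f a =ᶠ[nhds x] ((φ a).1.restrictScalars ℝ) ∘ fun y => B.triv i y (s y) := by
      filter_upwards [h3] with y hy
      simp only [hf, hy, one_smul]
      rfl
    have h7 : MDifferentiableAt 𝓘(ℝ, E) 𝓘(ℝ, V i) (fun y => B.triv i y (s y)) x :=
      ((hs i).contMDiffAt ((B.isOpen_U i).mem_nhds hx)).mdifferentiableAt (by simp)
    rw [differential, h6.mfderiv_eq, mfderiv_comp x
      ((φ a).1.restrictScalars ℝ).mdifferentiableAt h7, ContinuousLinearMap.mfderiv_eq]
    rfl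
  rw [h5, D.map_sum fun a => (hσ a).op_smul (hfs a)]
  have h8 : (∑ a, D.toFun (fun y => B.localSection i x (e a) y <• f a y) x) ξ =
      ∑ a, (B.localSection i x (e a) x <• differential (f a) x (ξ 0) +
        D.toFun (B.localSection i x (e a)) x ξ <• f a x) := by
    rw [ContinuousAlternatingMap.sum_apply]
    exact Finset.sum_congr rfl fun a _ => D.leibniz _ _ (hσ a) (hfs a) x ξ
  rw [h8, _root_.map_sum]
  conv_rhs => rw [← h (differential (E := E) (fun y => B.triv i y (s y)) x (ξ 0))]
  rw [Connection.form, ContinuousAlternatingMap.sum_apply, EndR.sum_toCLM,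
    ← Finset.sum_add_distrib]
  refine Finset.sum_congr rfl fun a _ => ?_
  rw [_root_.map_add, (B.triv_hom i x hx).map_smul, (B.triv_hom i x hx).map_smul, hd, hfx,
    (localSection_eventually hx (e a)).self_of_nhds, B.triv_symm i x hx]
  rfl

end SmoothHilbertBundle

end Connections

/-! ### The identity (d + γ)² = dγ + γ∧γ, for an arbitrary decomposition. -/

section LocalCurvature

variable {E V R : Type*} [NormedAddCommGroup E] [NormedSpace ℝ E] [NormedAddCommGroup V]
  [NormedSpace ℝ V] [NormedRing R] [NormedAlgebra ℝ R]

lemma extDeriv_apply_one {F : Type*} [NormedAddCommGroup F] [NormedSpace ℝ F]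
    {α : E → E [⋀^Fin 1]→L[ℝ] F} {y : E} (h : DifferentiableAt ℝ α y) (u : Fin 2 → E) :
    extDeriv α y u = fderiv ℝ α y (u 0) (fun _ => u 1) - fderiv ℝ α y (u 1) (fun _ => u 0) := by
  have h0 : Fin.removeNth 0 u = fun _ => u 1 := by funext i; fin_cases i; rfl
  have h1 : Fin.removeNth 1 u = fun _ => u 0 := by funext i; fin_cases i; rfl
  rw [extDeriv_apply h, Fin.sum_univ_two, h0, h1]
  simp [fderiv_continuousAlternatingMap_apply_const_apply h, sub_eq_add_neg]

lemma hasFDerivAt_alternating_apply {F : Type*} [NormedAddCommGroup F] [NormedSpace ℝ F] {p : ℕ}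
    {α : E → E [⋀^Fin p]→L[ℝ] F} {y : E} (h : DifferentiableAt ℝ α y) (w : Fin p → E) :
    HasFDerivAt (fun z => α z w)
      ((ContinuousAlternatingMap.apply ℝ E F w).comp (fderiv ℝ α y)) y :=
  (ContinuousAlternatingMap.apply ℝ E F w).hasFDerivAt.comp y h.hasFDerivAt

/-- The curvature of `d + γ` computed from a decomposition of `(d + γ) S`. -/
lemma curvature_apply_of_decomposition (ρ : R →L[ℝ] V →L[ℝ] V)
    (hρ : ∀ a b v, ρ (a * b) v = ρ a (ρ b v)) {γ : E → E [⋀^Fin 1]→L[ℝ] R} {S : E → V} {n : ℕ}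
    {a : Fin n → E → E [⋀^Fin 1]→L[ℝ] ℝ} {t : Fin n → E → V} {y : E}
    (hγ : DifferentiableAt ℝ γ y) (hS : ContDiffAt ℝ ∞ S y)
    (ha : ∀ j, DifferentiableAt ℝ (a j) y) (ht : ∀ j, DifferentiableAt ℝ (t j) y)
    (h : ∀ᶠ z in nhds y, ∀ w, fderiv ℝ S z w + ρ (γ z fun _ => w) (S z) =
      ∑ j, a j z (fun _ => w) • t j z) {N : Fin n → E [⋀^Fin 1]→L[ℝ] V}
    (hN : ∀ j w, N j (fun _ => w) = fderiv ℝ (t j) y w + ρ (γ y fun _ => w) (t j y))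
    (u : Fin 2 → E) :
    ∑ j, (extDeriv (a j) y u • t j y - wedge (ContinuousLinearMap.lsmul ℝ ℝ) (a j y) (N j) u) =
      ρ ((extDeriv γ y + wedge (ContinuousLinearMap.mul ℝ R) (γ y) (γ y)) u) (S y) := by
  have hS' : DifferentiableAt ℝ S y := hS.differentiableAt (by simp)
  have hS2 : DifferentiableAt ℝ (fderiv ℝ S) y :=
    (hS.fderiv_right (m := 1) two_le_infty).differentiableAt (by simp)
  have hsym : ∀ v w, fderiv ℝ (fderiv ℝ S) y v w = fderiv ℝ (fderiv ℝ S) y w v := fun v w =>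
    (hS.isSymmSndFDerivAt (by simpa using two_le_infty)).eq v w
  -- Differentiate the decomposition of (d + γ)S, evaluated at w, in the direction v.
  -- Antisymmetrizing in v and w removes the second derivative of S and leaves the exterior
  -- derivatives of γ and of the coefficients.
  have key : ∀ v w, fderiv ℝ (fderiv ℝ S) y v w + (ρ (γ y fun _ => w) (fderiv ℝ S y v) +
      ρ (fderiv ℝ γ y v fun _ => w) (S y)) =
      ∑ j, (a j y (fun _ => w) • fderiv ℝ (t j) y v + fderiv ℝ (a j) y v (fun _ => w) • t j y) := by
    intro v w
    have h1 := (hS2.hasFDerivAt.clm_apply (hasFDerivAt_const w y)).add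
      ((ρ.hasFDerivAt.comp y (hasFDerivAt_alternating_apply hγ fun _ => w)).clm_apply
        hS'.hasFDerivAt)
    have h2 := HasFDerivAt.fun_sum (u := Finset.univ) fun j _ =>
      (hasFDerivAt_alternating_apply (ha j) fun _ => w).smul (ht j).hasFDerivAt
    have h3 := h1.unique (h2.congr_of_eventuallyEq (h.mono fun z hz => hz w))
    have h4 := DFunLike.congr_fun h3 v
    simpa using h4
  have h0 := h.self_of_nhds
  have k1 := key (u 0) (u 1)
  have k2 := key (u 1) (u 0)
  rw [hsym] at k2
  simp only [ContinuousAlternatingMap.add_apply, extDeriv_apply_one hγ, wedge_apply_one_one, hN,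
    extDeriv_apply_one (ha _), map_add, map_sub, _root_.add_apply, _root_.sub_apply,
    ContinuousLinearMap.mul_apply', hρ]
  -- Applying γ to the undifferentiated relation eliminates the mixed terms γ(v) dS(w) in favour of
  -- γ∧γ and the terms γ(v) t_j.
  have e0 := congrArg (ρ (γ y fun _ => u 1)) (h0 (u 0))
  have e1 := congrArg (ρ (γ y fun _ => u 0)) (h0 (u 1))
  simp only [map_add, map_sum, map_smul] at e0 e1
  have k3 : ∀ p q r s t : V, p + q = s → p + r = t → s - t = q - r := by
    rintro p q r s t rfl rfl; abel
  have k4 := k3 _ _ _ _ _ k1 k2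
  rw [← eq_sub_iff_add_eq'] at e0 e1
  have k5 : ∑ j, ((fderiv ℝ (a j) y (u 0) (fun _ => u 1) - fderiv ℝ (a j) y (u 1) (fun _ => u 0)) •
      t j y - (a j y (fun _ => u 0) • (fderiv ℝ (t j) y (u 1) + ρ (γ y fun _ => u 1) (t j y)) -
      a j y (fun _ => u 1) • (fderiv ℝ (t j) y (u 0) + ρ (γ y fun _ => u 0) (t j y)))) =
      (∑ j, (a j y (fun _ => u 1) • fderiv ℝ (t j) y (u 0) +
        fderiv ℝ (a j) y (u 0) (fun _ => u 1) • t j y) -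
      ∑ j, (a j y (fun _ => u 0) • fderiv ℝ (t j) y (u 1) +
        fderiv ℝ (a j) y (u 1) (fun _ => u 0) • t j y)) -
      ∑ j, a j y (fun _ => u 0) • ρ (γ y fun _ => u 1) (t j y) +
      ∑ j, a j y (fun _ => u 1) • ρ (γ y fun _ => u 0) (t j y) := by
    simp only [← Finset.sum_sub_distrib, ← Finset.sum_add_distrib]
    refine Finset.sum_congr rfl fun j _ => ?_
    simp only [sub_smul, smul_add]
    abel
  refine Eq.trans ?_ (k5.trans ?_)
  · exact Finset.sum_congr rfl fun j _ => by simp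
  rw [k4, e0, e1]
  abel

/-- `curvature_apply_of_decomposition`, with the action of the algebra as a plain function. -/
lemma curvature_apply_of_decomposition' (ρ : R →L[ℝ] V →L[ℝ] V)
    (act : R → V → V) (hact : ∀ a v, ρ a v = act a v)
    (hρ : ∀ a b v, act (a * b) v = act a (act b v)) {γ : E → E [⋀^Fin 1]→L[ℝ] R} {S : E → V} {n : ℕ}
    {a : Fin n → E → E [⋀^Fin 1]→L[ℝ] ℝ} {t : Fin n → E → V} {y : E}
    (hγ : DifferentiableAt ℝ γ y) (hS : ContDiffAt ℝ ∞ S y)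
    (ha : ∀ j, DifferentiableAt ℝ (a j) y) (ht : ∀ j, DifferentiableAt ℝ (t j) y)
    (h : ∀ᶠ z in nhds y, ∀ w, fderiv ℝ S z w + act (γ z fun _ => w) (S z) =
      ∑ j, a j z (fun _ => w) • t j z) {N : Fin n → E [⋀^Fin 1]→L[ℝ] V}
    (hN : ∀ j w, N j (fun _ => w) = fderiv ℝ (t j) y w + act (γ y fun _ => w) (t j y))
    (u : Fin 2 → E) {Ω : R}
    (hΩ : Ω = (extDeriv γ y + wedge (ContinuousLinearMap.mul ℝ R) (γ y) (γ y)) u) :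
    ∑ j, (extDeriv (a j) y u • t j y - wedge (ContinuousLinearMap.lsmul ℝ ℝ) (a j y) (N j) u) =
      act Ω (S y) := by
  obtain rfl : act = fun a v => ρ a v := by
    funext a v
    rw [hact]
  rw [hΩ]
  exact curvature_apply_of_decomposition ρ hρ hγ hS ha ht h hN u

end LocalCurvature

/-! ### The square of a connection, in a chart and a trivialization. -/

section Connections

variable {A : Type*} [CStarAlgebra A] [PartialOrder A] [StarOrderedRing A]
  {E : Type*} [NormedAddCommGroup E] [NormedSpace ℝ E]
  {M : Type*} [TopologicalSpace M] [ChartedSpace E M]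
  {W : M → Type*} [∀ x, NormedAddCommGroup (W x)] [∀ x, NormedSpace ℂ (W x)]
  [∀ x, Module Aᵐᵒᵖ (W x)] [∀ x, HilbertModule A (W x)]
  {ι : Type*} {V : ι → Type*} [∀ i, NormedAddCommGroup (V i)] [∀ i, NormedSpace ℂ (V i)]
  [∀ i, Module Aᵐᵒᵖ (V i)] [∀ i, HilbertModule A (V i)]
  [FiniteDimensional ℝ E] [T2Space M] [IsManifold 𝓘(ℝ, E) ∞ M]

open HilbertModule

namespace SmoothHilbertBundle

variable {B : SmoothHilbertBundle A E W V} (D : B.Connection) {i : ι} {n : ℕ} {e : Fin n → V i}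
  {φ : Fin n → HomA A (V i) A}

/-- A section, in a chart and a trivialization. -/
lemma IsSmoothSection.contDiffOn {s : ∀ x, W x} (hs : B.IsSmoothSection s)
    {c : OpenPartialHomeomorph M E} (hc : c ∈ atlas E M) (i : ι) :
    ContDiffOn ℝ ∞ (fun y => B.triv i (c.symm y) (s (c.symm y)))
      (c.target ∩ c.symm ⁻¹' B.U i) := by
  have h1 := contMDiffOn_symm_of_mem_maximalAtlas (I := 𝓘(ℝ, E)) (n := ∞)
    (IsManifold.subset_maximalAtlas hc)
  have h2 := (hs i).comp (h1.mono Set.inter_subset_left) (fun y hy => hy.2)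
  exact contMDiffOn_iff_contDiffOn.1 h2

/-- The formula d + ω pulled back to the chart; the chain rule turns the intrinsic differential into
`fderiv`. -/
lemma Connection.inChart_trivForm (h : ∀ v, ∑ a, e a <• ((φ a).1 v) = v) {s : ∀ x, W x}
    (hs : B.IsSmoothSection s) {c : OpenPartialHomeomorph M E} (hc : c ∈ atlas E M) {y : E}
    (hy : y ∈ c.target ∩ c.symm ⁻¹' B.U i) (w : E) :
    (B.trivForm i (D.toFun s)).inChart c y (fun _ => w) =
      fderiv ℝ (fun y => B.triv i (c.symm y) (s (c.symm y))) y w +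
        ((D.form e φ).inChart c y fun _ => w).toCLM
          (B.triv i (c.symm y) (s (c.symm y))) := by
  have h1 := D.triv_toFun h hs hy.2 (fun _ => DForm.symmDeriv c y w)
  refine h1.trans ?_
  congr 1
  have h2 : MDifferentiableAt 𝓘(ℝ, E) 𝓘(ℝ, V i) (fun y => B.triv i y (s y)) (c.symm y) :=
    ((hs i).contMDiffAt ((B.isOpen_U i).mem_nhds hy.2)).mdifferentiableAt (by simp)
  have h3 := mfderiv_comp y h2
    ((DForm.mdifferentiable_of_mem_atlas' hc).mdifferentiableAt_symm hy.1)
  rw [mfderiv_eq_fderiv] at h3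
  exact (DFunLike.congr_fun h3 w).symm

lemma trivForm_wedge_lsmul {c : OpenPartialHomeomorph M E} (hc : c ∈ atlas E M) {x : M}
    (hxc : x ∈ c.source) (α : DForm E (fun _ : M => ℝ) 1) (β : DForm E W 1)
    (ξ : Fin 2 → TangentSpace 𝓘(ℝ, E) x) :
    B.triv i x (wedge (ContinuousLinearMap.lsmul ℝ ℝ) (α x) (β x) ξ) =
      wedge (ContinuousLinearMap.lsmul ℝ ℝ) (α.inChart c (c x))
        ((B.trivForm i β).inChart c (c x)) (fun j => DForm.chartDeriv c x (ξ j)) := by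
  have e4 := DFunLike.congr_fun (wedge_compContinuousLinearMap (ContinuousLinearMap.lsmul ℝ ℝ)
    (α.inChart c (c x)) ((B.trivForm i β).inChart c (c x)) (DForm.chartDeriv c x)) ξ
  rw [DForm.inChart_comp_chartDeriv _ hc hxc, DForm.inChart_comp_chartDeriv _ hc hxc] at e4
  refine Eq.trans ?_ e4.symm
  have e5 := wedge_apply_one_one (ContinuousLinearMap.lsmul ℝ ℝ) (α.val x)
    ((B.trivForm i β).val x) ξ
  refine (congrArg (B.triv i x) (wedge_apply_one_one (ContinuousLinearMap.lsmul ℝ ℝ) (α x)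
    (β x) ξ)).trans (Eq.trans ?_ e5.symm)
  rw [_root_.map_sub]
  exact congrArg₂ _ ((B.triv i x).map_smul_of_tower _ _) ((B.triv i x).map_smul_of_tower _ _)

/-- The right side involves neither the α_j nor the t_j: the Leibniz extension of ∇ to ∇s does not
depend on the decomposition, so a curvature can exist at all. -/
lemma Connection.inChart_sum_eq_curvature (h : ∀ v, ∑ a, e a <• ((φ a).1 v) = v) {s : ∀ x, W x}
    (hs : B.IsSmoothSection s) {O : Set M} (hO : IsOpen O) {m : ℕ}
    {α : Fin m → DForm E (fun _ : M => ℝ) 1} {t : Fin m → ∀ x, W x} (hα : ∀ j, (α j).IsSmooth)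
    (ht : ∀ j, B.IsSmoothSection (t j))
    (hd : ∀ x ∈ O, ∀ ξ, D.toFun s x ξ = ∑ j, α j x ξ • t j x) {c : OpenPartialHomeomorph M E}
    (hc : c ∈ atlas E M) {y : E} (hy : y ∈ c.target ∩ c.symm ⁻¹' B.U i) (hyO : c.symm y ∈ O)
    (u : Fin 2 → E) :
    ∑ j, (extDeriv (fun y => (α j).inChart c y) y u • B.triv i (c.symm y) (t j (c.symm y)) -
      wedge (ContinuousLinearMap.lsmul ℝ ℝ) ((α j).inChart c y)
        ((B.trivForm i (D.toFun (t j))).inChart c y) u) =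
      ((D.form e φ).curvature.inChart c y u).toCLM
        (B.triv i (c.symm y) (s (c.symm y))) := by
  have hN := (DForm.isOpen_inChart c (B.isOpen_U i)).mem_nhds hy
  have h1 : ∀ s : ∀ x, W x, B.IsSmoothSection s →
      ContDiffAt ℝ ∞ (fun y => B.triv i (c.symm y) (s (c.symm y))) y :=
    fun s hs => (hs.contDiffOn hc i).contDiffAt hN
  have h2 : DifferentiableAt ℝ (fun y => (D.form e φ).inChart c y) y :=
    D.smoothOn_form.differentiableAt (B.isOpen_U i) hc hy.1 hy.2
  have h3 : ∀ j, DifferentiableAt ℝ (fun y => (α j).inChart c y) y := fun j =>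
    (DForm.isSmooth_iff_smoothOn.1 (hα j)).differentiableAt isOpen_univ hc hy.1 (Set.mem_univ _)
  have h4 : ∀ j, DifferentiableAt ℝ (fun y => B.triv i (c.symm y) (t j (c.symm y))) y :=
    fun j => (h1 _ (ht j)).differentiableAt (by simp)
  refine curvature_apply_of_decomposition' EndR.action (fun T v => T.toCLM v)
    (fun _ _ => rfl) (fun _ _ _ => rfl) h2 (h1 s hs) h3 h4 ?_
    (fun j w => D.inChart_trivForm h (ht j) hc hy w) u
    (DFunLike.congr_fun (DForm.inChart_curvature (B.isOpen_U i) D.smoothOn_form hc hy) u)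
  filter_upwards [hN, (DForm.isOpen_inChart c hO).mem_nhds ⟨hy.1, hyO⟩] with z hz hzO w
  rw [← D.inChart_trivForm h hs hc hz w]
  refine (congrArg (B.triv i (c.symm z)) (hd _ hzO.2 fun _ => DForm.symmDeriv c z w)).trans ?_
  rw [_root_.map_sum]
  exact Finset.sum_congr rfl fun j _ => (B.triv i (c.symm z)).map_smul_of_tower _ _

/-- The `2`-form obtained by applying the extension of a connection to `∑ⱼ αⱼ ⊗ tⱼ` is given, in a
trivialization, by the curvature of the connection form. -/
lemma Connection.triv_sum_eq_curvature (h : ∀ v, ∑ a, e a <• ((φ a).1 v) = v) {s : ∀ x, W x}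
    (hs : B.IsSmoothSection s) {O : Set M} (hO : IsOpen O) {m : ℕ}
    {α : Fin m → DForm E (fun _ : M => ℝ) 1} {t : Fin m → ∀ x, W x} (hα : ∀ j, (α j).IsSmooth)
    (ht : ∀ j, B.IsSmoothSection (t j))
    (hd : ∀ x ∈ O, ∀ ξ, D.toFun s x ξ = ∑ j, α j x ξ • t j x) {x : M} (hx : x ∈ O)
    (hxi : x ∈ B.U i) (ξ : Fin 2 → TangentSpace 𝓘(ℝ, E) x) :
    B.triv i x (∑ j, ((α j).d x ξ • t j x +
      (-1 : ℝ) ^ 1 • wedge (ContinuousLinearMap.lsmul ℝ ℝ) (α j x) (D.toFun (t j) x) ξ)) =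
      ((D.form e φ).curvature x ξ).toCLM (B.triv i x (s x)) := by
  have hc : chartAt E x ∈ atlas E M := chart_mem_atlas E x
  have hxc : x ∈ (chartAt E x).source := mem_chart_source E x
  have e0 := (chartAt E x).left_inv hxc
  have key := D.inChart_sum_eq_curvature h hs hO hα ht hd hc
    (y := chartAt E x x) ⟨(chartAt E x).map_source hxc, by rwa [Set.mem_preimage, e0]⟩
    (by rwa [e0]) (fun j => DForm.chartDeriv (chartAt E x) x (ξ j))
  have e1 : (D.form e φ).curvature.inChart (chartAt E x) (chartAt E x x)
      (fun j => DForm.chartDeriv (chartAt E x) x (ξ j)) = (D.form e φ).curvature x ξ :=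
    DFunLike.congr_fun (DForm.inChart_comp_chartDeriv (D.form e φ).curvature hc hxc) ξ
  have e2 : ∀ s : ∀ x, W x, B.triv i ((chartAt E x).symm (chartAt E x x))
      (s ((chartAt E x).symm (chartAt E x x))) = B.triv i x (s x) := fun s => by rw [e0]
  simp only [e1, e2] at key
  refine Eq.trans ?_ key
  rw [_root_.map_sum]
  refine Finset.sum_congr rfl fun j _ => ?_
  rw [_root_.map_add, ← trivForm_wedge_lsmul hc hxc, pow_one, neg_one_smul, _root_.map_neg,
    ← sub_eq_add_neg]
  congr 1
  exact (B.triv i x).map_smul_of_tower _ _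

end SmoothHilbertBundle

end Connections

/-! ### Functions as 0-forms, and coordinate differentials. -/

section Functions

variable {E : Type*} [NormedAddCommGroup E] [NormedSpace ℝ E]
  {M : Type*} [TopologicalSpace M] [ChartedSpace E M] [IsManifold 𝓘(ℝ, E) ∞ M]
  {F : Type*} [NormedAddCommGroup F] [NormedSpace ℝ F]

namespace DForm

variable (E) in
/-- A function, as a form of degree zero. -/
def ofFun (f : M → F) : DForm E (fun _ : M => F) 0 :=
  fun x => ContinuousAlternatingMap.constOfIsEmpty ℝ (TangentSpace 𝓘(ℝ, E) x) (Fin 0) (f x)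

lemma inChart_ofFun (f : M → F) (c : OpenPartialHomeomorph M E) (y : E) :
    (ofFun E f).inChart c y = ContinuousAlternatingMap.constOfIsEmpty ℝ E (Fin 0) (f (c.symm y)) :=
  rfl

lemma isSmooth_ofFun {f : M → F} (hf : ContMDiff 𝓘(ℝ, E) 𝓘(ℝ, F) ∞ f) : (ofFun E f).IsSmooth := by
  refine .of_contDiffOn fun c hc => ?_
  simp only [inChart_ofFun]
  have h1 := contMDiffOn_symm_of_mem_maximalAtlas (I := 𝓘(ℝ, E)) (n := ∞)
    (IsManifold.subset_maximalAtlas hc)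
  exact (ContinuousAlternatingMap.constOfIsEmptyLIE ℝ E F
    (Fin 0)).toContinuousLinearEquiv.contDiff.comp_contDiffOn
      (contMDiffOn_iff_contDiffOn.1 (hf.comp_contMDiffOn h1))

/-- Near every point, the coordinates of a chart are given by the differentials of smooth functions
on the whole manifold. -/
lemma exists_coordinate [FiniteDimensional ℝ E] [T2Space M] (x : M) (b : E →L[ℝ] ℝ) :
    ∃ α : DForm E (fun _ : M => ℝ) 1, α.IsSmooth ∧ ∀ᶠ y in nhds x,
      ∀ ξ, α y ξ = b (chartDeriv (chartAt E x) y (ξ 0)) := by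
  obtain ⟨c, hc⟩ : ∃ c, c = chartAt E x := ⟨_, rfl⟩
  have hca : c ∈ atlas E M := hc ▸ chart_mem_atlas E x
  have hxc : x ∈ c.source := hc ▸ mem_chart_source E x
  rw [← hc]
  obtain ⟨χ, h1, h2, h3⟩ := exists_bump (E := E) c.open_source hxc
  have h4 : ContMDiffOn 𝓘(ℝ, E) 𝓘(ℝ, E) ∞ c c.source :=
    contMDiffOn_of_mem_maximalAtlas (IsManifold.subset_maximalAtlas hca)
  -- The coordinate is defined only on the chart domain; the cut-off makes it global without
  -- changing its differential near x.
  have hf : ContMDiff 𝓘(ℝ, E) 𝓘(ℝ, ℝ) ∞ (fun y => χ y • b (c y)) := by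
    intro y
    by_cases hy : y ∈ c.source
    · exact h1.contMDiffAt.smul (b.contDiff.contMDiff.contMDiffAt.comp y
        (h4.contMDiffAt (c.open_source.mem_nhds hy)))
    · refine (contMDiffAt_const (c := (0 : ℝ))).congr_of_eventuallyEq ?_
      filter_upwards [(isClosed_tsupport χ).isOpen_compl.mem_nhds (fun h => hy (h2 h))] with z hz
      rw [image_eq_zero_of_notMem_tsupport hz, zero_smul]
  have hs := isSmooth_ofFun (E := E) hf
  refine ⟨(ofFun E fun y => χ y • b (c y)).d,
    isSmooth_iff_smoothOn.2 ((isSmooth_iff_smoothOn.1 hs).d isOpen_univ), ?_⟩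
  filter_upwards [h3.eventually_nhds, c.open_source.mem_nhds hxc] with y hy hyc ξ
  have e1 := inChart_comp_chartDeriv (ofFun E fun y => χ y • b (c y)).d hca hyc
  rw [inChart_d isOpen_univ (isSmooth_iff_smoothOn.1 hs) hca (c.map_source hyc) (Set.mem_univ _)]
    at e1
  simp only [inChart_ofFun] at e1
  rw [extDeriv_constOfIsEmpty] at e1
  have e2 : (fun z => χ (c.symm z) • b (c (c.symm z))) =ᶠ[nhds (c y)] b := by
    have h5 : ContinuousAt c.symm (c y) := c.continuousAt_symm (c.map_source hyc)
    have h6 : ∀ᶠ z in nhds (c y), χ (c.symm z) = 1 := by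
      rw [ContinuousAt, c.left_inv hyc] at h5
      exact h5.eventually hy
    filter_upwards [h6, c.open_target.mem_nhds (c.map_source hyc)] with z hz hzc
    rw [hz, one_smul, c.right_inv hzc]
  rw [e2.fderiv_eq, b.fderiv] at e1
  exact (DFunLike.congr_fun e1 ξ).symm

end DForm

end Functions

/-! ### Existence and uniqueness of the curvature. -/

section Connections

variable {A : Type*} [CStarAlgebra A] [PartialOrder A] [StarOrderedRing A]
  {E : Type*} [NormedAddCommGroup E] [NormedSpace ℝ E]
  {M : Type*} [TopologicalSpace M] [ChartedSpace E M]
  {W : M → Type*} [∀ x, NormedAddCommGroup (W x)] [∀ x, NormedSpace ℂ (W x)]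
  [∀ x, Module Aᵐᵒᵖ (W x)] [∀ x, HilbertModule A (W x)]
  {ι : Type*} {V : ι → Type*} [∀ i, NormedAddCommGroup (V i)] [∀ i, NormedSpace ℂ (V i)]
  [∀ i, Module Aᵐᵒᵖ (V i)] [∀ i, HilbertModule A (V i)]
  [FiniteDimensional ℝ E] [T2Space M] [IsManifold 𝓘(ℝ, E) ∞ M]

open HilbertModule

namespace SmoothHilbertBundle

variable {B : SmoothHilbertBundle A E W V} (D : B.Connection) {i : ι} {n : ℕ} {e : Fin n → V i}
  {φ : Fin n → HomA A (V i) A}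

/-- Bundle valued `1`-forms are locally of the form `∑ⱼ αⱼ ⊗ tⱼ`. -/
lemma exists_decomposition {θ : DForm E W 1} (hθ : B.IsSmoothForm θ) (x : M) :
    ∃ (O : Set M) (m : ℕ) (α : Fin m → DForm E (fun _ : M => ℝ) 1) (t : Fin m → ∀ x, W x),
      IsOpen O ∧ x ∈ O ∧ (∀ j, (α j).IsSmooth) ∧ (∀ j, B.IsSmoothSection (t j)) ∧
      ∀ y ∈ O, ∀ ξ, θ y ξ = ∑ j, α j y ξ • t j y := by
  obtain ⟨i, hi⟩ := B.exists_mem_U x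
  set c := chartAt E x with hc
  have hca : c ∈ atlas E M := chart_mem_atlas E x
  have hxc : x ∈ c.source := mem_chart_source E x
  let b := Module.finBasis ℝ E
  choose α hα hα' using fun j => DForm.exists_coordinate (M := M) x
    (LinearMap.toContinuousLinearMap (b.coord j))
  have h1 := DForm.smoothOn_iff.1 (hθ.smoothOn i) c hca
  have h2 : ∀ j, ContMDiffOn 𝓘(ℝ, E) 𝓘(ℝ, V i) ∞
      (fun y => (B.trivForm i θ).inChart c (c y) (fun _ => b j)) (c.source ∩ B.U i) := fun j => by
    refine (contMDiffOn_iff_contDiffOn.2 (h1.alternating_apply fun _ => b j)).comp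
      ((contMDiffOn_of_mem_maximalAtlas (IsManifold.subset_maximalAtlas hca)).mono
        Set.inter_subset_left) fun y hy => ⟨c.map_source hy.1, ?_⟩
    rw [Set.mem_preimage, c.left_inv hy.1]
    exact hy.2
  choose t ht ht' using fun j => exists_section (B := B) (c.open_source.inter (B.isOpen_U i))
    Set.inter_subset_right ⟨hxc, hi⟩ (h2 j)
  have h3 : ∀ᶠ y in nhds x, ∀ ξ, θ y ξ = ∑ j, α j y ξ • t j y := by
    filter_upwards [Filter.eventually_all.2 hα', Filter.eventually_all.2 ht',
      c.open_source.mem_nhds hxc, (B.isOpen_U i).mem_nhds hi] with y h4 h5 hyc hyi ξ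
    have e1 : B.triv i y (θ y ξ) = (B.trivForm i θ).inChart c (c y)
        (fun j => DForm.chartDeriv c y (ξ j)) :=
      (DFunLike.congr_fun (DForm.inChart_comp_chartDeriv (B.trivForm i θ) hca hyc) ξ).symm
    have e2 : ∀ w : E, (B.trivForm i θ).inChart c (c y) (fun _ => w) =
        ∑ j, b.coord j w • (B.trivForm i θ).inChart c (c y) (fun _ => b j) := by
      intro w
      have e3 := map_sum ((ContinuousAlternatingMap.ofSubsingleton ℝ E (V i) (0 : Fin 1)).symm
        ((B.trivForm i θ).inChart c (c y))) (fun j => b.repr w j • b j) Finset.univ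
      rw [b.sum_repr] at e3
      refine e3.trans (Finset.sum_congr rfl fun j _ => ?_)
      exact ((ContinuousAlternatingMap.ofSubsingleton ℝ E (V i) (0 : Fin 1)).symm
        ((B.trivForm i θ).inChart c (c y))).map_smul _ _
    have e4 : (fun j => DForm.chartDeriv c y (ξ j)) = fun _ => DForm.chartDeriv c y (ξ 0) := by
      funext j
      rw [Subsingleton.elim j 0]
    rw [e4, e2] at e1
    rw [← B.symm_triv i y hyi (θ y ξ), e1, _root_.map_sum]
    refine Finset.sum_congr rfl fun j _ => ?_
    rw [h4, h5]
    exact (B.symm i y).map_smul_of_tower _ _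
  obtain ⟨O, hO, hOo, hxO⟩ := eventually_nhds_iff.1 h3
  exact ⟨O, _, α, t, hOo, hxO, hα, ht, hO⟩

/-- Finite generation is assumed for the fibres only; the model V i inherits a frame from any fibre
over U i. -/
lemma exists_frame_of_mem (hW : ∀ x, IsFGP A (W x)) {x : M} (hx : x ∈ B.U i) :
    ∃ (n : ℕ) (e : Fin n → V i) (φ : Fin n → HomA A (V i) A),
      ∀ v, ∑ a, e a <• ((φ a).1 v) = v := by
  obtain ⟨n, e, φ, h⟩ := (hW x).exists_frame
  exact ⟨n, _, _, frame_comp h (B.triv_hom i x hx) (B.symm_hom i x hx) (B.triv_symm i x hx)⟩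

/-- An endomorphism of a fiber, read in a trivialization. -/
def endToTriv (B : SmoothHilbertBundle A E W V) {i : ι} {x : M} (hx : x ∈ B.U i) :
    EndA A (W x) → EndR A (V i) :=
  EndR.conj (B.symm_hom i x hx) (B.triv_hom i x hx)

lemma toCLM_endToTriv {x : M} (hx : x ∈ B.U i) (T : EndA A (W x)) (v : V i) :
    (B.endToTriv hx T).toCLM v = B.triv i x ((T : W x →L[ℂ] W x) (B.symm i x v)) := rfl

lemma endToTriv_injective {x : M} (hx : x ∈ B.U i) : Function.Injective (B.endToTriv hx) :=
  fun _ _ => EndR.conj_injective _ _ (B.symm_triv i x hx)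

/-- In a trivialization, the curvature is the curvature of the connection form. -/
lemma Connection.endToTriv_of_extends (h : ∀ v, ∑ a, e a <• ((φ a).1 v) = v)
    {Ω : DForm E (fun x => EndA A (W x)) 2}
    (hΩ : ∀ s, B.IsSmoothSection s → D.Extends (D.toFun s) (endApply Ω s)) {x : M}
    (hx : x ∈ B.U i) (ξ : Fin 2 → TangentSpace 𝓘(ℝ, E) x) :
    B.endToTriv hx (Ω x ξ) = (D.form e φ).curvature x ξ := by
  ext v
  -- The condition `Extends` determines Ω at x on the vector v because v is the value of a section s
  -- and ∇s has a decomposition near x.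
  obtain ⟨s, hs, hsx⟩ := B.exists_section_eq x (B.symm i x v)
  obtain ⟨O, m, α, t, hO, hxO, hα, ht, hd⟩ := exists_decomposition (D.smooth s hs) x
  have h1 := hΩ s hs O m α t hO hα ht hd x hxO ξ
  have h2 := D.triv_sum_eq_curvature h hs hO hα ht hd hxO hx ξ
  rw [← h1, hsx, B.triv_symm i x hx] at h2
  rw [← h2, toCLM_endToTriv, ← hsx]
  rfl

/-- A form with values in the endomorphisms which is given by the curvature of the connection form
in trivializations. -/
lemma Connection.isCurvature_of_endToTriv (hW : ∀ x, IsFGP A (W x))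
    {Ω : DForm E (fun x => EndA A (W x)) 2}
    (h : ∀ x, ∃ (i : ι) (n : ℕ) (e : Fin n → V i) (φ : Fin n → HomA A (V i) A) (hx : x ∈ B.U i),
      (∀ v, ∑ a, e a <• ((φ a).1 v) = v) ∧
        ∀ ξ, B.endToTriv hx (Ω x ξ) = (D.form e φ).curvature x ξ) : D.IsCurvature Ω := by
  have h1 : ∀ s, B.IsSmoothSection s → D.Extends (D.toFun s) (endApply Ω s) := by
    intro s hs O m α t hO hα ht hd x hxO ξ
    obtain ⟨i, n, e, φ, hx, hf, h2⟩ := h x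
    have h3 := D.triv_sum_eq_curvature hf hs hO hα ht hd hxO hx ξ
    rw [← h2, toCLM_endToTriv, B.symm_triv i x hx] at h3
    rw [← B.symm_triv i x hx (∑ j, _), h3, B.symm_triv i x hx]
    rfl
  -- The hypothesis describes Ω in a single trivialization at each point. Through h1, however, Ω is
  -- the curvature of the connection form in every trivialization, and that is smooth.
  refine ⟨fun i c hc y hy => ?_, h1⟩
  obtain ⟨n, e, φ, hf⟩ := exists_frame_of_mem hW hy.2
  have h2 := (DForm.smoothOn_iff.1 ((D.smoothOn_form (e := e) (φ := φ)).curvature (B.isOpen_U i))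
    c hc)
  have h3 : DForm.SmoothOn (fun x => (NormedCLM.mkBounded
      (fun T : EndR A (V i) => T.toCLM) (fun _ _ => rfl) (fun _ _ => rfl) 1
        (fun T => by rw [one_mul, EndR.norm_eq])).compContinuousAlternatingMap
          ((D.form e φ).curvature x) : DForm E (fun _ : M => V i →L[ℂ] V i) 2) (B.U i) :=
    ((D.smoothOn_form (e := e) (φ := φ)).curvature (B.isOpen_U i)).comp_clm _
  refine ((DForm.smoothOn_iff.1 h3 c hc).congr fun z hz => ?_) y hy
  ext u v
  have h4 := D.endToTriv_of_extends hf h1 hz.2 (fun j => DForm.symmDeriv c z (u j))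
  exact congrArg (fun T : EndR A (V i) => T.toCLM v) h4

/-- A connection has exactly one curvature. -/
theorem Connection.existsUnique_curvature (hW : ∀ x, IsFGP A (W x)) :
    ∃! Ω, D.IsCurvature Ω := by
  -- The trivialization and frame may be chosen pointwise without any regularity:
  -- `isCurvature_of_endToTriv` supplies the smoothness.
  choose i hi using B.exists_mem_U
  choose n e φ hf using fun x => exists_frame_of_mem hW (hi x)
  refine ⟨fun x => (EndR.conjSymm (B.symm_hom (i x) x (hi x))
    (B.triv_hom (i x) x (hi x))).compContinuousAlternatingMap ((D.form (e x) (φ x)).curvature x),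
    D.isCurvature_of_endToTriv hW fun x => ⟨i x, n x, e x, φ x, hi x, hf x, fun ξ => ?_⟩,
    fun Ω hΩ => ?_⟩
  · exact EndR.conj_conjSymm _ _ (B.triv_symm (i x) x (hi x)) _
  · funext x
    ext ξ : 1
    refine endToTriv_injective (hi x) ?_
    rw [D.endToTriv_of_extends (hf x) hΩ.2]
    exact (EndR.conj_conjSymm _ _ (B.triv_symm (i x) x (hi x)) _).symm

end SmoothHilbertBundle

end Connections

/-! ### Wedge products under algebra homomorphisms. -/

section WedgeMaps

variable {T R S : Type*} [AddCommGroup T] [Module ℝ T] [TopologicalSpace T]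
  [NormedRing R] [NormedAlgebra ℝ R] [NormedRing S] [NormedAlgebra ℝ S] {f : R → S}
  (hadd : ∀ a b, f (a + b) = f a + f b) (hsmul : ∀ (c : ℝ) a, f (c • a) = c • f a)
  (hmul : ∀ a b, f (a * b) = f a * f b)
include hadd hsmul hmul

/-- Meant for `endToTriv`, a plain function known to be additive, real-homogeneous and
multiplicative: a wedge product is a real linear combination of products, which such a map
preserves. -/
lemma map_wedge_apply {p q : ℕ} {α : T [⋀^Fin p]→L[ℝ] R} {β : T [⋀^Fin q]→L[ℝ] R}
    {α' : T [⋀^Fin p]→L[ℝ] S} {β' : T [⋀^Fin q]→L[ℝ] S} (hα : ∀ v, f (α v) = α' v)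
    (hβ : ∀ v, f (β v) = β' v) (v : Fin (p + q) → T) :
    f (wedge (ContinuousLinearMap.mul ℝ R) α β v) =
      wedge (ContinuousLinearMap.mul ℝ S) α' β' v := by
  obtain ⟨g, rfl⟩ : ∃ g : R →ₗ[ℝ] S, f = g := ⟨⟨⟨f, hadd⟩, hsmul⟩, rfl⟩
  simp only [wedge_apply, map_smul, map_sum, Units.smul_def, map_zsmul,
    ContinuousLinearMap.mul_apply', hmul, hα, hβ]

lemma map_wedgePow_apply (h1 : f 1 = 1) {Φ : T [⋀^Fin 2]→L[ℝ] R} {Ψ : T [⋀^Fin 2]→L[ℝ] S}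
    (h : ∀ v, f (Φ v) = Ψ v) (k : ℕ) : ∀ v, f (wedgePow Φ k v) = wedgePow Ψ k v := by
  induction k with
  | zero => exact fun v => h1
  | succ k ih => exact map_wedge_apply hadd hsmul hmul ih h

end WedgeMaps

/-- The curvature along a line of connection forms has this shape in the parameter. -/
lemma hasDerivAt_quadratic {T F : Type*} [AddCommGroup T] [Module ℝ T] [TopologicalSpace T]
    [NormedAddCommGroup F] [NormedSpace ℝ F] {p : ℕ} (a b c : T [⋀^Fin p]→L[ℝ] F) (t : ℝ)
    (u : Fin p → T) :
    HasDerivAt (fun s : ℝ => (a + s • b + s ^ 2 • c) u) ((b + (2 * t) • c) u) t := by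
  have h := (((hasDerivAt_id t).smul_const (b u)).const_add (a u)).add
    ((hasDerivAt_pow 2 t).smul_const (c u))
  simp only [one_smul, Nat.cast_ofNat, show (2 : ℕ) - 1 = 1 from rfl, pow_one] at h
  exact h

/-! ### Curvature along a line of connection forms. -/

section CurvatureFamilies

variable {E : Type*} [NormedAddCommGroup E] [NormedSpace ℝ E] [FiniteDimensional ℝ E]
  {M : Type*} [TopologicalSpace M] [ChartedSpace E M] [IsManifold 𝓘(ℝ, E) ∞ M]
  {F R : Type*} [NormedAddCommGroup F] [NormedSpace ℝ F] [NormedRing R] [NormedAlgebra ℝ R]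
  {U : Set M}

namespace DForm

/-- Linearity of d and bilinearity of the wedge product. The linear coefficient is the covariant
derivative of θ for γ. -/
lemma curvature_add_smul (hU : IsOpen U) {γ θ : DForm E (fun _ : M => R) 1} (hγ : γ.SmoothOn U)
    (hθ : θ.SmoothOn U) (t : ℝ) {x : M} (hx : x ∈ U) :
    (γ + t • θ).curvature x = γ.curvature x + t • (θ.d x +
      _root_.wedge (ContinuousLinearMap.mul ℝ R) (γ x) (θ x) +
      _root_.wedge (ContinuousLinearMap.mul ℝ R) (θ x) (γ x)) +
      t ^ 2 • _root_.wedge (ContinuousLinearMap.mul ℝ R) (θ x) (θ x) := by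
  have h1 : (γ + t • θ).d x = γ.d x + t • θ.d x := by
    rw [d_add_apply hU hγ (hθ.const_smul t) hx, d_smul]
    rfl
  have h2 : _root_.wedge (ContinuousLinearMap.mul ℝ R) ((γ + t • θ) x) ((γ + t • θ) x) =
      wedgeₗ (ContinuousLinearMap.mul ℝ R) (γ x + t • θ x) (γ x + t • θ x) := rfl
  rw [curvature, curvature, h1, h2]
  simp only [map_add, map_smul, LinearMap.add_apply, LinearMap.smul_apply, smul_add, smul_smul]
  simp only [wedgeₗ, LinearMap.mk₂_apply, pow_two]
  abel

variable (T : R →L[ℝ] F) (hT : ∀ a b, T (a * b) = T (b * a))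

/-- The curvature is quadratic in t, so the trace of its k-th power has degree at most 2k. -/
lemma polyCurves_wedgePow_curvature (hU : IsOpen U) {γ θ : DForm E (fun _ : M => R) 1}
    (hγ : γ.SmoothOn U) (hθ : θ.SmoothOn U) {x : M} (hx : x ∈ U) (k : ℕ) :
    (fun t : ℝ => T.compContinuousAlternatingMap (_root_.wedgePow ((γ + t • θ).curvature x) k)) ∈
      polyCurves (TangentSpace 𝓘(ℝ, E) x [⋀^Fin (2 * k)]→L[ℝ] F) (k * 2 + 1) := by
  have h1 : (fun t : ℝ => (γ + t • θ).curvature x) ∈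
      polyCurves (TangentSpace 𝓘(ℝ, E) x [⋀^Fin 2]→L[ℝ] R) (2 + 1) := by
    simp only [curvature_add_smul hU hγ hθ _ hx]
    refine Submodule.add_mem _ (Submodule.add_mem _ (polyCurves_const (by lia) _) ?_)
      (polyCurves_monomial (by lia) _)
    simpa only [pow_one] using polyCurves_monomial (m := 1) (N := 2 + 1) (by lia) _
  exact polyCurves_comp (ContinuousLinearMap.compContinuousAlternatingMapCLM ℝ E R F
    (Fin (2 * k)) T).toLinearMap (polyCurves_wedgePow h1 k)

-- The t-derivative of the curvature of γ + tθ is the covariant derivative of θ for that same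
-- connection form, and the trace of its product with the k-th power is exact by the transgression
-- formula.
include hT in
lemma hasDerivAt_trace_wedgePow_curvature (hU : IsOpen U) {γ θ : DForm E (fun _ : M => R) 1}
    (hγ : γ.SmoothOn U) (hθ : θ.SmoothOn U) {x : M} (hx : x ∈ U) (k : ℕ) (t : ℝ)
    (v : Fin (2 * (k + 1)) → TangentSpace 𝓘(ℝ, E) x) :
    HasDerivAt (fun s : ℝ => T (_root_.wedgePow ((γ + s • θ).curvature x) (k + 1) v))
      (((k + 1 : ℕ) : ℝ) • DForm.d (fun x => T.compContinuousAlternatingMap (_root_.wedge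
        (ContinuousLinearMap.mul ℝ R) (_root_.wedgePow ((γ + t • θ).curvature x) k) (θ x)) :
          DForm E (fun _ : M => F) (2 * k + 1)) x v) t := by
  rw [d_trace_wedgePow_curvature_wedge T hT hU (hγ.add (hθ.const_smul t)) hθ k hx]
  have h2 : θ.d x + _root_.wedge (ContinuousLinearMap.mul ℝ R) ((γ + t • θ) x) (θ x) +
      _root_.wedge (ContinuousLinearMap.mul ℝ R) (θ x) ((γ + t • θ) x) =
      (θ.d x + _root_.wedge (ContinuousLinearMap.mul ℝ R) (γ x) (θ x) +
        _root_.wedge (ContinuousLinearMap.mul ℝ R) (θ x) (γ x)) +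
        (2 * t) • _root_.wedge (ContinuousLinearMap.mul ℝ R) (θ x) (θ x) := by
    have h4 : _root_.wedge (ContinuousLinearMap.mul ℝ R) ((γ + t • θ) x) (θ x) =
      wedgeₗ (ContinuousLinearMap.mul ℝ R) (γ x + t • θ x) (θ x) := rfl
    have h5 : _root_.wedge (ContinuousLinearMap.mul ℝ R) (θ x) ((γ + t • θ) x) =
      wedgeₗ (ContinuousLinearMap.mul ℝ R) (θ x) (γ x + t • θ x) := rfl
    rw [h4, h5]
    simp only [map_add, map_smul, LinearMap.add_apply, LinearMap.smul_apply]
    simp only [wedgeₗ, LinearMap.mk₂_apply, two_mul, add_smul]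
    abel
  rw [h2]
  have h1 := fun u => hasDerivAt_quadratic (γ.curvature x) (θ.d x +
    _root_.wedge (ContinuousLinearMap.mul ℝ R) (γ x) (θ x) +
    _root_.wedge (ContinuousLinearMap.mul ℝ R) (θ x) (γ x))
    (_root_.wedge (ContinuousLinearMap.mul ℝ R) (θ x) (θ x)) t u
  simp only [curvature_add_smul hU hγ hθ _ hx]
  exact hasDerivAt_trace_wedgePow (E := E) T hT h1 k v

end DForm

end CurvatureFamilies

/-! ### Closedness of the Chern forms; interpolation of connections. -/

section Connections

variable {A : Type*} [CStarAlgebra A] [PartialOrder A] [StarOrderedRing A]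
  {E : Type*} [NormedAddCommGroup E] [NormedSpace ℝ E]
  {M : Type*} [TopologicalSpace M] [ChartedSpace E M]
  {W : M → Type*} [∀ x, NormedAddCommGroup (W x)] [∀ x, NormedSpace ℂ (W x)]
  [∀ x, Module Aᵐᵒᵖ (W x)] [∀ x, HilbertModule A (W x)]
  {ι : Type*} {V : ι → Type*} [∀ i, NormedAddCommGroup (V i)] [∀ i, NormedSpace ℂ (V i)]
  [∀ i, Module Aᵐᵒᵖ (V i)] [∀ i, HilbertModule A (V i)]
  [FiniteDimensional ℝ E] [T2Space M] [IsManifold 𝓘(ℝ, E) ∞ M]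

open HilbertModule

namespace SmoothHilbertBundle

variable {B : SmoothHilbertBundle A E W V} (D : B.Connection) {i : ι} {n : ℕ} {e : Fin n → V i}
  {φ : Fin n → HomA A (V i) A}

lemma endToTriv_add {x : M} (hx : x ∈ B.U i) (S T : EndA A (W x)) :
    B.endToTriv hx (S + T) = B.endToTriv hx S + B.endToTriv hx T := EndR.conj_add _ _ _ _

lemma endToTriv_smul {x : M} (hx : x ∈ B.U i) (c : ℝ) (T : EndA A (W x)) :
    B.endToTriv hx (c • T) = c • B.endToTriv hx T := EndR.conj_smul _ _ _ _

lemma endToTriv_mul {x : M} (hx : x ∈ B.U i) (S T : EndA A (W x)) :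
    B.endToTriv hx (S * T) = B.endToTriv hx S * B.endToTriv hx T :=
  EndR.conj_mul _ _ (B.symm_triv i x hx) _ _

lemma endToTriv_one {x : M} (hx : x ∈ B.U i) : B.endToTriv hx 1 = 1 :=
  EndR.conj_one _ _ (B.triv_symm i x hx)

variable {Z : Type*} [NonUnitalCommCStarAlgebra Z] {τ : A →L[ℂ] Z}
  (hτ : ∀ a b : A, τ (a * b) = τ (b * a)) (hW : ∀ x, IsFGP A (W x))

/-- The trace of an endomorphism valued form. -/
def traceForm {p : ℕ} (x : M) (α : TangentSpace 𝓘(ℝ, E) x [⋀^Fin p]→L[ℝ] EndA A (W x)) :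
    TangentSpace 𝓘(ℝ, E) x [⋀^Fin p]→L[ℝ] Z :=
  ((traceEv τ hτ (hW x)).restrictScalars ℝ).compContinuousAlternatingMap α

lemma traceForm_eq (h : ∀ v, ∑ a, e a <• ((φ a).1 v) = v) {p : ℕ} {x : M} (hx : x ∈ B.U i)
    {α : TangentSpace 𝓘(ℝ, E) x [⋀^Fin p]→L[ℝ] EndA A (W x)}
    {β : TangentSpace 𝓘(ℝ, E) x [⋀^Fin p]→L[ℝ] EndR A (V i)}
    (hβ : ∀ ξ, B.endToTriv hx (α ξ) = β ξ) :
    traceForm hτ hW x α = (frameTrace τ e φ).compContinuousAlternatingMap β := by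
  ext ξ
  refine (traceEv_eq_frameTrace τ hτ (hW x) h (B.symm_hom i x hx) (B.triv_hom i x hx)
    (B.symm_triv i x hx) (α ξ)).trans ?_
  exact congrArg _ (hβ ξ)

/-- Reading endomorphisms in a trivialization is an algebra isomorphism onto its image, so it
commutes with wedge powers, and the trace becomes that of a frame. The form is thus determined by
the local connection form alone. -/
lemma chernForm_eq (h : ∀ v, ∑ a, e a <• ((φ a).1 v) = v) {Ω : DForm E (fun x => EndA A (W x)) 2}
    (hΩ : D.IsCurvature Ω) (k : ℕ) {x : M} (hx : x ∈ B.U i) :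
    chernForm τ hτ hW Ω k x =
      ((k.factorial : ℝ)⁻¹) • (frameTrace τ e φ).compContinuousAlternatingMap
      (wedgePow ((D.form e φ).curvature x) k) := by
  refine (traceForm_eq hτ hW h hx (α := expForm (Ω x) k)
    (β := ((k.factorial : ℝ)⁻¹) • wedgePow ((D.form e φ).curvature x) k) fun ξ => ?_).trans ?_
  · refine (endToTriv_smul hx _ _).trans (congrArg _ ?_)
    exact map_wedgePow_apply (endToTriv_add hx) (endToTriv_smul hx) (endToTriv_mul hx)
      (endToTriv_one hx) (D.endToTriv_of_extends h hΩ.2 hx) k ξ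
  · ext ξ
    exact map_smul (frameTrace τ e φ) _ _

/-- Smoothness and d are local; over each U i the form is a multiple of the frame trace of a power
of the curvature of the connection form. -/
theorem chernForm_mem_closedForms {Ω : DForm E (fun x => EndA A (W x)) 2} (hΩ : D.IsCurvature Ω)
    (k : ℕ) : chernForm τ hτ hW Ω k ∈ closedForms E M Z (2 * k) := by
  have key : ∀ x, ∃ O, IsOpen O ∧ x ∈ O ∧ (chernForm τ hτ hW Ω k).SmoothOn O ∧
      (chernForm τ hτ hW Ω k).d x = 0 := by
    intro x
    obtain ⟨i, hi⟩ := B.exists_mem_U x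
    obtain ⟨n, e, φ, hf⟩ := exists_frame_of_mem hW hi
    have h1 := D.smoothOn_form (e := e) (φ := φ)
    have h2 : ∀ y ∈ B.U i, (((k.factorial : ℝ)⁻¹) • (fun x =>
        (frameTrace τ e φ).compContinuousAlternatingMap (wedgePow ((D.form e φ).curvature x) k) :
          DForm E (fun _ : M => Z) (2 * k))) y = chernForm τ hτ hW Ω k y :=
      fun y hy => (chernForm_eq D hτ hW hf hΩ k hy).symm
    refine ⟨B.U i, B.isOpen_U i, hi, ?_, ?_⟩
    · exact ((((h1.curvature (B.isOpen_U i)).wedgePow k).comp_clm (frameTrace τ e φ)).const_smul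
        _).congr h2
    · rw [← DForm.d_congr (B.isOpen_U i) h2 hi, DForm.d_smul, Pi.smul_apply,
        DForm.d_trace_wedgePow_curvature (frameTrace τ e φ) (frameTrace_mul_comm τ hτ hf)
          (B.isOpen_U i) h1 k hi, smul_zero]
  refine ⟨DForm.isSmooth_iff_smoothOn.2 (DForm.smoothOn_of_locally fun x _ => ?_), ?_⟩
  · obtain ⟨O, hO, hx, h, -⟩ := key x
    exact ⟨O, hO, hx, h⟩
  · funext x
    obtain ⟨O, hO, hx, -, h⟩ := key x
    exact h

variable (D' : B.Connection)

lemma trivForm_add {p : ℕ} (α β : DForm E W p) :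
    B.trivForm i (α + β) = B.trivForm i α + B.trivForm i β := by
  funext x
  ext ξ
  exact _root_.map_add (B.triv i x) _ _

lemma trivForm_smul {p : ℕ} (c : ℝ) (α : DForm E W p) :
    B.trivForm i (c • α) = c • B.trivForm i α := by
  funext x
  ext ξ
  exact (B.triv i x).map_smul_of_tower _ _

/-- The connection `(1 - t) D + t D'`. -/
def Connection.interpolate (t : ℝ) : B.Connection where
  toFun s := D.toFun s + t • (D'.toFun s + (-1 : ℝ) • D.toFun s)
  smooth s hs i := by
    have h1 := (D.smooth s hs).smoothOn i
    have h2 := (D'.smooth s hs).smoothOn i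
    have h3 := h1.add ((h2.add (h1.const_smul (-1))).const_smul t)
    rw [← trivForm_smul, ← trivForm_add, ← trivForm_smul, ← trivForm_add] at h3
    exact h3
  map_add s s' hs hs' := by
    funext x
    rw [D.map_add s s' hs hs', D'.map_add s s' hs hs']
    ext ξ
    simp only [Pi.add_apply, Pi.smul_apply, smul_add, ContinuousAlternatingMap.add_apply,
      ContinuousAlternatingMap.smul_apply]
    abel
  leibniz s f hs hf x ξ := by
    -- The term s df occurs in both connections and cancels in their difference, so it survives
    -- exactly once: an affine combination of connections is a connection.
    simp only [Pi.add_apply, Pi.smul_apply, ContinuousAlternatingMap.add_apply,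
      ContinuousAlternatingMap.smul_apply, D.leibniz s f hs hf, D'.leibniz s f hs hf]
    rw [neg_one_smul, neg_one_smul, ← sub_eq_add_neg, ← sub_eq_add_neg, add_sub_add_left_eq_sub,
      smul_add, add_assoc, ← smul_sub]
    congr 2
    exact (isBoundedBilinearMap_op_smul.smul_left t _ (f x)).symm

/-- The difference of the connection forms of two connections. -/
def Connection.formDiff (e : Fin n → V i) (φ : Fin n → HomA A (V i) A) :
    DForm E (fun _ : M => EndR A (V i)) 1 := D'.form e φ + (-1 : ℝ) • D.form e φ

lemma Connection.smoothOn_formDiff : (D.formDiff D' e φ).SmoothOn (B.U i) :=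
  D'.smoothOn_form.add (D.smoothOn_form.const_smul _)

/-- The local sections entering the form do not depend on the connection, so the form is affine in
it. -/
lemma Connection.form_interpolate (t : ℝ) :
    (D.interpolate D' t).form e φ = D.form e φ + t • D.formDiff D' e φ := by
  have h1 : ∀ s, B.trivForm i ((D.interpolate D' t).toFun s) = B.trivForm i (D.toFun s) +
      t • (B.trivForm i (D'.toFun s) + (-1 : ℝ) • B.trivForm i (D.toFun s)) := fun s => by
    rw [← trivForm_smul, ← trivForm_add, ← trivForm_smul, ← trivForm_add]
    rfl
  funext x
  ext ξ : 1
  simp only [Connection.form, Connection.formDiff, h1, Pi.add_apply,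
    Pi.smul_apply, ContinuousAlternatingMap.add_apply, ContinuousAlternatingMap.smul_apply,
    ContinuousAlternatingMap.sum_apply, ContinuousLinearMap.compContinuousAlternatingMap_coe,
    Function.comp_apply, _root_.map_add, map_smul, Finset.sum_add_distrib, Finset.smul_sum,
    smul_add]

lemma Connection.form_interpolate_zero : (D.interpolate D' 0).form e φ = D.form e φ := by
  rw [form_interpolate, zero_smul, add_zero]

lemma Connection.form_interpolate_one : (D.interpolate D' 1).form e φ = D'.form e φ := by
  rw [form_interpolate, formDiff, one_smul, neg_one_smul, add_comm, neg_add_cancel_right]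

/-- The difference of two connections is an endomorphism valued form. -/
lemma Connection.exists_difference (hW : ∀ x, IsFGP A (W x)) :
    ∃ θ : DForm E (fun x => EndA A (W x)) 1, ∀ (i : ι) (n : ℕ) (e : Fin n → V i)
      (φ : Fin n → HomA A (V i) A), (∀ v, ∑ a, e a <• ((φ a).1 v) = v) →
      ∀ (x : M) (hx : x ∈ B.U i) ξ, B.endToTriv hx (θ x ξ) = D.formDiff D' e φ x ξ := by
  choose i hi using B.exists_mem_U
  choose n e φ hf using fun x => exists_frame_of_mem hW (hi x)
  -- The differentials of s cancel, so the difference of the connections at x depends only on s x.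
  -- As the left side is transported from the fibre itself, the endomorphism built in the chosen
  -- trivialization has the required form in every other.
  have key : ∀ (i : ι) (n : ℕ) (e : Fin n → V i) (φ : Fin n → HomA A (V i) A),
      (∀ v, ∑ a, e a <• ((φ a).1 v) = v) → ∀ (x : M) (_ : x ∈ B.U i) ξ (s : ∀ x, W x),
      B.IsSmoothSection s → B.triv i x (D'.toFun s x ξ - D.toFun s x ξ) =
        (D.formDiff D' e φ x ξ).toCLM (B.triv i x (s x)) := by
    intro i n e φ h x hx ξ s hs
    rw [_root_.map_sub, D.triv_toFun h hs hx, D'.triv_toFun h hs hx, add_sub_add_left_eq_sub]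
    rw [formDiff, Pi.add_apply, ContinuousAlternatingMap.add_apply, EndR.add_toCLM, Pi.smul_apply,
      ContinuousAlternatingMap.smul_apply, EndR.smul_toCLM, neg_one_smul, sub_eq_add_neg]
  refine ⟨fun x => (EndR.conjSymm (B.symm_hom (i x) x (hi x))
    (B.triv_hom (i x) x (hi x))).compContinuousAlternatingMap (D.formDiff D' (e x) (φ x) x),
    fun j m e' φ' hf' x hx ξ => ?_⟩
  ext v
  obtain ⟨s, hs, hsx⟩ := B.exists_section_eq x (B.symm j x v)
  have h1 := key _ _ _ _ (hf x) x (hi x) ξ s hs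
  have h2 := key _ _ _ _ hf' x hx ξ s hs
  rw [hsx, B.triv_symm j x hx] at h2
  rw [← h2, toCLM_endToTriv, ← hsx, ← B.symm_triv (i x) x (hi x) (D'.toFun s x ξ - _), h1]
  rfl

end SmoothHilbertBundle

end Connections

/-! ### Exact forms and polynomial families. -/

section Exact

variable {E : Type*} [NormedAddCommGroup E] [NormedSpace ℝ E]
  {M : Type*} [TopologicalSpace M] [ChartedSpace E M]
  {F : Type*} [NormedAddCommGroup F] [NormedSpace ℝ F]

variable (E M F) in
/-- The differentials of smooth forms. -/
def DForm.exact (p : ℕ) : Submodule ℝ (DForm E (fun _ : M => F) (p + 1)) where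
  carrier := {β | ∃ η : DForm E (fun _ : M => F) p, η.IsSmooth ∧ η.d = β}
  add_mem' := by
    rintro _ _ ⟨η, h, rfl⟩ ⟨θ, t, rfl⟩
    exact ⟨η + θ, h.add t, DForm.d_add h t⟩
  zero_mem' := ⟨0, DForm.isSmooth_zero, DForm.d_zero⟩
  smul_mem' := by
    rintro c _ ⟨η, h, rfl⟩
    exact ⟨c • η, h.smul c, DForm.d_smul η c⟩

/-- If a family of forms depends polynomially on a parameter and its derivatives are exact, then the
differences of its members are exact. -/
lemma DForm.sub_mem_exact {p N : ℕ} {P : ℝ → DForm E (fun _ : M => F) (p + 1)}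
    (hP : ∀ x, (fun t => P t x) ∈ polyCurves (TangentSpace 𝓘(ℝ, E) x [⋀^Fin (p + 1)]→L[ℝ] F) N)
    {Q : ℝ → DForm E (fun _ : M => F) (p + 1)} (hQ : ∀ t, Q t ∈ DForm.exact E M F p)
    (h : ∀ x v t, HasDerivAt (fun s => P s x v) (Q t x v) t) :
    P 1 - P 0 ∈ DForm.exact E M F p := by
  choose c hc using fun x => exists_coeff_of_mem_polyCurves (hP x)
  have h1 : ∀ t, P t = ∑ m ∈ Finset.range N, t ^ m • (fun x => c x m) := by
    intro t
    funext x
    rw [Finset.sum_apply]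
    exact hc x t
  rw [h1 1, h1 0]
  refine sub_mem_of_deriv_mem fun t => ?_
  -- The formal derivative of the polynomial is Q t: at each point and tuple of vectors both are the
  -- derivative of the same curve in F.
  convert hQ t using 1
  funext x
  ext v
  rw [Finset.sum_apply, ContinuousAlternatingMap.sum_apply]
  have h2 : ∀ s, P s x v = ∑ m ∈ Finset.range N, s ^ m • c x m v := by
    intro s
    rw [h1 s, Finset.sum_apply, ContinuousAlternatingMap.sum_apply]
    rfl
  have h3 : HasDerivAt (fun s => P s x v)
      (∑ m ∈ Finset.range N, (m * t ^ (m - 1)) • c x m v) t := by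
    simp only [h2]
    exact HasDerivAt.fun_sum fun m _ => (hasDerivAt_pow m t).smul_const _
  exact h3.unique (h x v t)

end Exact

/-! ### Transgression between two connections. -/

section Connections

variable {A : Type*} [CStarAlgebra A] [PartialOrder A] [StarOrderedRing A]
  {E : Type*} [NormedAddCommGroup E] [NormedSpace ℝ E]
  {M : Type*} [TopologicalSpace M] [ChartedSpace E M]
  {W : M → Type*} [∀ x, NormedAddCommGroup (W x)] [∀ x, NormedSpace ℂ (W x)]
  [∀ x, Module Aᵐᵒᵖ (W x)] [∀ x, HilbertModule A (W x)]
  {ι : Type*} {V : ι → Type*} [∀ i, NormedAddCommGroup (V i)] [∀ i, NormedSpace ℂ (V i)]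
  [∀ i, Module Aᵐᵒᵖ (V i)] [∀ i, HilbertModule A (V i)]
  [FiniteDimensional ℝ E] [T2Space M] [IsManifold 𝓘(ℝ, E) ∞ M]

open HilbertModule

namespace SmoothHilbertBundle

variable {B : SmoothHilbertBundle A E W V} (D : B.Connection) {i : ι} {n : ℕ} {e : Fin n → V i}
  {φ : Fin n → HomA A (V i) A}

variable {Z : Type*} [NonUnitalCommCStarAlgebra Z] {τ : A →L[ℂ] Z}
  (hτ : ∀ a b : A, τ (a * b) = τ (b * a)) (hW : ∀ x, IsFGP A (W x)) (D' : B.Connection)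

/-- The transgression form of a family of curvatures. -/
def transgression (Ω : DForm E (fun x => EndA A (W x)) 2) (θ : DForm E (fun x => EndA A (W x)) 1)
    (k : ℕ) : DForm E (fun _ : M => Z) (2 * k + 1) :=
  fun x => traceForm hτ hW x (wedge (ContinuousLinearMap.mul ℝ (EndA A (W x)))
    (wedgePow (Ω x) k) (θ x))

lemma transgression_eq (h : ∀ v, ∑ a, e a <• ((φ a).1 v) = v)
    {Ω : DForm E (fun x => EndA A (W x)) 2} (hΩ : D.IsCurvature Ω)
    {θ : DForm E (fun x => EndA A (W x)) 1} {x : M} (hx : x ∈ B.U i)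
    {δ : DForm E (fun _ : M => EndR A (V i)) 1} (hδ : ∀ ξ, B.endToTriv hx (θ x ξ) = δ x ξ) (k : ℕ) :
    transgression hτ hW Ω θ k x = (frameTrace τ e φ).compContinuousAlternatingMap
      (wedge (ContinuousLinearMap.mul ℝ (EndR A (V i))) (wedgePow ((D.form e φ).curvature x) k)
        (δ x)) :=
  traceForm_eq hτ hW h hx (map_wedge_apply (endToTriv_add hx) (endToTriv_smul hx)
    (endToTriv_mul hx) (map_wedgePow_apply (endToTriv_add hx) (endToTriv_smul hx)
      (endToTriv_mul hx) (endToTriv_one hx) (D.endToTriv_of_extends h hΩ.2 hx) k) hδ)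

/-- Along the interpolated connections the Chern form is polynomial in t, and its derivative is the
differential of a multiple of `transgression`. The latter is a global form because the difference of
two connections is a global endomorphism valued form. -/
theorem chernForm_sub_mem_exact {Ω Ω' : DForm E (fun x => EndA A (W x)) 2} (hΩ : D.IsCurvature Ω)
    (hΩ' : D'.IsCurvature Ω') (k : ℕ) :
    (chernForm τ hτ hW Ω' (k + 1) - chernForm τ hτ hW Ω (k + 1) :
      DForm E (fun _ : M => Z) (2 * k + 1 + 1)) ∈ DForm.exact E M Z (2 * k + 1) := by
  choose Ωt hΩt using fun t => ((D.interpolate D' t).existsUnique_curvature hW).exists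
  obtain ⟨θ, hθ⟩ := D.exists_difference D' hW
  choose i hi using B.exists_mem_U
  choose n e φ hf using fun x => exists_frame_of_mem hW (hi x)
  -- The Chern form depends on the curvature only through the local connection forms, which at t = 1
  -- are those of D' and at t = 0 those of D.
  have hP1 : chernForm τ hτ hW (Ωt 1) (k + 1) = chernForm τ hτ hW Ω' (k + 1) := by
    funext x
    rw [chernForm_eq _ hτ hW (hf x) (hΩt 1) _ (hi x), chernForm_eq _ hτ hW (hf x) hΩ' _ (hi x),
      D.form_interpolate_one]
  have hP0 : chernForm τ hτ hW (Ωt 0) (k + 1) = chernForm τ hτ hW Ω (k + 1) := by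
    funext x
    rw [chernForm_eq _ hτ hW (hf x) (hΩt 0) _ (hi x), chernForm_eq _ hτ hW (hf x) hΩ _ (hi x),
      D.form_interpolate_zero]
  have hQ : ∀ t x, ∀ y ∈ B.U (i x),
      (fun y => (frameTrace τ (e x) (φ x)).compContinuousAlternatingMap
      (wedge (ContinuousLinearMap.mul ℝ (EndR A (V (i x))))
        (wedgePow ((D.form (e x) (φ x) + t • D.formDiff D' (e x) (φ x)).curvature y) k)
        (D.formDiff D' (e x) (φ x) y)) : DForm E (fun _ : M => Z) (2 * k + 1)) y =
      transgression hτ hW (Ωt t) θ k y := by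
    intro t x y hy
    rw [transgression_eq _ hτ hW (hf x) (hΩt t) hy (hθ _ _ _ _ (hf x) y hy),
      D.form_interpolate D' t]
  have hQs : ∀ t, (transgression hτ hW (Ωt t) θ k).IsSmooth := by
    intro t
    refine DForm.isSmooth_iff_smoothOn.2 (DForm.smoothOn_of_locally fun x _ =>
      ⟨B.U (i x), B.isOpen_U _, hi x, DForm.SmoothOn.congr ?_ (hQ t x)⟩)
    have h1 := D.smoothOn_formDiff D' (e := e x) (φ := φ x)
    exact ((((D.smoothOn_form.add (h1.const_smul t)).curvature (B.isOpen_U _)).wedgePow k).wedge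
      (ContinuousLinearMap.mul ℝ (EndR A (V (i x)))) h1).comp_clm (frameTrace τ (e x) (φ x))
  -- The bound N exceeds by one the degree 2(k + 1) of the power of a quadratic. In Q, the factor
  -- 1/(k + 1)! comes from the exponential and k + 1 from differentiating the power.
  have key := DForm.sub_mem_exact (E := E) (M := M) (F := Z) (p := 2 * k + 1)
    (N := (k + 1) * 2 + 1) (P := fun t => chernForm τ hτ hW (Ωt t) (k + 1))
    (Q := fun t => (((k + 1).factorial : ℝ)⁻¹) • ((k + 1 : ℕ) : ℝ) •
      (transgression hτ hW (Ωt t) θ k).d) ?_ ?_ ?_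
  · rw [← hP1, ← hP0]
    exact key
  · intro x
    have h1 := DForm.polyCurves_wedgePow_curvature (frameTrace τ (e x) (φ x)) (B.isOpen_U (i x))
      (D.smoothOn_form (e := e x) (φ := φ x)) (D.smoothOn_formDiff D' (e := e x) (φ := φ x))
      (hi x) (k + 1)
    have h2 := Submodule.smul_mem _ (((k + 1).factorial : ℝ)⁻¹) h1
    refine (congrArg (· ∈ polyCurves (TangentSpace 𝓘(ℝ, E) x [⋀^Fin (2 * (k + 1))]→L[ℝ] Z) _)
      (funext fun t => ?_)).mp h2
    rw [chernForm_eq _ hτ hW (hf x) (hΩt t) _ (hi x), D.form_interpolate D' t]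
    rfl
  · exact fun t => Submodule.smul_mem _ _ (Submodule.smul_mem _ _ ⟨_, hQs t, rfl⟩)
  · intro x v t
    have h1 := (DForm.hasDerivAt_trace_wedgePow_curvature (frameTrace τ (e x) (φ x))
      (frameTrace_mul_comm τ hτ (hf x)) (B.isOpen_U (i x))
      (D.smoothOn_form (e := e x) (φ := φ x)) (D.smoothOn_formDiff D' (e := e x) (φ := φ x))
      (hi x) k t v).const_smul
        (((k + 1).factorial : ℝ)⁻¹)
    rw [DForm.d_congr (B.isOpen_U (i x)) (hQ t x) (hi x)] at h1
    refine h1.congr_of_eventuallyEq (Filter.Eventually.of_forall fun s => ?_)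
    have h2 := chernForm_eq _ hτ hW (hf x) (hΩt s) (k + 1) (hi x)
    rw [D.form_interpolate D' s] at h2
    exact DFunLike.congr_fun h2 v

end SmoothHilbertBundle

end Connections

end

theorem mainTheorem12
    {A : Type*} [CStarAlgebra A] [PartialOrder A] [StarOrderedRing A]
    {Z : Type*} [NonUnitalCommCStarAlgebra Z]
    (τ : A →L[ℂ] Z) (hτ : ∀ a b : A, τ (a * b) = τ (b * a))
    {E : Type*} [NormedAddCommGroup E] [NormedSpace ℝ E] [FiniteDimensional ℝ E]
    {M : Type*} [TopologicalSpace M] [T2Space M] [ChartedSpace E M] [IsManifold 𝓘(ℝ, E) ∞ M]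
    {W : M → Type*} [∀ x, NormedAddCommGroup (W x)] [∀ x, NormedSpace ℂ (W x)]
    [∀ x, Module Aᵐᵒᵖ (W x)] [∀ x, HilbertModule A (W x)]
    {ι : Type*} {V : ι → Type*} [∀ i, NormedAddCommGroup (V i)] [∀ i, NormedSpace ℂ (V i)]
    [∀ i, Module Aᵐᵒᵖ (V i)] [∀ i, HilbertModule A (V i)]
    (B : SmoothHilbertBundle A E W V) (hW : ∀ x, IsFGP A (W x)) :
    -- every connection has a well-defined curvature
    (∀ D : B.Connection, ∃! Ω, D.IsCurvature Ω) ∧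
    -- the forms `ch_τ(Ω)` are (smooth and) closed
    (∀ (D : B.Connection) (Ω : DForm E (fun x => EndA A (W x)) 2), D.IsCurvature Ω →
      ∀ k, chernForm τ hτ hW Ω k ∈ closedForms E M Z (2 * k)) ∧
    -- their cohomology classes do not depend on the connection
    (∀ (D D' : B.Connection) (Ω Ω' : DForm E (fun x => EndA A (W x)) 2),
      D.IsCurvature Ω → D'.IsCurvature Ω' →
      ∀ k (h : chernForm τ hτ hW Ω k ∈ closedForms E M Z (2 * k))
        (h' : chernForm τ hτ hW Ω' k ∈ closedForms E M Z (2 * k)),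
        deRhamClass (chernForm τ hτ hW Ω k) h = deRhamClass (chernForm τ hτ hW Ω' k) h') := by
  refine ⟨fun D => D.existsUnique_curvature hW, fun D Ω hΩ k =>
    SmoothHilbertBundle.chernForm_mem_closedForms D hτ hW hΩ k, fun D D' Ω Ω' hΩ hΩ' k h h' => ?_⟩
  cases k with
  -- In degree 0 the form is τ(ev(1)), which does not involve the connection.
  | zero => rfl
  | succ k =>
    -- The degree 2(k + 1) reduces to a successor, where exactness means having a smooth primitive.
    -- The quotient asks for the form of Ω minus that of Ω', so the two connections enter in
    -- exchanged roles.
    refine (Submodule.Quotient.eq _).2 ?_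
    exact SmoothHilbertBundle.chernForm_sub_mem_exact D' hτ hW D hΩ' hΩ k
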